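/- Let $\mathbb F\in\{\mathbb R,\mathbb C\}$ and let $d\ge 2$ be an integer. Write $\langle\xi\rangle=(1+|\xi|^2)^{1/2}$ and use the Fourier transform $\hat f(\xi)=\int f(x)e^{-2\pi i x\cdot\xi}\,dx$, extended to tempered distributions. For $s,r,\delta\in\mathbb R$ let $$X^s_{r,\delta}=\Big\{f\in\mathscr S'(\mathbb R^d;\mathbb F):\ \hat f\in L^1_{\rm loc},\ \|f\|_{X^s_{r,\delta}}^2=\int_{|\xi|<1}\frac{\xi_1^2+|\xi|^{2\delta}}{|\xi|^{2r}}|\hat f(\xi)|^2d\xi+\int_{|\xi|\ge1}\langle\xi\rangle^{2s}|\hat f(\xi)|^2d\xi<\infty\Big\},$$ and let $H^s\cap\dot H^{-r}$ be the space of $f\in\mathscr S'(\mathbb R^d;\mathbb F)$ with $\hat f\in L^1_{\rm loc}$ and $\|f\|^2=\int(\langle\xi\rangle^{2s}+|\xi|^{-2r})|\hat f(\xi)|^2d\xi<\infty$. Let $s,r,\delta,\sigma\in\mathbb R$ satisfy $\delta>1$, $d>1+\delta-2r$, $0\le r\le1$, $\sigma\le s$, $1-r\le s$ and $s+\sigma>d/2$;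 if $d=2$, suppose also $\delta\le2$. Let $\gamma\in\mathbb R\setminus\{0\}$. Let $\varphi:\mathbb R^d\to[0,\infty)$ be continuous, with $\varphi(\xi)\asymp|\xi|^\delta$ as $\xi\to0$ and $\varphi(\xi)\asymp|\xi|^\sigma$ as $|\xi|\to\infty$, and with $\varphi(\xi)\ne0$ whenever $\xi\neq0$ and $\xi_1=0$; if $\mathbb F=\mathbb R$, suppose also that $\varphi$ is even. Let $\varphi(D)$ be the operator $\widehat{\varphi(D)g}=\varphi\,\hat g$, defined when $\hat g$ is a locally integrable function. Let $R>0$ and let $\zeta,\psi$ be $\mathbb F$-valued functions given on $B(0,R)\subseteq\mathbb F$ by power series centred at $0$ converging there, with $\zeta(0)=\psi(0)=0$, $\zeta'(0)=\alpha\in\mathbb R\setminus\{0\}$ and $\psi'(0)=\beta\in\mathbb R\setminus\{0\}$. Then there are $\rho\in(0,R]$ and an open set $\mathcal U\subseteq H^s\cap\dot H^{-r}$ containing $0$ (in particular nonempty) such that for every $f\in\mathcal U$ there is exactly one $u\in X^{s+\sigma}_{r,\delta}$ which is a continuous function with $|u(x)|<\rho$ for all $x\in\mathbb R^d$ and which solves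 $$-\gamma\,\partial_1[\zeta(u)]+\varphi(D)\psi(u)=f$$ in the sense of tempered distributions. Moreover the map $\mathcal U\ni f\mapsto u\in X^{s+\sigma}_{r,\delta}$ is analytic (over $\mathbb F$). -/

import Mathlib

open MeasureTheory SchwartzMap FourierTransform LineDeriv Filter Topology
open scoped ContDiff

noncomputable section

/-- `ℝᵈ` with the Euclidean norm; the first coordinate `ξ₁` is `ξ 0`. -/
abbrev Space (d : ℕ) : Type := EuclideanSpace ℝ (Fin d)

/-- A tempered distribution vanishing on all compactly supported test functions is zero. -/
theorem tempered_eq_zero_of_compact {d : ℕ} (T : 𝓢'(Space d, ℂ))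
    (hT : ∀ θ : 𝓢(Space d, ℂ), HasCompactSupport θ → T θ = 0) : T = 0 := by
  ext θ
  let b : ContDiffBump (0 : Space d) := ⟨1, 2, one_pos, one_lt_two⟩
  have hb : ContDiff ℝ ∞ (fun x => ((b x : ℝ) : ℂ)) :=
    Complex.ofRealCLM.contDiff.comp b.contDiff
  have hbs : HasCompactSupport (fun x => ((b x : ℝ) : ℂ)) :=
    b.hasCompactSupport.comp_left (g := fun r : ℝ => (r : ℂ)) (by simp)
  let η : Space d → ℂ := fun x => 1 - ((b x : ℝ) : ℂ)
  have hη : ContDiff ℝ ∞ η := contDiff_const.sub hb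
  -- derivatives of the cut-off are bounded
  have hC : ∀ i : ℕ, ∃ C : ℝ, 0 ≤ C ∧ ∀ x, ‖iteratedFDeriv ℝ i η x‖ ≤ C := by
    intro i
    obtain ⟨C, hC⟩ := ((hb.continuous_iteratedFDeriv (m := i) (by exact_mod_cast le_top)).norm
      ).bddAbove_range_of_hasCompactSupport (hbs.iteratedFDeriv i).norm
    refine ⟨1 + C, ?_, ?_⟩
    · have := hC ⟨0, rfl⟩
      have h2 := norm_nonneg (iteratedFDeriv ℝ i (fun x => ((b x : ℝ) : ℂ)) 0)
      simp only at this
      linarith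
    · intro x
      have h1 : iteratedFDeriv ℝ i η x = iteratedFDeriv ℝ i (fun _ : Space d => (1 : ℂ)) x
          - iteratedFDeriv ℝ i (fun x => ((b x : ℝ) : ℂ)) x :=
        iteratedFDeriv_sub_apply contDiff_const.contDiffAt
          ((hb.of_le (by exact_mod_cast le_top)).contDiffAt)
      rw [h1]
      refine (norm_sub_le _ _).trans (add_le_add ?_ (hC ⟨x, rfl⟩))
      rcases Nat.eq_zero_or_pos i with rfl | hi
      · simp
      · rw [iteratedFDeriv_const_of_ne hi.ne']; simp
  choose C hC0 hC using hC
  -- the cut-offs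
  let c : ℕ → ℝ := fun n => 1 / ((n : ℝ) + 1)
  have hc0 : ∀ n, 0 < c n := fun n => by positivity
  have hc1 : ∀ n, c n ≤ 1 := fun n => by
    simp only [c]; rw [div_le_one (by positivity)]; linarith [(Nat.cast_nonneg n : (0 : ℝ) ≤ n)]
  have hclim : Tendsto c atTop (𝓝 0) := tendsto_one_div_add_atTop_nhds_zero_nat
  have hbn : ∀ n, ContDiff ℝ ∞ (fun x : Space d => ((b (c n • x) : ℝ) : ℂ)) := fun n =>
    hb.comp (contDiff_const_smul (c n))
  have hbns : ∀ n, HasCompactSupport (fun x : Space d => ((b (c n • x) : ℝ) : ℂ)) := fun n =>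
    hbs.comp_homeomorph (Homeomorph.smulOfNeZero (c n) (hc0 n).ne')
  let θn : ℕ → 𝓢(Space d, ℂ) := fun n =>
    HasCompactSupport.toSchwartzMap (f := fun x => ((b (c n • x) : ℝ) : ℂ) * θ x)
      ((hbns n).mul_right) ((hbn n).mul (θ.smooth ⊤))
  have hz : ∀ n, T (θn n) = 0 := fun n => hT _ ((hbns n).mul_right)
  have hηc : ∀ n i x, ‖iteratedFDeriv ℝ i (fun y => η (c n • y)) x‖ ≤ C i * (c n * ‖x‖) := by
    intro n i x
    rw [iteratedFDeriv_comp_const_smul (c n) (hη.of_le (by exact_mod_cast le_top))]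
    rw [norm_smul, norm_pow, Real.norm_eq_abs, abs_of_pos (hc0 n)]
    by_cases hx : c n * ‖x‖ < 1
    · have : iteratedFDeriv ℝ i η (c n • x) = 0 := by
        have he : η =ᶠ[𝓝 (c n • x)] fun _ => (0 : ℂ) := by
          have : c n • x ∈ Metric.ball (0 : Space d) 1 := by
            rw [mem_ball_zero_iff, norm_smul, Real.norm_eq_abs, abs_of_pos (hc0 n)]; exact hx
          filter_upwards [Metric.isOpen_ball.mem_nhds this] with y hy
          simp only [η]
          rw [b.one_of_mem_closedBall (Metric.ball_subset_closedBall hy)]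
          simp
        rw [(he.iteratedFDeriv ℝ i).eq_of_nhds]
        exact congrFun iteratedFDeriv_fun_zero _
      rw [this, norm_zero, mul_zero]
      have := hC0 i; have := hc0 n; positivity
    · push Not at hx
      calc c n ^ i * ‖iteratedFDeriv ℝ i η (c n • x)‖ ≤ 1 * C i :=
            mul_le_mul (pow_le_one₀ (hc0 n).le (hc1 n)) (hC _ _) (norm_nonneg _) zero_le_one
        _ ≤ C i * (c n * ‖x‖) := by rw [one_mul]; exact le_mul_of_one_le_right (hC0 i) hx
  have hlim : Tendsto (fun n => θn n) atTop (𝓝 θ) := by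
    rw [(schwartz_withSeminorms ℝ (Space d) ℂ).tendsto_nhds]
    rintro ⟨k, l⟩ ε hε
    let M : ℝ := ∑ i ∈ Finset.range (l + 1),
      (l.choose i : ℝ) * C i * SchwartzMap.seminorm ℝ (k + 1) (l - i) θ
    have hM : 0 ≤ M := Finset.sum_nonneg fun i _ =>
      mul_nonneg (mul_nonneg (Nat.cast_nonneg _) (hC0 i)) (apply_nonneg _ _)
    have hle : ∀ n, SchwartzMap.seminorm ℝ k l (θn n - θ) ≤ c n * M := by
      intro n
      refine SchwartzMap.seminorm_le_bound ℝ k l _ (mul_nonneg (hc0 n).le hM) ?_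
      intro x
      have hfun : ((θn n - θ : 𝓢(Space d, ℂ)) : Space d → ℂ) =
          fun y => - (η (c n • y) * θ y) := by
        funext y
        simp only [sub_apply, η, θn, HasCompactSupport.toSchwartzMap_toFun]
        ring
      rw [hfun]
      have hneg : iteratedFDeriv ℝ l (fun y => - (η (c n • y) * θ y)) x =
          - iteratedFDeriv ℝ l (fun y => η (c n • y) * θ y) x := iteratedFDeriv_neg_apply
      rw [hneg, norm_neg]
      have hp := norm_iteratedFDeriv_mul_le (𝕜 := ℝ) (f := fun y => η (c n • y)) (g := θ)
        (N := ∞) (hη.comp (contDiff_const_smul (c n))) (θ.smooth ⊤) x (n := l)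
        (by exact_mod_cast le_top)
      calc ‖x‖ ^ k * ‖iteratedFDeriv ℝ l (fun y => η (c n • y) * θ y) x‖
          ≤ ‖x‖ ^ k * ∑ i ∈ Finset.range (l + 1), (l.choose i : ℝ) *
            ‖iteratedFDeriv ℝ i (fun y => η (c n • y)) x‖ * ‖iteratedFDeriv ℝ (l - i) θ x‖ := by
              gcongr
        _ ≤ c n * M := by
          simp only [M]
          rw [Finset.mul_sum, Finset.mul_sum]
          refine Finset.sum_le_sum fun i _ => ?_
          have h1 := hηc n i x
          have h2 := SchwartzMap.le_seminorm ℝ (k + 1) (l - i) θ x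
          calc ‖x‖ ^ k * ((l.choose i : ℝ) * ‖iteratedFDeriv ℝ i (fun y => η (c n • y)) x‖ *
                ‖iteratedFDeriv ℝ (l - i) θ x‖)
              ≤ ‖x‖ ^ k * ((l.choose i : ℝ) * (C i * (c n * ‖x‖)) *
                ‖iteratedFDeriv ℝ (l - i) θ x‖) := by gcongr
            _ = c n * ((l.choose i : ℝ) * C i *
                (‖x‖ ^ (k + 1) * ‖iteratedFDeriv ℝ (l - i) θ x‖)) := by ring
            _ ≤ _ := by
              have := hC0 i; have := (hc0 n).le
              gcongr
    have : Tendsto (fun n => c n * M) atTop (𝓝 0) := by simpa using hclim.mul_const M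
    filter_upwards [this.eventually (gt_mem_nhds hε)] with n hn
    exact (hle n).trans_lt hn
  have h1 := (T.continuous.tendsto θ).comp hlim
  have h2 : Tendsto (fun n => T (θn n)) atTop (𝓝 0) := by simp [hz]
  exact tendsto_nhds_unique h1 h2

/-- The tempered distribution `T` is a locally integrable function, namely `g`. -/
def IsFunction {d : ℕ} (T : 𝓢'(Space d, ℂ)) (g : Space d → ℂ) : Prop :=
  LocallyIntegrable g volume ∧
    ∀ θ : 𝓢(Space d, ℂ), HasCompactSupport θ → T θ = ∫ x, θ x * g x

/-- The tempered distribution `T` is `𝕜`-valued, i.e. it takes values in `𝕜 ⊆ ℂ` on real test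
functions.  This is no condition for `𝕜 = ℂ`, and says that `T` is real for `𝕜 = ℝ`. -/
def IsValuedIn (𝕜 : Type*) [RCLike 𝕜] [NormedAlgebra 𝕜 ℂ] {d : ℕ} (T : 𝓢'(Space d, ℂ)) : Prop :=
  ∀ θ : 𝓢(Space d, ℂ), (∀ x, (θ x).im = 0) → T θ ∈ Set.range (algebraMap 𝕜 ℂ)

namespace IsFunction

variable {d : ℕ} {S T : 𝓢'(Space d, ℂ)} {g h : Space d → ℂ}

theorem integrable_mul (hg : LocallyIntegrable g volume) (θ : 𝓢(Space d, ℂ))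
    (hθ : HasCompactSupport θ) : Integrable (fun x => θ x * g x) := by
  simpa [smul_eq_mul] using hg.integrable_smul_left_of_hasCompactSupport θ.continuous hθ

theorem zero : IsFunction (0 : 𝓢'(Space d, ℂ)) 0 :=
  ⟨locallyIntegrable_zero, fun θ _ => by simp⟩

theorem add (hS : IsFunction S g) (hT : IsFunction T h) : IsFunction (S + T) (g + h) := by
  refine ⟨hS.1.add hT.1, fun θ hθ => ?_⟩
  have : (S + T) θ = S θ + T θ := rfl
  rw [this, hS.2 θ hθ, hT.2 θ hθ, ← integral_add (integrable_mul hS.1 θ hθ)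
    (integrable_mul hT.1 θ hθ)]
  simp [mul_add]

theorem smul (c : ℂ) (hT : IsFunction T h) : IsFunction (c • T) (c • h) := by
  refine ⟨hT.1.smul c, fun θ hθ => ?_⟩
  have : (c • T) θ = c * T θ := rfl
  rw [this, hT.2 θ hθ, ← integral_const_mul]
  congr 1
  funext x
  simp only [Pi.smul_apply, smul_eq_mul]
  ring

theorem ae_eq (hg : IsFunction T g) (hh : IsFunction T h) : g =ᵐ[volume] h := by
  refine ae_eq_of_integral_contDiff_smul_eq hg.1 hh.1 fun χ hχ hχs => ?_
  have h₁ : HasCompactSupport (Complex.ofRealCLM ∘ χ) := hχs.comp_left rfl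
  have h₂ : ContDiff ℝ ∞ (Complex.ofRealCLM ∘ χ) := by fun_prop
  have e := (hg.2 (h₁.toSchwartzMap h₂) h₁).symm.trans (hh.2 (h₁.toSchwartzMap h₂) h₁)
  simpa using e

theorem eq_zero (hT : IsFunction T g) (hg : g =ᵐ[volume] 0) : T = 0 := by
  refine tempered_eq_zero_of_compact T fun θ hθ => ?_
  rw [hT.2 θ hθ]
  refine integral_eq_zero_of_ae ?_
  filter_upwards [hg] with x hx
  simp [hx]

end IsFunction

/-- A measurable weight on frequency space which is positive almost everywhere. -/
structure FourierWeight (d : ℕ) where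
  toFun : Space d → ℝ
  measurable : Measurable toFun
  pos : ∀ᵐ ξ, 0 < toFun ξ

/-- The `𝕜`-valued tempered distributions `f` with `f̂ ∈ L¹_loc` and `∫ w |f̂|² < ∞`. -/
def weightedFourierSubmodule (𝕜 : Type*) [RCLike 𝕜] [NormedAlgebra 𝕜 ℂ] {d : ℕ}
    (w : FourierWeight d) : Submodule 𝕜 𝓢'(Space d, ℂ) where
  carrier := {f | IsValuedIn 𝕜 f ∧ ∃ g : Space d → ℂ, IsFunction (𝓕 f) g ∧
    Integrable (fun ξ => w.toFun ξ * ‖g ξ‖ ^ 2)}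
  zero_mem' := by
    refine ⟨fun θ _ => ⟨0, by simp⟩, 0, ?_, by simp⟩
    have : 𝓕 (0 : 𝓢'(Space d, ℂ)) = 0 := FourierTransform.fourier_zero
    rw [this]; exact IsFunction.zero
  add_mem' := by
    rintro f₁ f₂ ⟨r₁, g₁, h₁, i₁⟩ ⟨r₂, g₂, h₂, i₂⟩
    refine ⟨fun θ hθ => ?_, g₁ + g₂, ?_, ?_⟩
    · obtain ⟨a, ha⟩ := r₁ θ hθ
      obtain ⟨b, hb⟩ := r₂ θ hθ
      refine ⟨a + b, ?_⟩
      rw [map_add, ha, hb]; rfl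
    · rw [FourierTransform.fourier_add]; exact h₁.add h₂
    · refine ((i₁.const_mul 2).add (i₂.const_mul 2)).mono'
        (w.measurable.aestronglyMeasurable.mul
          ((h₁.1.add h₂.1).aestronglyMeasurable.norm.pow 2)) ?_
      filter_upwards [w.pos] with ξ hξ
      rw [Real.norm_eq_abs, abs_of_nonneg (by positivity)]
      simp only [Pi.add_apply]
      have := norm_add_le (g₁ ξ) (g₂ ξ)
      have h3 : ‖g₁ ξ + g₂ ξ‖ ^ 2 ≤ 2 * ‖g₁ ξ‖ ^ 2 + 2 * ‖g₂ ξ‖ ^ 2 := by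
        nlinarith [norm_nonneg (g₁ ξ + g₂ ξ), sq_nonneg (‖g₁ ξ‖ - ‖g₂ ξ‖)]
      nlinarith
  smul_mem' := by
    rintro c f ⟨r, g, h, i⟩
    have hc : c • f = (algebraMap 𝕜 ℂ c) • f := (algebraMap_smul ℂ c f).symm
    refine ⟨fun θ hθ => ?_, (algebraMap 𝕜 ℂ c) • g, ?_, ?_⟩
    · obtain ⟨a, ha⟩ := r θ hθ
      refine ⟨c * a, ?_⟩
      rw [map_mul, ha, hc]; rfl
    · rw [hc, FourierTransform.fourier_smul]; exact h.smul _
    · refine (i.const_mul (‖algebraMap 𝕜 ℂ c‖ ^ 2)).congr (Eventually.of_forall fun ξ => ?_)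
      simp only [Pi.smul_apply, norm_smul]
      ring

/-- The space of all `𝕜`-valued tempered distributions `f` on `ℝᵈ` with `f̂ ∈ L¹_loc` and
`‖f‖² = ∫ w |f̂|² < ∞`. -/
def WeightedFourierSpace (𝕜 : Type*) [RCLike 𝕜] [NormedAlgebra 𝕜 ℂ] {d : ℕ}
    (w : FourierWeight d) : Type :=
  ↥(weightedFourierSubmodule 𝕜 w)

namespace WeightedFourierSpace

variable {𝕜 : Type*} [RCLike 𝕜] [NormedAlgebra 𝕜 ℂ] {d : ℕ} {w : FourierWeight d}

instance : AddCommGroup (WeightedFourierSpace 𝕜 w) :=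
  inferInstanceAs (AddCommGroup ↥(weightedFourierSubmodule 𝕜 w))

instance : Module 𝕜 (WeightedFourierSpace 𝕜 w) :=
  inferInstanceAs (Module 𝕜 ↥(weightedFourierSubmodule 𝕜 w))

/-- The underlying tempered distribution. -/
def distribution : WeightedFourierSpace 𝕜 w →ₗ[𝕜] 𝓢'(Space d, ℂ) :=
  (weightedFourierSubmodule 𝕜 w).subtype

/-- The Fourier transform as a function. -/
def fourierFun (f : WeightedFourierSpace 𝕜 w) : Space d → ℂ :=
  Classical.choose f.2.2

theorem isFunction_fourierFun (f : WeightedFourierSpace 𝕜 w) :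
    IsFunction (𝓕 (distribution f)) (fourierFun f) :=
  (Classical.choose_spec f.2.2).1

theorem integrable_fourierFun (f : WeightedFourierSpace 𝕜 w) :
    Integrable (fun ξ => w.toFun ξ * ‖fourierFun f ξ‖ ^ 2) :=
  (Classical.choose_spec f.2.2).2

theorem norm_sqrt_mul_sq (f : WeightedFourierSpace 𝕜 w) :
    (fun ξ => ‖((Real.sqrt (w.toFun ξ) : ℝ) : ℂ) * fourierFun f ξ‖ ^ 2) =ᵐ[volume]
      fun ξ => w.toFun ξ * ‖fourierFun f ξ‖ ^ 2 := by
  filter_upwards [w.pos] with ξ hξ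
  rw [norm_mul, mul_pow, Complex.norm_real, Real.norm_eq_abs, sq_abs, Real.sq_sqrt hξ.le]

theorem memLp_sqrt_mul (f : WeightedFourierSpace 𝕜 w) :
    MemLp (fun ξ => ((Real.sqrt (w.toFun ξ) : ℝ) : ℂ) * fourierFun f ξ) 2 volume := by
  refine (memLp_two_iff_integrable_sq_norm ?_).2
    ((integrable_fourierFun f).congr (norm_sqrt_mul_sq f).symm)
  exact (Complex.measurable_ofReal.comp w.measurable.sqrt).aestronglyMeasurable.mul
    (isFunction_fourierFun f).1.aestronglyMeasurable

/-- The isometry `f ↦ √w f̂` into `L²`, through which the norm is defined. -/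
def toL2 : WeightedFourierSpace 𝕜 w →ₗ[𝕜] Lp ℂ 2 (volume : Measure (Space d)) where
  toFun f := (memLp_sqrt_mul f).toLp _
  map_add' f g := by
    rw [← MemLp.toLp_add]
    refine MemLp.toLp_congr _ _ ?_
    have h : IsFunction (𝓕 (distribution (f + g))) (fourierFun f + fourierFun g) := by
      rw [map_add, FourierTransform.fourier_add]
      exact (isFunction_fourierFun f).add (isFunction_fourierFun g)
    filter_upwards [(isFunction_fourierFun (f + g)).ae_eq h] with ξ hξ
    simp only [Pi.add_apply, hξ, mul_add]
  map_smul' c f := by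
    rw [RingHom.id_apply, ← MemLp.toLp_const_smul]
    refine MemLp.toLp_congr _ _ ?_
    have h : IsFunction (𝓕 (distribution (c • f))) ((algebraMap 𝕜 ℂ c) • fourierFun f) := by
      rw [map_smul, ← algebraMap_smul ℂ c (distribution f), FourierTransform.fourier_smul]
      exact (isFunction_fourierFun f).smul _
    filter_upwards [(isFunction_fourierFun (c • f)).ae_eq h] with ξ hξ
    simp only [Pi.smul_apply, hξ, Algebra.smul_def, Algebra.algebraMap_self,
      RingHom.id_apply]
    ring

theorem toL2_injective : Function.Injective (toL2 : WeightedFourierSpace 𝕜 w →ₗ[𝕜] _) := by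
  rw [← LinearMap.ker_eq_bot, LinearMap.ker_eq_bot']
  intro f hf
  have h0 : fourierFun f =ᵐ[volume] 0 := by
    have h1 : (toL2 f : Space d → ℂ) =ᵐ[volume] 0 := by
      rw [hf]; exact Lp.coeFn_zero _ _ _
    have h2 : (toL2 f : Space d → ℂ) =ᵐ[volume]
        fun ξ => ((Real.sqrt (w.toFun ξ) : ℝ) : ℂ) * fourierFun f ξ :=
      MemLp.coeFn_toLp (memLp_sqrt_mul f)
    filter_upwards [h1, h2, w.pos] with ξ h1 h2 h3
    rw [h2] at h1
    have h4 : ((Real.sqrt (w.toFun ξ) : ℝ) : ℂ) ≠ 0 := by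
      simpa using (Real.sqrt_pos.2 h3).ne'
    exact (mul_eq_zero.1 h1).resolve_left h4
  have h3 : 𝓕 (distribution f) = 0 := (isFunction_fourierFun f).eq_zero h0
  have h4 : distribution f = 0 := by
    have h5 : 𝓕⁻ (𝓕 (distribution f)) = distribution f := fourierInv_fourier_eq _
    rw [← h5, h3]
    exact FourierTransform.fourierInv_zero
  exact Subtype.ext h4

instance : NormedAddCommGroup (WeightedFourierSpace 𝕜 w) :=
  NormedAddCommGroup.induced _ _ (toL2 : WeightedFourierSpace 𝕜 w →ₗ[𝕜] _) toL2_injective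

instance : NormedSpace 𝕜 (WeightedFourierSpace 𝕜 w) :=
  NormedSpace.induced 𝕜 _ _ (toL2 : WeightedFourierSpace 𝕜 w →ₗ[𝕜] _)

/-- The norm is `‖f‖² = ∫ w |f̂|²`. -/
theorem norm_sq_eq (f : WeightedFourierSpace 𝕜 w) :
    ‖f‖ ^ 2 = ∫ ξ, w.toFun ξ * ‖fourierFun f ξ‖ ^ 2 := by
  have h1 : ‖f‖ = ‖toL2 f‖ := rfl
  have h2 : ‖toL2 f‖ ^ 2 = RCLike.re (inner ℂ (toL2 f) (toL2 f)) :=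
    (inner_self_eq_norm_sq _).symm
  rw [h1, h2, L2.inner_def, ← integral_re (L2.integrable_inner _ _)]
  refine integral_congr_ae ?_
  filter_upwards [MemLp.coeFn_toLp (memLp_sqrt_mul f), norm_sqrt_mul_sq f] with ξ hξ h3
  rw [← h3, inner_self_eq_norm_sq]
  congr 2

end WeightedFourierSpace

/-- The weight `ω_{s,r,δ}` of the anisotropic space: `(ξ₁² + |ξ|^{2δ}) / |ξ|^{2r}` in the unit
ball and `⟨ξ⟩^{2s} = (1 + |ξ|²)^s` outside. -/
def anisotropicWeight (d : ℕ) [NeZero d] (s r δ : ℝ) : FourierWeight d where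
  toFun ξ :=
    if ‖ξ‖ < 1 then ((ξ 0) ^ 2 + ‖ξ‖ ^ (2 * δ)) / ‖ξ‖ ^ (2 * r) else (1 + ‖ξ‖ ^ 2) ^ s
  measurable := by
    refine Measurable.ite (measurableSet_lt measurable_norm measurable_const) ?_ ?_
    · fun_prop
    · fun_prop
  pos := by
    filter_upwards [Measure.ae_ne volume (0 : Space d)] with ξ hξ
    have := norm_pos_iff.2 hξ
    split_ifs <;> positivity

/-- The weight `⟨ξ⟩^{2s} + |ξ|^{-2r}` of `H^s ∩ Ḣ^{-r}`. -/
def sobolevWeight (d : ℕ) (s r : ℝ) : FourierWeight d where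
  toFun ξ := (1 + ‖ξ‖ ^ 2) ^ s + ‖ξ‖ ^ (-2 * r)
  measurable := by fun_prop
  pos := Eventually.of_forall fun ξ => by positivity

/-- The anisotropic Sobolev space `X^s_{r,δ}(ℝᵈ; 𝕜)`. -/
abbrev XSpace (𝕜 : Type*) [RCLike 𝕜] [NormedAlgebra 𝕜 ℂ] (d : ℕ) [NeZero d] (s r δ : ℝ) : Type :=
  WeightedFourierSpace 𝕜 (anisotropicWeight d s r δ)

/-- The space `(H^s ∩ Ḣ^{-r})(ℝᵈ; 𝕜)`, with `‖f‖² = ‖f‖²_{H^s} + ‖f‖²_{Ḣ^{-r}}`. -/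
abbrev SobolevInter (𝕜 : Type*) [RCLike 𝕜] [NormedAlgebra 𝕜 ℂ] (d : ℕ) (s r : ℝ) :
    Type :=
  WeightedFourierSpace 𝕜 (sobolevWeight d s r)

/-- `Q = φ(D) P`: the Fourier transform of `P` is a function `p`, and that of `Q` is `φ p`. -/
def IsMultiplierImage {d : ℕ} (φ : Space d → ℝ) (P Q : 𝓢'(Space d, ℂ)) : Prop :=
  ∃ p : Space d → ℂ, IsFunction (𝓕 P) p ∧ IsFunction (𝓕 Q) (fun ξ => (φ ξ : ℂ) * p ξ)

/-- The distribution `u` is a continuous function with values in the ball `B(0, ρ)` of `𝕜`, and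
`-γ ∂₁[ζ(u)] + φ(D) ψ(u) = f` in the sense of tempered distributions. -/
def IsSolution {𝕜 : Type*} [RCLike 𝕜] [NormedAlgebra 𝕜 ℂ] {d : ℕ} [NeZero d]
    (φ : Space d → ℝ) (γ : ℝ) (ζ ψ : 𝕜 → 𝕜) (ρ : ℝ) (f u : 𝓢'(Space d, ℂ)) : Prop :=
  ∃ v : Space d → 𝕜, Continuous v ∧ (∀ x, ‖v x‖ < ρ) ∧
    IsFunction u (fun x => algebraMap 𝕜 ℂ (v x)) ∧
    ∃ Z P Q : 𝓢'(Space d, ℂ),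
      IsFunction Z (fun x => algebraMap 𝕜 ℂ (ζ (v x))) ∧
      IsFunction P (fun x => algebraMap 𝕜 ℂ (ψ (v x))) ∧
      IsMultiplierImage φ P Q ∧
      -(γ : ℂ) • ∂_{EuclideanSpace.single (0 : Fin d) (1 : ℝ)} Z + Q = f

end

/-! Write `a = ζ(u) - αu` and `b = ψ(u) - βu`. On the Fourier side the equation is `m û = f̂ + 2πiγ
ξ₁ â - φ b̂` with `m = βφ - 2πiγα ξ₁`, the `linearSymbol`. The two terms of `m` are its real and
imaginary parts, so `|m|` dominates both `|φ|` and `|ξ₁|`. Hence `1/m` maps `H^s ∩ Ḣ^{-r}` boundedly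
into `X` (`exists_anisotropicWeight_le`), while `ξ₁/m` and `φ/m` are bounded multipliers on `X`, and
the nonlinear terms lose no derivatives.

Existence. `X` consists of continuous functions and is closed under products, with `‖uv‖ ≤ C‖u‖‖v‖`.
Analytic functions vanishing at `0` therefore act on it analytically (`exists_nonlinearity`), and
`a`, `b` have vanishing derivative at `u = 0`. The equation becomes `F(u) = A f`, where `A` is the
multiplier `1/m` and `F` is analytic with derivative the identity at `0`; the analytic inverse
function theorem gives a local solution map.

The algebra property (`isAlgebra_anisotropicWeight`). It is a convolution estimate for the weight
`w`. If an input frequency is comparable to the output or larger than `1`, `w` is essentially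
subadditive, and Young's inequality suffices because `1/w` is integrable. The difficult interaction
is that of two low frequencies of comparable size which nearly cancel, since the output then meets
the singularity `|ξ|^{-2r}`. It is absorbed into a kernel times `w w` (`isAlgebra_of_kernel`); the
kernel has uniformly bounded integrals (`exists_lintegral_interactionKernel_le`), which is where the
restriction `δ ≤ 2` for `d = 2` enters.

Uniqueness (`eq_of_isSolution`). Competing solutions are only small in the supremum norm, so the
inverse function theorem does not reach them. For `W = u - v` the symbol bounds give `|Ŵ| ≤ |α|⁻¹|t|
+ |β|⁻¹|y|`, where `t` and `y` are the transforms of differences that are pointwise at most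
`|α||W|/4` and `|β||W|/4`. By Plancherel `‖W‖₂ ≤ ‖W‖₂/2`, hence `W = 0`, as soon as `W` is known to
be in `L²`. This is not automatic, as the weight degenerates at the origin. It follows by
bootstrapping: transforms of elements of `X` lie in `L¹ ∩ L^q` for some `q > 1`, so high powers of
`u` and `v` are in `L²`; after a Taylor expansion `|Ŵ| ≤ K * |Ŵ| + G` with `K ∈ L¹ ∩ L^q` and `G ∈
L²`, and finitely many iterations put `Ŵ` in `L²`. -/

open scoped ComplexConjugate Convolution ENNReal NNReal

/-! ### Distributions given by functions: inversion, Plancherel, derivatives -/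

namespace IsFunction

variable {d : ℕ} {S T : 𝓢'(Space d, ℂ)} {g h : Space d → ℂ}

theorem congr (hT : IsFunction T g) (hg : g =ᵐ[volume] h) : IsFunction T h := by
  refine ⟨hT.1.congr hg, fun θ hθ => (hT.2 θ hθ).trans (integral_congr_ae ?_)⟩
  filter_upwards [hg] with x hx
  rw [hx]

theorem neg (hT : IsFunction T h) : IsFunction (-T) (-h) := by
  have h1 : (-1 : ℂ) • T = -T := by
    ext θ
    exact neg_one_mul (T θ)
  simpa only [h1, neg_smul, one_smul] using hT.smul (-1)

theorem sub (hS : IsFunction S g) (hT : IsFunction T h) : IsFunction (S - T) (g - h) := by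
  simpa [sub_eq_add_neg] using hS.add hT.neg

theorem unique (hS : IsFunction S g) (hT : IsFunction T g) : S = T :=
  sub_eq_zero.1 ((hS.sub hT).eq_zero (by simp))

theorem toTemperedDistribution {p : ℝ≥0∞} [hp : Fact (1 ≤ p)]
    (f : Lp ℂ p (volume : Measure (Space d))) :
    IsFunction (Lp.toTemperedDistribution f) f := by
  refine ⟨(Lp.memLp f).locallyIntegrable hp.elim, fun θ _ => ?_⟩
  simp

/-- Every `Lᵖ` function is a tempered distribution. -/
theorem exists_of_memLp {p : ℝ≥0∞} (hp : 1 ≤ p) (hg : MemLp g p) :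
    ∃ T : 𝓢'(Space d, ℂ), IsFunction T g :=
  have : Fact (1 ≤ p) := ⟨hp⟩
  ⟨_, (toTemperedDistribution (hg.toLp g)).congr hg.coeFn_toLp⟩

/-- `IsFunction` only tests against compactly supported functions. For `Lᵖ` functions the formula
extends to every Schwartz function, because a tempered distribution is determined by its compactly
supported tests. -/
theorem apply_of_memLp {p : ℝ≥0∞} (hp : 1 ≤ p) (hg : MemLp g p) (hT : IsFunction T g)
    (θ : 𝓢(Space d, ℂ)) : T θ = ∫ x, θ x * g x := by
  have : Fact (1 ≤ p) := ⟨hp⟩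
  have h : IsFunction (Lp.toTemperedDistribution (hg.toLp g)) g :=
    (toTemperedDistribution (hg.toLp g)).congr hg.coeFn_toLp
  rw [hT.unique h, Lp.toTemperedDistribution_apply]
  refine integral_congr_ae ?_
  filter_upwards [hg.coeFn_toLp] with x hx
  rw [hx, smul_eq_mul]

theorem memLp_fourierInv (hg : Integrable g) : MemLp (𝓕⁻ g) ∞ := by
  rw [Real.fourierInv_eq_fourier_comp_neg]
  refine memLp_top_of_bound (C := ∫ x, ‖g x‖) ?_ (Eventually.of_forall fun x => ?_)
  · exact (VectorFourier.fourierIntegral_continuous Real.continuous_fourierChar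
      continuous_inner hg.comp_neg).aestronglyMeasurable
  · refine (VectorFourier.norm_fourierIntegral_le_integral_norm _ _ _ _ _).trans_eq ?_
    exact integral_neg_eq_self (fun x => ‖g x‖) volume

/-- If the Fourier transform of `T` is an integrable function `g`, then `T` is the function
`𝓕⁻ g`. -/
theorem fourierInv (hT : IsFunction (𝓕 T) g) (hg : Integrable g) : IsFunction T (𝓕⁻ g) := by
  have hm := memLp_fourierInv hg
  refine ⟨hm.locallyIntegrable le_top, fun θ _ => ?_⟩
  have h1 : T θ = (𝓕 T) (𝓕⁻ θ) := by
    rw [TemperedDistribution.fourier_apply, fourier_fourierInv_eq]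
  rw [h1, hT.apply_of_memLp le_rfl (memLp_one_iff_integrable.2 hg), SchwartzMap.fourierInv_coe]
  -- The multiplication formula moves the transform from `θ` to `g`; the reflections turn it into
  -- the inverse transform.
  have h2 := VectorFourier.integral_fourierIntegral_smul_eq_flip (L := innerₗ (Space d))
    (μ := volume) (ν := volume) (e := Real.fourierChar) Real.continuous_fourierChar
    continuous_inner (f := fun x => θ (-x)) (g := g) (θ.integrable.comp_neg) hg
  rw [Real.fourierInv_eq_fourier_comp_neg]
  refine Eq.trans h2 ?_
  rw [← integral_neg_eq_self]
  refine integral_congr_ae (Eventually.of_forall fun x => ?_)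
  simp only [neg_neg, smul_eq_mul, Real.fourierInv_eq_fourier_neg]
  rw [flip_innerₗ]
  rfl

theorem exists_fourier_of_integrable (hg : Integrable g) :
    ∃ T : 𝓢'(Space d, ℂ), IsFunction (𝓕 T) g := by
  obtain ⟨S, hS⟩ := exists_of_memLp le_rfl (memLp_one_iff_integrable.2 hg)
  exact ⟨𝓕⁻ S, by rwa [fourier_fourierInv_eq]⟩

/-- **Plancherel**: an `L²` function has an `L²` Fourier transform, of the same norm. -/
theorem exists_fourier_of_memLp_two (hT : IsFunction T g) (hg : MemLp g 2) :
    ∃ h : Space d → ℂ, MemLp h 2 ∧ IsFunction (𝓕 T) h ∧ eLpNorm h 2 = eLpNorm g 2 := by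
  have h1 : T = Lp.toTemperedDistribution (hg.toLp g) :=
    hT.unique ((toTemperedDistribution (hg.toLp g)).congr hg.coeFn_toLp)
  refine ⟨(𝓕 (hg.toLp g) : Lp ℂ 2 (volume : Measure (Space d))), Lp.memLp _, ?_, ?_⟩
  · rw [h1, Lp.fourier_toTemperedDistribution_eq]
    exact toTemperedDistribution _
  · have := Lp.norm_fourier_eq (hg.toLp g)
    rw [Lp.norm_toLp, Lp.norm_def, ENNReal.toReal_eq_toReal_iff' (Lp.eLpNorm_ne_top _)
      hg.eLpNorm_ne_top] at this
    rw [← this]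

theorem memLp_two_of_fourier (hT : IsFunction T g) (hF : IsFunction (𝓕 T) h) (hh : MemLp h 2) :
    MemLp g 2 ∧ eLpNorm g 2 = eLpNorm h 2 := by
  obtain ⟨S, hS⟩ := exists_of_memLp one_le_two hh
  have h1 : 𝓕 T = Lp.toTemperedDistribution (hh.toLp h) :=
    hF.unique ((toTemperedDistribution (hh.toLp h)).congr hh.coeFn_toLp)
  have h2 : T = Lp.toTemperedDistribution (𝓕⁻ (hh.toLp h)) := by
    rw [← Lp.fourierInv_toTemperedDistribution_eq, ← h1, fourierInv_fourier_eq]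
  have h3 : IsFunction T (𝓕⁻ (hh.toLp h) : Lp ℂ 2 (volume : Measure (Space d))) := by
    rw [h2]; exact toTemperedDistribution _
  have h4 := hT.ae_eq h3
  have h5 : MemLp g 2 := (memLp_congr_ae h4).2 (Lp.memLp _)
  obtain ⟨k, -, hk, hn⟩ := hT.exists_fourier_of_memLp_two h5
  exact ⟨h5, by rw [← hn, eLpNorm_congr_ae (hk.ae_eq hF)]⟩

theorem fourier_lineDeriv (hT : IsFunction (𝓕 T) g) (m : Space d) :
    IsFunction (𝓕 (∂_{m} T)) (fun ξ => 2 * Real.pi * Complex.I * (inner ℝ ξ m : ℝ) * g ξ) := by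
  have hl : LocallyIntegrable (fun ξ : Space d => ((inner ℝ ξ m : ℝ) : ℂ) * g ξ) := by
    have hc : Continuous fun ξ : Space d => ((inner ℝ ξ m : ℝ) : ℂ) := by fun_prop
    simpa [smul_eq_mul] using hT.1.continuous_smul hc
  have ht : (fun ξ : Space d => ((inner ℝ ξ m : ℝ) : ℂ)).HasTemperateGrowth := by fun_prop
  have h1 : IsFunction
      (TemperedDistribution.smulLeftCLM ℂ (fun ξ : Space d => ((inner ℝ ξ m : ℝ) : ℂ)) (𝓕 T))
      (fun ξ => (inner ℝ ξ m : ℝ) * g ξ) := by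
    refine ⟨hl, fun θ hθ => ?_⟩
    rw [TemperedDistribution.smulLeftCLM_apply_apply, hT.2]
    · refine integral_congr_ae (Eventually.of_forall fun x => ?_)
      simp only
      rw [SchwartzMap.smulLeftCLM_apply_apply ht, smul_eq_mul]
      ring
    · refine hθ.mono ?_
      intro x hx
      contrapose! hx
      simp only [Function.mem_support, not_not] at hx ⊢
      rw [SchwartzMap.smulLeftCLM_apply_apply ht, hx, smul_zero]
  rw [TemperedDistribution.fourier_lineDerivOp_eq]
  refine (h1.smul (2 * Real.pi * Complex.I)).congr (Eventually.of_forall fun ξ => ?_)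
  simp only [Pi.smul_apply, smul_eq_mul]
  ring

end IsFunction

/-! ### Real-valuedness as Hermitian symmetry of the Fourier transform -/

section Hermitian

variable (𝕜 : Type*) [RCLike 𝕜] [NormedAlgebra 𝕜 ℂ] {d : ℕ}

/-- The symmetry of the Fourier transform of a `𝕜`-valued function: no condition for `𝕜 = ℂ`,
and `g (-ξ) = conj (g ξ)` for `𝕜 = ℝ`. -/
def IsHermitianIn (g : Space d → ℂ) : Prop :=
  (RCLike.I : 𝕜) = 0 → ∀ᵐ ξ, g (-ξ) = conj (g ξ)

theorem algebraMap_ofReal (r : ℝ) : algebraMap 𝕜 ℂ (r : 𝕜) = r := by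
  have h := map_real_smul (algebraMap 𝕜 ℂ) (algebraMapCLM 𝕜 ℂ).continuous r 1
  rw [map_one, RCLike.real_smul_eq_coe_mul, mul_one] at h
  simpa using h

theorem norm_algebraMap_eq (a : 𝕜) : ‖algebraMap 𝕜 ℂ a‖ = ‖a‖ := by simp

/-- The condition `RCLike.I ≠ 0` singles out the complex case. The image of `I` is then a square
root of `-1`, and together with the reals it spans `ℂ`. -/
theorem mem_range_algebraMap_of_I_ne_zero (h : (RCLike.I : 𝕜) ≠ 0) (z : ℂ) :
    z ∈ Set.range (algebraMap 𝕜 ℂ) := by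
  have h1 : (algebraMap 𝕜 ℂ RCLike.I) * (algebraMap 𝕜 ℂ RCLike.I) = -1 := by
    rw [← map_mul, RCLike.I_mul_I_of_nonzero h, map_neg, map_one]
  have h2 : ((algebraMap 𝕜 ℂ RCLike.I) - Complex.I) * ((algebraMap 𝕜 ℂ RCLike.I) + Complex.I) =
      0 := by
    ring_nf
    rw [pow_two, h1, Complex.I_sq]; ring
  -- The algebra structure on `ℂ` is arbitrary, so `I` may be sent to `-I` as well; the preimage of
  -- `z` changes accordingly.
  rcases mul_eq_zero.1 h2 with h3 | h3
  · refine ⟨(z.re : 𝕜) + (z.im : 𝕜) * RCLike.I, ?_⟩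
    rw [map_add, map_mul, algebraMap_ofReal, algebraMap_ofReal, sub_eq_zero.1 h3, Complex.re_add_im]
  · refine ⟨(z.re : 𝕜) - (z.im : 𝕜) * RCLike.I, ?_⟩
    rw [map_sub, map_mul, algebraMap_ofReal, algebraMap_ofReal, eq_neg_of_add_eq_zero_left h3]
    conv_rhs => rw [← Complex.re_add_im z]
    ring

theorem mem_range_algebraMap_iff (h : (RCLike.I : 𝕜) = 0) {z : ℂ} :
    z ∈ Set.range (algebraMap 𝕜 ℂ) ↔ conj z = z := by
  constructor
  · rintro ⟨a, rfl⟩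
    have : a = ((RCLike.re a : ℝ) : 𝕜) := by
      conv_lhs => rw [← RCLike.re_add_im a, h, mul_zero, add_zero]
    rw [this, algebraMap_ofReal, Complex.conj_ofReal]
  · intro hz
    exact ⟨(z.re : 𝕜), by rw [algebraMap_ofReal]; exact Complex.conj_eq_iff_re.1 hz⟩

variable {𝕜}

theorem IsHermitianIn.mem_range_fourierInv {g : Space d → ℂ} (hg : IsHermitianIn 𝕜 g)
    (x : Space d) : 𝓕⁻ g x ∈ Set.range (algebraMap 𝕜 ℂ) := by
  by_cases h : (RCLike.I : 𝕜) = 0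
  · rw [mem_range_algebraMap_iff 𝕜 h, Real.fourierInv_eq', ← integral_conj,
      ← integral_neg_eq_self]
    refine integral_congr_ae ?_
    filter_upwards [hg h] with ξ hξ
    simp only [smul_eq_mul, map_mul, hξ, Complex.conj_conj, ← Complex.exp_conj, inner_neg_left,
      Complex.conj_I, Complex.conj_ofReal]
    congr 2
    push_cast
    ring
  · exact mem_range_algebraMap_of_I_ne_zero 𝕜 h _

theorem IsFunction.isValuedIn {T : 𝓢'(Space d, ℂ)} {v : Space d → ℂ} (hT : IsFunction T v)
    (hv : MemLp v ∞) (h : ∀ x, v x ∈ Set.range (algebraMap 𝕜 ℂ)) : IsValuedIn 𝕜 T := by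
  intro θ hθ
  by_cases hI : (RCLike.I : 𝕜) = 0
  · rw [mem_range_algebraMap_iff 𝕜 hI, hT.apply_of_memLp le_top hv, ← integral_conj]
    congr 1
    funext x
    rw [map_mul, (mem_range_algebraMap_iff 𝕜 hI).1 (h x), Complex.conj_eq_iff_im.2 (hθ x)]
  · exact mem_range_algebraMap_of_I_ne_zero 𝕜 hI _

/-- The complex conjugate of a Schwartz function. -/
noncomputable def conjSchwartz : 𝓢(Space d, ℂ) →L[ℝ] 𝓢(Space d, ℂ) :=
  SchwartzMap.postcompCLM (𝕜 := ℝ) (Complex.conjCLE : ℂ →L[ℝ] ℂ)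

theorem conjSchwartz_apply (θ : 𝓢(Space d, ℂ)) (x : Space d) :
    conjSchwartz θ x = conj (θ x) := rfl

/-- `θ + θ̄` and `i(θ - θ̄)` are real test functions, on which `T` is real; the claim is a linear
combination of these two facts. -/
theorem IsValuedIn.apply_conjSchwartz {T : 𝓢'(Space d, ℂ)} (hT : IsValuedIn 𝕜 T)
    (hI : (RCLike.I : 𝕜) = 0) (θ : 𝓢(Space d, ℂ)) : T (conjSchwartz θ) = conj (T θ) := by
  have h1 := hT (θ + conjSchwartz θ) fun x => by
    rw [add_apply, conjSchwartz_apply, Complex.add_im, Complex.conj_im]; ring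
  have h2 := hT (Complex.I • (θ - conjSchwartz θ)) fun x => by
    rw [smul_apply, sub_apply, conjSchwartz_apply]
    simp
  rw [mem_range_algebraMap_iff 𝕜 hI] at h1 h2
  rw [map_add, map_add] at h1
  rw [map_smul, map_sub, smul_eq_mul, map_mul, map_sub, Complex.conj_I] at h2
  have h3 : Complex.I * (-(conj (T θ)) + conj (T (conjSchwartz θ)) - T θ + T (conjSchwartz θ)) =
      0 := by
    linear_combination h2
  have h4 := (mul_eq_zero.1 h3).resolve_left Complex.I_ne_zero
  linear_combination (h4 - h1) / 2

/-- The Fourier transform of a `𝕜`-valued distribution has the symmetry `IsHermitianIn`. -/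
theorem IsValuedIn.isHermitianIn {T : 𝓢'(Space d, ℂ)} (hT : IsValuedIn 𝕜 T)
    {g : Space d → ℂ} (hg : IsFunction (𝓕 T) g) : IsHermitianIn 𝕜 g := by
  intro hI
  have h1 : IsFunction (𝓕 T) (fun ξ => conj (g (-ξ))) := by
    have hl : LocallyIntegrable (fun ξ => g (-ξ)) := by
      intro x
      obtain ⟨s, hs, hi⟩ := hg.1 (-x)
      exact ⟨-s, continuous_neg.continuousAt.preimage_mem_nhds hs, hi.comp_neg⟩
    refine ⟨fun x => ?_, fun θ hθ => ?_⟩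
    · obtain ⟨s, hs, hi⟩ := hl x
      exact ⟨s, hs, (Complex.conjCLE : ℂ →L[ℝ] ℂ).integrable_comp hi⟩
    let e : Space d ≃L[ℝ] Space d := ContinuousLinearEquiv.neg ℝ
    -- The test function `conj (θ (-x))` is the one whose Fourier transform is the conjugate of that
    -- of `θ`.
    let θ' : 𝓢(Space d, ℂ) := SchwartzMap.compCLMOfContinuousLinearEquiv ℝ e (conjSchwartz θ)
    have hθ' : ∀ x, θ' x = conj (θ (-x)) := fun x => rfl
    have hF : 𝓕 θ' = conjSchwartz (𝓕 θ) := by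
      ext x
      rw [conjSchwartz_apply, SchwartzMap.fourier_coe, SchwartzMap.fourier_coe, Real.fourier_eq',
        Real.fourier_eq', ← integral_conj, ← integral_neg_eq_self]
      refine integral_congr_ae (Eventually.of_forall fun ξ => ?_)
      simp only [hθ', neg_neg, smul_eq_mul, map_mul, ← Complex.exp_conj, inner_neg_left,
        Complex.conj_I, Complex.conj_ofReal]
      congr 2
      push_cast
      ring
    have hc : HasCompactSupport θ' := by
      have : HasCompactSupport (fun x => θ (-x)) := hθ.comp_homeomorph (Homeomorph.neg _)
      exact this.comp_left (g := fun z : ℂ => conj z) (by simp)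
    have h2 : (𝓕 T) θ' = conj ((𝓕 T) θ) := by
      rw [TemperedDistribution.fourier_apply, hF, hT.apply_conjSchwartz hI,
        TemperedDistribution.fourier_apply]
    rw [hg.2 θ' hc] at h2
    have h3 : conj (∫ x, θ' x * g x) = (𝓕 T) θ := by rw [h2]; exact Complex.conj_conj _
    rw [← h3, ← integral_conj, ← integral_neg_eq_self]
    refine integral_congr_ae (Eventually.of_forall fun ξ => ?_)
    simp [hθ']
  filter_upwards [hg.ae_eq h1] with ξ hξ
  rw [hξ]; exact (Complex.conj_conj _).symm

end Hermitian

/-! ### Weighted spaces as Banach spaces of continuous functions; Fourier multipliers -/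

theorem lintegral_mul_sq_le {α : Type*} [MeasurableSpace α] {μ : Measure α} {f g : α → ℝ≥0∞}
    (hf : AEMeasurable f μ) (hg : AEMeasurable g μ) :
    (∫⁻ x, f x * g x ∂μ) ^ 2 ≤ (∫⁻ x, f x ^ 2 ∂μ) * ∫⁻ x, g x ^ 2 ∂μ := by
  have h1 := ENNReal.lintegral_mul_le_Lp_mul_Lq μ Real.HolderConjugate.two_two hf hg
  have h2 := pow_le_pow_left' h1 2
  have h3 : ∀ z : ℝ≥0∞, (z ^ (1 / 2 : ℝ)) ^ 2 = z := fun z => by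
    rw [← ENNReal.rpow_natCast, ← ENNReal.rpow_mul]; norm_num
  simpa only [mul_pow, h3, ENNReal.rpow_two, Pi.mul_apply] using h2

theorem IsHermitianIn.mul {𝕜 : Type*} [RCLike 𝕜] {d : ℕ} {b g : Space d → ℂ}
    (hb : IsHermitianIn 𝕜 b) (hg : IsHermitianIn 𝕜 g) : IsHermitianIn 𝕜 (fun ξ => b ξ * g ξ) := by
  intro hI
  filter_upwards [hb hI, hg hI] with ξ h1 h2
  rw [h1, h2, map_mul]

/-- Cauchy–Schwarz for `F = w^{-1/2} · w^{1/2} F`. When `1/w` is integrable this bounds the `L¹`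
norm of the transform, hence the supremum norm, by the weighted norm. -/
theorem FourierWeight.lintegral_sq_le {d : ℕ} (w : FourierWeight d) {F : Space d → ℝ≥0∞}
    (hF : AEMeasurable F) :
    (∫⁻ ξ, F ξ) ^ 2 ≤
      (∫⁻ ξ, (ENNReal.ofReal (w.toFun ξ))⁻¹) * ∫⁻ ξ, ENNReal.ofReal (w.toFun ξ) * F ξ ^ 2 := by
  have hwm := w.measurable
  have h1 : ∫⁻ ξ, F ξ = ∫⁻ ξ, (ENNReal.ofReal (√(w.toFun ξ)))⁻¹ *
      (ENNReal.ofReal (√(w.toFun ξ)) * F ξ) := by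
    refine lintegral_congr_ae ?_
    filter_upwards [w.pos] with ξ hξ
    rw [← mul_assoc, ENNReal.inv_mul_cancel, one_mul]
    · simpa using hξ
    · exact ENNReal.ofReal_ne_top
  rw [h1]
  refine (lintegral_mul_sq_le (by fun_prop) (by fun_prop)).trans_eq ?_
  congr 1
  · refine lintegral_congr_ae ?_
    filter_upwards [w.pos] with ξ hξ
    rw [← ENNReal.inv_pow, ← ENNReal.ofReal_pow (Real.sqrt_nonneg _), Real.sq_sqrt hξ.le]
  · refine lintegral_congr_ae ?_
    filter_upwards [w.pos] with ξ hξ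
    rw [mul_pow, ← ENNReal.ofReal_pow (Real.sqrt_nonneg _), Real.sq_sqrt hξ.le]

namespace WeightedFourierSpace

variable {𝕜 : Type*} [RCLike 𝕜] [NormedAlgebra 𝕜 ℂ] {d : ℕ} {w w' : FourierWeight d}

theorem isHermitianIn_fourierFun (f : WeightedFourierSpace 𝕜 w) :
    IsHermitianIn 𝕜 (fourierFun f) :=
  IsValuedIn.isHermitianIn f.2.1 (isFunction_fourierFun f)

theorem fourierFun_ae_eq (f : WeightedFourierSpace 𝕜 w) {g : Space d → ℂ}
    (hg : IsFunction (𝓕 (distribution f)) g) : fourierFun f =ᵐ[volume] g :=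
  (isFunction_fourierFun f).ae_eq hg

theorem fourierFun_add (f g : WeightedFourierSpace 𝕜 w) :
    fourierFun (f + g) =ᵐ[volume] fourierFun f + fourierFun g := by
  refine fourierFun_ae_eq _ ?_
  rw [map_add, FourierTransform.fourier_add]
  exact (isFunction_fourierFun f).add (isFunction_fourierFun g)

theorem fourierFun_smul (c : 𝕜) (f : WeightedFourierSpace 𝕜 w) :
    fourierFun (c • f) =ᵐ[volume] algebraMap 𝕜 ℂ c • fourierFun f := by
  refine fourierFun_ae_eq _ ?_
  rw [map_smul, ← algebraMap_smul ℂ c (distribution f), FourierTransform.fourier_smul]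
  exact (isFunction_fourierFun f).smul _

theorem fourierFun_sub (f g : WeightedFourierSpace 𝕜 w) :
    fourierFun (f - g) =ᵐ[volume] fourierFun f - fourierFun g := by
  rw [sub_eq_add_neg, ← neg_one_smul 𝕜 g]
  filter_upwards [fourierFun_add f ((-1 : 𝕜) • g), fourierFun_smul (-1 : 𝕜) g] with ξ h1 h2
  rw [h1, Pi.add_apply, h2]
  simp [sub_eq_add_neg]

theorem distribution_injective :
    Function.Injective (distribution : WeightedFourierSpace 𝕜 w →ₗ[𝕜] 𝓢'(Space d, ℂ)) :=
  Subtype.val_injective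

theorem ext_fourierFun {f g : WeightedFourierSpace 𝕜 w}
    (h : fourierFun f =ᵐ[volume] fourierFun g) : f = g := by
  apply distribution_injective
  have h1 := ((isFunction_fourierFun f).congr h).unique (isFunction_fourierFun g)
  have h2 : 𝓕⁻ (𝓕 (distribution f)) = distribution f := fourierInv_fourier_eq _
  have h3 : 𝓕⁻ (𝓕 (distribution g)) = distribution g := fourierInv_fourier_eq _
  rw [← h2, h1, h3]

theorem ofReal_norm_sq (f : WeightedFourierSpace 𝕜 w) {g : Space d → ℂ}
    (hg : IsFunction (𝓕 (distribution f)) g) :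
    ENNReal.ofReal (‖f‖ ^ 2) = ∫⁻ ξ, ENNReal.ofReal (w.toFun ξ) * ‖g ξ‖ₑ ^ 2 := by
  rw [norm_sq_eq, ofReal_integral_eq_lintegral_ofReal (integrable_fourierFun f)]
  · refine lintegral_congr_ae ?_
    filter_upwards [w.pos, fourierFun_ae_eq f hg] with ξ h1 h2
    rw [ENNReal.ofReal_mul h1.le, h2, ENNReal.ofReal_pow (norm_nonneg _), ofReal_norm]
  · filter_upwards [w.pos] with ξ h1
    simp only [Pi.zero_apply]
    positivity

/-- The pointwise bound `|g| ≤ w |g|² + 1/w` suffices. -/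
theorem integrable_of_weight (hw : Integrable fun ξ => (w.toFun ξ)⁻¹) {g : Space d → ℂ}
    (hg : AEStronglyMeasurable g) (hi : Integrable fun ξ => w.toFun ξ * ‖g ξ‖ ^ 2) :
    Integrable g := by
  refine (hi.add hw).mono' hg ?_
  filter_upwards [w.pos] with ξ hξ
  have h1 : 0 ≤ (w.toFun ξ)⁻¹ * ((w.toFun ξ * ‖g ξ‖ - 1) ^ 2 + w.toFun ξ * ‖g ξ‖) := by
    positivity
  have h2 : (w.toFun ξ)⁻¹ * ((w.toFun ξ * ‖g ξ‖ - 1) ^ 2 + w.toFun ξ * ‖g ξ‖) =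
      w.toFun ξ * ‖g ξ‖ ^ 2 + (w.toFun ξ)⁻¹ - ‖g ξ‖ := by
    field_simp; ring
  simp only [Pi.add_apply]
  linarith

theorem integrable_fourierFun' (hw : Integrable fun ξ => (w.toFun ξ)⁻¹)
    (f : WeightedFourierSpace 𝕜 w) : Integrable (fourierFun f) :=
  integrable_of_weight hw (isFunction_fourierFun f).1.aestronglyMeasurable
    (integrable_fourierFun f)

/-- Integrability of `1/w` makes every admissible `g` integrable, hence the transform of a genuine
tempered distribution; symmetry of `g` makes that distribution `𝕜`-valued. -/
theorem exists_of_fourier (hw : Integrable fun ξ => (w.toFun ξ)⁻¹) {g : Space d → ℂ}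
    (hg : AEStronglyMeasurable g) (hi : Integrable fun ξ => w.toFun ξ * ‖g ξ‖ ^ 2)
    (hh : IsHermitianIn 𝕜 g) :
    ∃ f : WeightedFourierSpace 𝕜 w, IsFunction (𝓕 (distribution f)) g := by
  have h1 := integrable_of_weight hw hg hi
  obtain ⟨T, hT⟩ := IsFunction.exists_fourier_of_integrable h1
  exact ⟨⟨T, (hT.fourierInv h1).isValuedIn (IsFunction.memLp_fourierInv h1)
    hh.mem_range_fourierInv, g, hT, hi⟩, hT⟩

/-- The element of the weighted space with Fourier transform `g`. -/
noncomputable def ofFourier (hw : Integrable fun ξ => (w.toFun ξ)⁻¹) {g : Space d → ℂ}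
    (hg : AEStronglyMeasurable g) (hi : Integrable fun ξ => w.toFun ξ * ‖g ξ‖ ^ 2)
    (hh : IsHermitianIn 𝕜 g) : WeightedFourierSpace 𝕜 w :=
  Classical.choose (exists_of_fourier hw hg hi hh)

theorem isFunction_ofFourier (hw : Integrable fun ξ => (w.toFun ξ)⁻¹) {g : Space d → ℂ}
    (hg : AEStronglyMeasurable g) (hi : Integrable fun ξ => w.toFun ξ * ‖g ξ‖ ^ 2)
    (hh : IsHermitianIn 𝕜 g) : IsFunction (𝓕 (distribution (ofFourier hw hg hi hh))) g :=
  Classical.choose_spec (exists_of_fourier hw hg hi hh)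

/-- The values of an element of the weighted space, as a function. -/
noncomputable def val (f : WeightedFourierSpace 𝕜 w) (x : Space d) : 𝕜 :=
  Classical.choose ((isHermitianIn_fourierFun f).mem_range_fourierInv x)

theorem algebraMap_val (f : WeightedFourierSpace 𝕜 w) (x : Space d) :
    algebraMap 𝕜 ℂ (val f x) = 𝓕⁻ (fourierFun f) x :=
  Classical.choose_spec ((isHermitianIn_fourierFun f).mem_range_fourierInv x)

theorem isFunction_val (hw : Integrable fun ξ => (w.toFun ξ)⁻¹) (f : WeightedFourierSpace 𝕜 w) :
    IsFunction (distribution f) (fun x => algebraMap 𝕜 ℂ (val f x)) := by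
  simp only [algebraMap_val]
  exact (isFunction_fourierFun f).fourierInv (integrable_fourierFun' hw f)

theorem continuous_fourierInv {g : Space d → ℂ} (hg : Integrable g) : Continuous (𝓕⁻ g) := by
  rw [Real.fourierInv_eq_fourier_comp_neg]
  exact VectorFourier.fourierIntegral_continuous Real.continuous_fourierChar
      continuous_inner hg.comp_neg

theorem continuous_val (hw : Integrable fun ξ => (w.toFun ξ)⁻¹) (f : WeightedFourierSpace 𝕜 w) :
    Continuous (val f) := by
  have h1 : Isometry (algebraMap 𝕜 ℂ) := AddMonoidHomClass.isometry_of_norm _ (by simp)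
  rw [h1.isEmbedding.continuous_iff]
  refine (continuous_fourierInv (integrable_fourierFun' hw f)).congr fun x => ?_
  exact (algebraMap_val f x).symm

theorem val_injective (hw : Integrable fun ξ => (w.toFun ξ)⁻¹) :
    Function.Injective (val : WeightedFourierSpace 𝕜 w → Space d → 𝕜) := by
  intro f g h
  apply distribution_injective
  have h1 := isFunction_val hw f
  rw [h] at h1
  exact h1.unique (isFunction_val hw g)

theorem val_add (hw : Integrable fun ξ => (w.toFun ξ)⁻¹) (f g : WeightedFourierSpace 𝕜 w)
    (x : Space d) : val (f + g) x = val f x + val g x := by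
  apply (algebraMap 𝕜 ℂ).injective
  rw [map_add, algebraMap_val, algebraMap_val, algebraMap_val,
    Real.fourierInv_congr_ae (fourierFun_add f g), Real.fourierInv_eq, Real.fourierInv_eq,
    Real.fourierInv_eq]
  simp only [Pi.add_apply, smul_add]
  have h1 := (Real.fourierIntegral_convergent_iff (-x)).2 (integrable_fourierFun' hw f)
  have h2 := (Real.fourierIntegral_convergent_iff (-x)).2 (integrable_fourierFun' hw g)
  simp only [inner_neg_right, neg_neg] at h1 h2
  exact integral_add h1 h2

theorem val_smul (c : 𝕜) (f : WeightedFourierSpace 𝕜 w) (x : Space d) :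
    val (c • f) x = c * val f x := by
  apply (algebraMap 𝕜 ℂ).injective
  rw [map_mul, algebraMap_val, algebraMap_val, Real.fourierInv_congr_ae (fourierFun_smul c f),
    Real.fourierInv_eq', Real.fourierInv_eq', ← integral_const_mul]
  congr 1
  funext ξ
  simp only [Pi.smul_apply, smul_eq_mul]
  ring

theorem enorm_val_le (f : WeightedFourierSpace 𝕜 w) (x : Space d) :
    ‖val f x‖ₑ ≤ ∫⁻ ξ, ‖fourierFun f ξ‖ₑ := by
  have h1 : ‖val f x‖ₑ = ‖algebraMap 𝕜 ℂ (val f x)‖ₑ := by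
    rw [← ofReal_norm, ← ofReal_norm, norm_algebraMap_eq]
  rw [h1, algebraMap_val, Real.fourierInv_eq']
  refine (enorm_integral_le_lintegral_enorm _).trans_eq (lintegral_congr fun ξ => ?_)
  rw [enorm_smul, ← ofReal_norm, Complex.norm_exp]
  simp

theorem lintegral_enorm_sq_le (f : WeightedFourierSpace 𝕜 w) :
    (∫⁻ ξ, ‖fourierFun f ξ‖ₑ) ^ 2 ≤
      (∫⁻ ξ, (ENNReal.ofReal (w.toFun ξ))⁻¹) * ENNReal.ofReal (‖f‖ ^ 2) := by
  rw [ofReal_norm_sq f (isFunction_fourierFun f)]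
  exact w.lintegral_sq_le (isFunction_fourierFun f).1.aestronglyMeasurable.enorm

theorem ofReal_integral_inv (hw : Integrable fun ξ => (w.toFun ξ)⁻¹) :
    ENNReal.ofReal (∫ ξ, (w.toFun ξ)⁻¹) = ∫⁻ ξ, (ENNReal.ofReal (w.toFun ξ))⁻¹ := by
  rw [ofReal_integral_eq_lintegral_ofReal hw]
  · refine lintegral_congr_ae ?_
    filter_upwards [w.pos] with ξ hξ
    rw [ENNReal.ofReal_inv_of_pos hξ]
  · filter_upwards [w.pos] with ξ hξ using (inv_pos.2 hξ).le

/-- Evaluation at a point is a bounded functional. -/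
theorem exists_norm_val_le (hw : Integrable fun ξ => (w.toFun ξ)⁻¹) :
    ∃ C : ℝ, 0 ≤ C ∧ ∀ (f : WeightedFourierSpace 𝕜 w) (x : Space d), ‖val f x‖ ≤ C * ‖f‖ := by
  refine ⟨√(∫ ξ, (w.toFun ξ)⁻¹), Real.sqrt_nonneg _, fun f x => ?_⟩
  have h0 : 0 ≤ ∫ ξ, (w.toFun ξ)⁻¹ := integral_nonneg_of_ae <| by
    filter_upwards [w.pos] with ξ hξ using (inv_pos.2 hξ).le
  have h1 : ENNReal.ofReal (‖val f x‖ ^ 2) ≤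
      ENNReal.ofReal ((∫ ξ, (w.toFun ξ)⁻¹) * ‖f‖ ^ 2) := by
    rw [ENNReal.ofReal_pow (norm_nonneg _), ofReal_norm, ENNReal.ofReal_mul h0,
      ofReal_integral_inv hw]
    exact (pow_le_pow_left' (enorm_val_le f x) 2).trans (lintegral_enorm_sq_le f)
  rw [ENNReal.ofReal_le_ofReal_iff (by positivity)] at h1
  refine abs_le_of_sq_le_sq' ?_ (by positivity) |>.2
  rwa [mul_pow, Real.sq_sqrt h0]

/-- The value at a point, as a continuous linear functional. -/
noncomputable def evalCLM (hw : Integrable fun ξ => (w.toFun ξ)⁻¹) (x : Space d) :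
    WeightedFourierSpace 𝕜 w →L[𝕜] 𝕜 :=
  LinearMap.mkContinuousOfExistsBound
    { toFun := fun f => val f x
      map_add' := fun f g => val_add hw f g x
      map_smul' := fun c f => val_smul c f x }
    (let ⟨C, _, h⟩ := exists_norm_val_le (𝕜 := 𝕜) hw; ⟨C, fun f => h f x⟩)

theorem evalCLM_apply (hw : Integrable fun ξ => (w.toFun ξ)⁻¹) (x : Space d)
    (f : WeightedFourierSpace 𝕜 w) : evalCLM hw x f = val f x := rfl

theorem norm_toL2 (f : WeightedFourierSpace 𝕜 w) : ‖toL2 f‖ = ‖f‖ := rfl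

theorem isometry_toL2 : Isometry (toL2 : WeightedFourierSpace 𝕜 w →ₗ[𝕜] _) :=
  AddMonoidHomClass.isometry_of_norm _ norm_toL2

/-- The space is isometric to its range in `L²`, which is closed: dividing an `L²` limit by `√w`
gives the transform of the limiting element. -/
theorem completeSpace (hw : Integrable fun ξ => (w.toFun ξ)⁻¹) :
    CompleteSpace (WeightedFourierSpace 𝕜 w) := by
  rw [completeSpace_iff_isComplete_range
    (isometry_toL2 : Isometry (toL2 : WeightedFourierSpace 𝕜 w →ₗ[𝕜] _)).isUniformInducing]
  refine IsClosed.isComplete (IsSeqClosed.isClosed fun F G hF hFG => ?_)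
  have hwm := w.measurable
  have hne : ∀ᵐ ξ, ((√(w.toFun ξ) : ℝ) : ℂ) ≠ 0 := by
    filter_upwards [w.pos] with ξ hξ
    simpa using (Real.sqrt_pos.2 hξ).ne'
  let g : Space d → ℂ := fun ξ => ((√(w.toFun ξ) : ℝ) : ℂ)⁻¹ * G ξ
  have hg : AEStronglyMeasurable g :=
    AEStronglyMeasurable.mul (by fun_prop) (Lp.aestronglyMeasurable G)
  have hwg : ∀ᵐ ξ, w.toFun ξ * ‖g ξ‖ ^ 2 = ‖G ξ‖ ^ 2 := by
    filter_upwards [w.pos] with ξ hξ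
    simp only [g, norm_mul, norm_inv, Complex.norm_real, Real.norm_eq_abs, mul_pow, inv_pow,
      sq_abs, Real.sq_sqrt hξ.le]
    field_simp
  have hi : Integrable fun ξ => w.toFun ξ * ‖g ξ‖ ^ 2 :=
    ((memLp_two_iff_integrable_sq_norm (Lp.aestronglyMeasurable G)).1 (Lp.memLp G)).congr
      (by filter_upwards [hwg] with ξ h using h.symm)
  choose f hf using hF
  -- Symmetry is a pointwise condition, so it passes to the limit along an almost everywhere
  -- convergent subsequence.
  have hh : IsHermitianIn 𝕜 g := by
    intro hI
    obtain ⟨φ, -, hφ⟩ := (tendstoInMeasure_of_tendsto_Lp hFG).exists_seq_tendsto_ae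
    have hmp := Measure.measurePreserving_neg (volume : Measure (Space d))
    have h1 : ∀ᵐ ξ, ∀ n, F n ξ = ((√(w.toFun ξ) : ℝ) : ℂ) * fourierFun (f n) ξ := by
      rw [ae_all_iff]
      intro n
      rw [← hf n]
      exact MemLp.coeFn_toLp (memLp_sqrt_mul (f n))
    have h2 : ∀ᵐ ξ, ∀ n, fourierFun (f n) (-ξ) = conj (fourierFun (f n) ξ) :=
      ae_all_iff.2 fun n => isHermitianIn_fourierFun (f n) hI
    have h3 : ∀ᵐ ξ, Tendsto (fun n => fourierFun (f (φ n)) ξ) atTop (𝓝 (g ξ)) := by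
      filter_upwards [h1, hφ, hne] with ξ h1 h2 h3
      refine (h2.const_mul _).congr fun n => ?_
      rw [h1]
      exact inv_mul_cancel_left₀ h3 _
    filter_upwards [h2, h3, hmp.quasiMeasurePreserving.ae h3] with ξ h2 h3 h4
    refine tendsto_nhds_unique h4 ?_
    simp only [h2]
    exact (Complex.continuous_conj.tendsto _).comp h3
  refine ⟨ofFourier hw hg hi hh, ?_⟩
  apply Lp.ext
  have h1 := isFunction_ofFourier hw hg hi hh
  filter_upwards [MemLp.coeFn_toLp (memLp_sqrt_mul (ofFourier hw hg hi hh)),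
    fourierFun_ae_eq _ h1, hne] with ξ h2 h3 h4
  refine h2.trans ?_
  rw [h3]
  exact mul_inv_cancel_left₀ h4 _

section Multiplier

variable {b : Space d → ℂ}

theorem integrable_multiplier (hb : AEStronglyMeasurable b) {C : ℝ}
    (hC : ∀ᵐ ξ, w'.toFun ξ * ‖b ξ‖ ^ 2 ≤ C * w.toFun ξ) (f : WeightedFourierSpace 𝕜 w) :
    Integrable fun ξ => w'.toFun ξ * ‖b ξ * fourierFun f ξ‖ ^ 2 := by
  have hfm := (isFunction_fourierFun f).1.aestronglyMeasurable
  refine ((integrable_fourierFun f).const_mul C).mono'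
    (w'.measurable.aestronglyMeasurable.mul ((hb.mul hfm).norm.pow 2)) ?_
  filter_upwards [hC, w'.pos] with ξ h1 h2
  rw [Real.norm_of_nonneg (by positivity), norm_mul, mul_pow, ← mul_assoc, ← mul_assoc]
  gcongr

/-- The Fourier multiplier with symbol `b`, as an operator between weighted spaces. -/
theorem exists_multiplier (hw' : Integrable fun ξ => (w'.toFun ξ)⁻¹)
    (hb : AEStronglyMeasurable b) (hh : IsHermitianIn 𝕜 b) {C : ℝ}
    (hC : ∀ᵐ ξ, w'.toFun ξ * ‖b ξ‖ ^ 2 ≤ C * w.toFun ξ) :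
    ∃ B : WeightedFourierSpace 𝕜 w →L[𝕜] WeightedFourierSpace 𝕜 w',
      ∀ f, fourierFun (B f) =ᵐ[volume] fun ξ => b ξ * fourierFun f ξ := by
  have hex : ∀ f : WeightedFourierSpace 𝕜 w, ∃ u : WeightedFourierSpace 𝕜 w',
      fourierFun u =ᵐ[volume] fun ξ => b ξ * fourierFun f ξ := fun f => by
    obtain ⟨u, hu⟩ := exists_of_fourier hw'
      (hb.mul (isFunction_fourierFun f).1.aestronglyMeasurable) (integrable_multiplier hb hC f)
      (hh.mul (isHermitianIn_fourierFun f))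
    exact ⟨u, fourierFun_ae_eq u hu⟩
  choose B hB using hex
  let B' : WeightedFourierSpace 𝕜 w →ₗ[𝕜] WeightedFourierSpace 𝕜 w' :=
    { toFun := B
      map_add' := fun f g => ext_fourierFun <| by
        filter_upwards [hB (f + g), hB f, hB g, fourierFun_add (B f) (B g), fourierFun_add f g]
          with ξ h1 h2 h3 h4 h5
        rw [h1, h4, Pi.add_apply, h2, h3, h5, Pi.add_apply, mul_add]
      map_smul' := fun c f => ext_fourierFun <| by
        filter_upwards [hB (c • f), hB f, fourierFun_smul c (B f), fourierFun_smul c f]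
          with ξ h1 h2 h3 h4
        rw [h1, RingHom.id_apply, h3, Pi.smul_apply, h2, h4, Pi.smul_apply, smul_eq_mul,
          smul_eq_mul, mul_left_comm] }
  refine ⟨B'.mkContinuous (√(max C 0)) fun f => ?_, hB⟩
  have hsq : ‖B f‖ ^ 2 ≤ max C 0 * ‖f‖ ^ 2 := by
    rw [norm_sq_eq, norm_sq_eq, ← integral_const_mul]
    refine integral_mono_ae (integrable_fourierFun _) ((integrable_fourierFun f).const_mul _) ?_
    filter_upwards [hC, w.pos, hB f] with ξ h1 h2 h3
    rw [h3, norm_mul, mul_pow, ← mul_assoc, ← mul_assoc]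
    exact mul_le_mul_of_nonneg_right (h1.trans (by gcongr; exact le_max_left _ _)) (sq_nonneg _)
  refine abs_le_of_sq_le_sq' ?_ (by positivity) |>.2
  rwa [mul_pow, Real.sq_sqrt (le_max_right _ _)]

end Multiplier

end WeightedFourierSpace

/-! ### Products as convolutions, and analytic functions acting on the algebra -/

/-- The convolution of two nonnegative functions. -/
noncomputable def lconv {d : ℕ} (F G : Space d → ℝ≥0∞) (ξ : Space d) : ℝ≥0∞ :=
  ∫⁻ η, F η * G (ξ - η)

theorem lconv_congr {d : ℕ} {F F' G G' : Space d → ℝ≥0∞} (hF : F =ᵐ[volume] F')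
    (hG : G =ᵐ[volume] G') : lconv F G = lconv F' G' := by
  funext ξ
  refine lintegral_congr_ae ?_
  have h := (quasiMeasurePreserving_sub_left (volume : Measure (Space d)) ξ).ae hG
  filter_upwards [hF, h] with η h1 h2
  rw [h1, h2]

theorem enorm_convolution_le {d : ℕ} (f g : Space d → ℂ) (ξ : Space d) :
    ‖(f ⋆[ContinuousLinearMap.mul ℂ ℂ] g) ξ‖ₑ ≤ lconv (fun η => ‖f η‖ₑ) (fun η => ‖g η‖ₑ) ξ := by
  refine (enorm_integral_le_lintegral_enorm _).trans_eq (lintegral_congr fun η => ?_)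
  rw [ContinuousLinearMap.mul_apply', enorm_mul]

theorem IsHermitianIn.convolution {𝕜 : Type*} [RCLike 𝕜] {d : ℕ} {f g : Space d → ℂ}
    (hf : IsHermitianIn 𝕜 f) (hg : IsHermitianIn 𝕜 g) :
    IsHermitianIn 𝕜 (f ⋆[ContinuousLinearMap.mul ℂ ℂ] g) := by
  intro hI
  refine Eventually.of_forall fun ξ => ?_
  rw [convolution_def, convolution_def, ← integral_conj, ← integral_neg_eq_self]
  have h := (quasiMeasurePreserving_sub_left (volume : Measure (Space d)) ξ).ae (hg hI)
  refine integral_congr_ae ?_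
  filter_upwards [hf hI, h] with η h1 h2
  rw [ContinuousLinearMap.mul_apply', ContinuousLinearMap.mul_apply', map_mul, h1, ← h2]
  congr 2
  abel

/-- The weights `w` for which the weighted space is an algebra of continuous functions. -/
structure FourierWeight.IsAlgebra {d : ℕ} (w : FourierWeight d) : Prop where
  integrable_inv : Integrable fun ξ => (w.toFun ξ)⁻¹
  conv_le : ∃ C : ℝ≥0, ∀ F G : Space d → ℝ≥0∞, Measurable F → Measurable G →
    ∫⁻ ξ, ENNReal.ofReal (w.toFun ξ) * lconv F G ξ ^ 2 ≤
      C * (∫⁻ ξ, ENNReal.ofReal (w.toFun ξ) * F ξ ^ 2) *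
        ∫⁻ ξ, ENNReal.ofReal (w.toFun ξ) * G ξ ^ 2

/-- A power series in the operators `L u`, applied to `u`. -/
theorem exists_analytic_of_bilinear {𝕜 X : Type*} [RCLike 𝕜] [NormedAddCommGroup X]
    [NormedSpace 𝕜 X] [CompleteSpace X] (L : X →L[𝕜] X →L[𝕜] X) (c : ℕ → 𝕜) (hc : c 0 = 0)
    {R : ℝ} (hR : 0 < R)
    (hb : ∀ r : ℝ≥0, (r : ℝ) < R → ∃ M, ∀ n, ‖c n‖ * (r : ℝ) ^ (n + 1) ≤ M) :
    ∃ N : X → X, AnalyticAt 𝕜 N 0 ∧ HasStrictFDerivAt N (0 : X →L[𝕜] X) 0 ∧ N 0 = 0 ∧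
      ∀ᶠ u in 𝓝 0, HasSum (fun n => c n • (L u ^ n) u) (N u) := by
  let q : FormalMultilinearSeries 𝕜 (X →L[𝕜] X) (X →L[𝕜] X) :=
    FormalMultilinearSeries.ofScalars (X →L[𝕜] X) c
  have hrad : ENNReal.ofReal R ≤ q.radius := by
    refine ENNReal.le_of_forall_nnreal_lt fun r hr => ?_
    obtain ⟨M, hM⟩ := hb r (by
      rw [← ENNReal.ofReal_coe_nnreal] at hr; exact (ENNReal.ofReal_lt_ofReal_iff hR).1 hr)
    rcases eq_or_ne r 0 with rfl | hr0
    · simp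
    refine q.le_radius_of_bound (M / r) fun n => ?_
    have hrp : (0 : ℝ) < r := by positivity
    rw [le_div_iff₀ hrp, mul_assoc, ← pow_succ]
    refine le_trans ?_ (hM n)
    gcongr
    -- The zeroth term needs `c 0 = 0`: the norm bound is available only for positive powers, as
    -- operators on `X` need not have an identity of norm one.
    rcases Nat.eq_zero_or_pos n with rfl | hn
    · have : q 0 = 0 := FormalMultilinearSeries.ofScalars_eq_zero_of_scalar_zero _ hc
      rw [this, norm_zero]
      exact norm_nonneg _
    · exact FormalMultilinearSeries.ofScalars_norm_le _ c n hn
  have hq : HasFPowerSeriesOnBall q.sum q 0 q.radius :=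
    q.hasFPowerSeriesOnBall ((ENNReal.ofReal_pos.2 hR).trans_le hrad)
  have hH0 : q.sum 0 = 0 := by
    have := FormalMultilinearSeries.ofScalarsSum_zero (E := X →L[𝕜] X) c
    rwa [hc, zero_smul] at this
  have hL : AnalyticAt 𝕜 (fun u => q.sum (L u)) 0 := by
    refine AnalyticAt.comp (g := q.sum) ?_ (L.analyticAt 0)
    rw [map_zero]
    exact hq.analyticAt
  have hN : AnalyticAt 𝕜 (fun u => q.sum (L u) u) 0 :=
    ((ContinuousLinearMap.id 𝕜 (X →L[𝕜] X)).analyticAt_bilinear (q.sum (L 0), 0)).comp₂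
      hL analyticAt_id
  refine ⟨fun u => q.sum (L u) u, hN, ?_, by simp, ?_⟩
  -- By the product rule one term is evaluated at the vector `0`, and the other contains the sum of
  -- the series at the operator `0`, which vanishes because `c 0 = 0`.
  · have h1 := hL.hasStrictFDerivAt.clm_apply (hasStrictFDerivAt_id (0 : X))
    refine h1.congr_fderiv ?_
    ext u
    simp [hH0]
  · have h1 : ∀ᶠ u in 𝓝 (0 : X),
        L u ∈ Metric.eball (0 : X →L[𝕜] X) (ENNReal.ofReal R) := by
      refine L.continuous.continuousAt.eventually_mem ?_
      rw [map_zero]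
      exact Metric.eball_mem_nhds _ (ENNReal.ofReal_pos.2 hR)
    filter_upwards [h1] with u hu
    have h3 := hq.hasSum (Metric.eball_subset_eball hrad hu)
    rw [zero_add] at h3
    have h4 := ((ContinuousLinearMap.apply 𝕜 X u).hasSum h3)
    simpa [q, FormalMultilinearSeries.ofScalars_apply_eq] using h4

namespace WeightedFourierSpace

variable {𝕜 : Type*} [RCLike 𝕜] [NormedAlgebra 𝕜 ℂ] {d : ℕ} {w : FourierWeight d}

/-- The transform of a product is a convolution, and the convolution estimate for moduli supplies
the weighted bound. Measurable representatives are inserted because that estimate is stated for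
measurable functions. -/
theorem exists_mul (h : w.IsAlgebra) : ∃ C : ℝ, ∀ f g : WeightedFourierSpace 𝕜 w,
    ∃ u : WeightedFourierSpace 𝕜 w,
      fourierFun u =ᵐ[volume] fourierFun f ⋆[ContinuousLinearMap.mul ℂ ℂ] fourierFun g ∧
      ‖u‖ ≤ C * ‖f‖ * ‖g‖ := by
  obtain ⟨C, hC⟩ := h.conv_le
  refine ⟨√C, fun f g => ?_⟩
  have hf := integrable_fourierFun' h.integrable_inv f
  have hg := integrable_fourierFun' h.integrable_inv g
  have hfg := hf.integrable_convolution (ContinuousLinearMap.mul ℂ ℂ) hg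
  set k := fourierFun f ⋆[ContinuousLinearMap.mul ℂ ℂ] fourierFun g with hk
  have h1 : ∫⁻ ξ, ENNReal.ofReal (w.toFun ξ) * ‖k ξ‖ₑ ^ 2 ≤
      C * ENNReal.ofReal (‖f‖ ^ 2) * ENNReal.ofReal (‖g‖ ^ 2) := by
    have hfm := hf.1.enorm
    have hgm := hg.1.enorm
    have h2 := hC _ _ hfm.measurable_mk hgm.measurable_mk
    rw [← lconv_congr hfm.ae_eq_mk hgm.ae_eq_mk] at h2
    rw [ofReal_norm_sq f (isFunction_fourierFun f), ofReal_norm_sq g (isFunction_fourierFun g)]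
    refine le_trans ?_ (h2.trans_eq ?_)
    · refine lintegral_mono fun ξ => ?_
      gcongr
      exact enorm_convolution_le _ _ _
    · congr 1
      · congr 1
        refine lintegral_congr_ae ?_
        filter_upwards [hfm.ae_eq_mk] with ξ h
        rw [← h]
      · refine lintegral_congr_ae ?_
        filter_upwards [hgm.ae_eq_mk] with ξ h
        rw [← h]
  have hi : Integrable fun ξ => w.toFun ξ * ‖k ξ‖ ^ 2 := by
    refine ⟨w.measurable.aestronglyMeasurable.mul (hfg.1.norm.pow 2), ?_⟩
    have h2 : ∫⁻ ξ, ‖w.toFun ξ * ‖k ξ‖ ^ 2‖ₑ = ∫⁻ ξ, ENNReal.ofReal (w.toFun ξ) * ‖k ξ‖ₑ ^ 2 := by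
      refine lintegral_congr_ae ?_
      filter_upwards [w.pos] with ξ hξ
      rw [enorm_mul, enorm_pow, enorm_norm, Real.enorm_of_nonneg hξ.le]
    rw [hasFiniteIntegral_iff_enorm, h2]
    refine h1.trans_lt ?_
    finiteness
  obtain ⟨u, hu⟩ := exists_of_fourier h.integrable_inv hfg.1 hi
    ((isHermitianIn_fourierFun f).convolution (isHermitianIn_fourierFun g))
  refine ⟨u, fourierFun_ae_eq u hu, ?_⟩
  rw [← ofReal_norm_sq u hu, ← ENNReal.ofReal_coe_nnreal, ← ENNReal.ofReal_mul (by positivity),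
    ← ENNReal.ofReal_mul (by positivity), ENNReal.ofReal_le_ofReal_iff (by positivity)] at h1
  refine abs_le_of_sq_le_sq' ?_ (by positivity) |>.2
  rwa [mul_pow, mul_pow, Real.sq_sqrt (NNReal.coe_nonneg C)]

/-- The product of two elements of the weighted space. -/
noncomputable def mul (h : w.IsAlgebra) (f g : WeightedFourierSpace 𝕜 w) :
    WeightedFourierSpace 𝕜 w :=
  Classical.choose (Classical.choose_spec (exists_mul h) f g)

theorem fourierFun_mul (h : w.IsAlgebra) (f g : WeightedFourierSpace 𝕜 w) :
    fourierFun (mul h f g) =ᵐ[volume]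
      fourierFun f ⋆[ContinuousLinearMap.mul ℂ ℂ] fourierFun g :=
  (Classical.choose_spec (Classical.choose_spec (exists_mul h) f g)).1

theorem val_mul (h : w.IsAlgebra) (f g : WeightedFourierSpace 𝕜 w) (x : Space d) :
    val (mul h f g) x = val f x * val g x := by
  apply (algebraMap 𝕜 ℂ).injective
  rw [map_mul, algebraMap_val, algebraMap_val, algebraMap_val,
    Real.fourierInv_congr_ae (fourierFun_mul h f g), Real.fourierInv_eq_fourier_neg,
    Real.fourierInv_eq_fourier_neg, Real.fourierInv_eq_fourier_neg,
    Real.fourier_mul_convolution_eq (integrable_fourierFun' h.integrable_inv f)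
      (integrable_fourierFun' h.integrable_inv g)]

/-- Multiplication as a continuous bilinear map. -/
noncomputable def mulCLM (h : w.IsAlgebra) :
    WeightedFourierSpace 𝕜 w →L[𝕜] WeightedFourierSpace 𝕜 w →L[𝕜] WeightedFourierSpace 𝕜 w :=
  LinearMap.mkContinuous₂
    (LinearMap.mk₂ 𝕜 (mul h)
      (fun f f' g => val_injective h.integrable_inv <| funext fun x => by
        simp only [val_mul, val_add h.integrable_inv, add_mul])
      (fun c f g => val_injective h.integrable_inv <| funext fun x => by
        simp only [val_mul, val_smul, mul_assoc])
      (fun f g g' => val_injective h.integrable_inv <| funext fun x => by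
        simp only [val_mul, val_add h.integrable_inv, mul_add])
      (fun c f g => val_injective h.integrable_inv <| funext fun x => by
        simp only [val_mul, val_smul, mul_left_comm]))
    (Classical.choose (exists_mul (𝕜 := 𝕜) h))
    fun f g => (Classical.choose_spec (Classical.choose_spec (exists_mul h) f g)).2

theorem mulCLM_apply (h : w.IsAlgebra) (f g : WeightedFourierSpace 𝕜 w) :
    mulCLM h f g = mul h f g := rfl

theorem val_mulCLM_pow (h : w.IsAlgebra) (f g : WeightedFourierSpace 𝕜 w) (n : ℕ) (x : Space d) :
    val ((mulCLM h f ^ n) g) x = val f x ^ n * val g x := by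
  induction n with
  | zero => simp
  | succ n ih =>
    rw [pow_succ', mul_apply_eq_comp, mulCLM_apply, val_mul, ih, pow_succ']
    ring

/-- An analytic function acts on the weighted space as an analytic map near `0`. The map is
written without its linear part. -/
theorem exists_nonlinearity (h : w.IsAlgebra) {R : ℝ} (hR : 0 < R) {ζ : 𝕜 → 𝕜}
    {p : FormalMultilinearSeries 𝕜 𝕜 𝕜}
    (hζ : HasFPowerSeriesOnBall ζ p 0 (ENNReal.ofReal R)) (hζ₀ : ζ 0 = 0) {a : 𝕜}
    (hζ' : HasDerivAt ζ a 0) :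
    ∃ N : WeightedFourierSpace 𝕜 w → WeightedFourierSpace 𝕜 w,
      AnalyticAt 𝕜 N 0 ∧ HasStrictFDerivAt N (0 : WeightedFourierSpace 𝕜 w →L[𝕜] _) 0 ∧
      N 0 = 0 ∧ ∀ᶠ u in 𝓝 0, ∀ x, val (N u) x = ζ (val u x) - a * val u x := by
  have := completeSpace (𝕜 := 𝕜) h.integrable_inv
  -- The space has no unit, so `u^{n+1}` is written as the operator of multiplication by `u`, to the
  -- power `n`, applied to `u`. This shifts the coefficients by one, and the entry `0` at `n = 0`
  -- removes the linear term.
  let c : ℕ → 𝕜 := fun n => if n = 0 then 0 else p.coeff (n + 1)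
  obtain ⟨N, hN1, hN2, hN3, hN4⟩ := exists_analytic_of_bilinear (mulCLM (𝕜 := 𝕜) h) c rfl hR
    (fun r hr => by
      have hr' : (r : ℝ≥0∞) < p.radius := lt_of_lt_of_le (by
        rw [← ENNReal.ofReal_coe_nnreal]; exact (ENNReal.ofReal_lt_ofReal_iff hR).2 hr) hζ.r_le
      obtain ⟨M, hM0, hM⟩ := p.norm_mul_pow_le_of_lt_radius hr'
      refine ⟨M, fun n => ?_⟩
      rcases Nat.eq_zero_or_pos n with rfl | hn
      · simpa [c] using hM0.le
      · simpa [c, hn.ne'] using hM (n + 1))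
  refine ⟨N, hN1, hN2, hN3, ?_⟩
  have h2 : ∀ᶠ u in 𝓝 (0 : WeightedFourierSpace 𝕜 w), ∀ x, ‖val u x‖ < R := by
    obtain ⟨C, hC0, hC⟩ := exists_norm_val_le (𝕜 := 𝕜) h.integrable_inv
    filter_upwards [Metric.ball_mem_nhds (0 : WeightedFourierSpace 𝕜 w)
      (show 0 < R / (C + 1) by positivity)] with u hu x
    rw [mem_ball_zero_iff, lt_div_iff₀ (by positivity)] at hu
    refine (hC u x).trans_lt (lt_of_le_of_lt ?_ hu)
    nlinarith [norm_nonneg u]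
  filter_upwards [hN4, h2] with u h4 hu' x
  have h5 := (evalCLM h.integrable_inv x).hasSum h4
  have h6 := hζ.hasSum (y := val u x) (by
    simpa [Metric.mem_eball, edist_zero_right, ← ofReal_norm, hR] using hu' x)
  rw [zero_add] at h6
  have hc0 : p.coeff 0 = 0 := by
    rw [← hζ₀]; exact hζ.coeff_zero _
  have hc1 : p.coeff 1 = a := hζ.hasFPowerSeriesAt.hasDerivAt.unique hζ'
  have h7 : HasSum (fun n => p.coeff n * val u x ^ n) (ζ (val u x)) := by
    simpa [mul_comm] using h6
  have h8 := ((hasSum_nat_add_iff' 1).2 h7).sub (hasSum_ite_eq 0 (a * val u x))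
  simp only [Finset.range_one, Finset.sum_singleton, hc0, zero_mul, sub_zero] at h8
  refine h5.unique ?_
  convert! h8 using 2 with n
  rw [map_smul, evalCLM_apply, val_mulCLM_pow, ← pow_succ, smul_eq_mul]
  rcases Nat.eq_zero_or_pos n with rfl | hn
  · simp [c, hc1]
  · simp [c, hn.ne']

end WeightedFourierSpace

/-! ### Convolution inequalities for nonnegative functions -/

section Convolution

variable {d : ℕ} {F F' G G' K : Space d → ℝ≥0∞}

theorem measurable_lconv (hF : Measurable F) (hG : Measurable G) : Measurable (lconv F G) := by
  unfold lconv
  have : Measurable fun p : Space d × Space d => F p.2 * G (p.1 - p.2) := by fun_prop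
  exact this.lintegral_prod_right'

theorem lconv_mono (hF : ∀ᵐ ξ, F ξ ≤ F' ξ) (hG : ∀ᵐ ξ, G ξ ≤ G' ξ) (ξ : Space d) :
    lconv F G ξ ≤ lconv F' G' ξ := by
  refine lintegral_mono_ae ?_
  have h := (quasiMeasurePreserving_sub_left (volume : Measure (Space d)) ξ).ae hG
  filter_upwards [hF, h] with η h1 h2
  gcongr

theorem lconv_comm (F G : Space d → ℝ≥0∞) : lconv F G = lconv G F := by
  funext ξ
  unfold lconv
  rw [← lintegral_sub_left_eq_self _ ξ]
  simp only [sub_sub_cancel, mul_comm]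

theorem lconv_add (hF : Measurable F) (hG : Measurable G) (ξ : Space d) :
    lconv F (fun η => G η + G' η) ξ = lconv F G ξ + lconv F G' ξ := by
  unfold lconv
  simp only [mul_add]
  exact lintegral_add_left (by fun_prop) _

theorem lintegral_lconv_le_aux {F G : Space d → ℝ≥0∞} (hF : Measurable F) (hG : Measurable G) :
    ∫⁻ ξ, ∫⁻ η, F η * G (ξ - η) = (∫⁻ ξ, F ξ) * ∫⁻ ξ, G ξ := by
  rw [lintegral_lintegral_swap (by fun_prop)]
  have : ∀ η, ∫⁻ ξ, F η * G (ξ - η) = F η * ∫⁻ ξ, G ξ := fun η => by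
    rw [lintegral_const_mul _ (by fun_prop), lintegral_sub_right_eq_self]
  simp only [this]
  exact lintegral_mul_const _ hF

/-- Young's inequality `L² * L¹ ⊆ L²`. -/
theorem lintegral_lconv_sq_le (hF : Measurable F) (hG : Measurable G) :
    ∫⁻ ξ, lconv F G ξ ^ 2 ≤ (∫⁻ ξ, F ξ ^ 2) * (∫⁻ ξ, G ξ) ^ 2 := by
  have h1 : ∀ z : ℝ≥0∞, (z ^ (1 / 2 : ℝ)) ^ 2 = z := fun z => by
    rw [← ENNReal.rpow_natCast, ← ENNReal.rpow_mul]; norm_num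
  -- Cauchy–Schwarz for the splitting `F G = (F G^{1/2}) · G^{1/2}`.
  have h2 : ∀ ξ, lconv F G ξ ^ 2 ≤ (∫⁻ η, F η ^ 2 * G (ξ - η)) * ∫⁻ ξ, G ξ := fun ξ => by
    have h3 := lintegral_mul_sq_le (μ := (volume : Measure (Space d)))
      (f := fun η => F η * G (ξ - η) ^ (1 / 2 : ℝ)) (g := fun η => G (ξ - η) ^ (1 / 2 : ℝ))
      (by fun_prop) (by fun_prop)
    simp only [mul_pow, h1, mul_assoc, ← pow_two] at h3
    rwa [lintegral_sub_left_eq_self (fun η => G η)] at h3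
  refine (lintegral_mono h2).trans_eq ?_
  have hm : Measurable fun p : Space d × Space d => F p.2 ^ 2 * G (p.1 - p.2) := by fun_prop
  rw [lintegral_mul_const _ hm.lintegral_prod_right',
    lintegral_lconv_le_aux (F := fun η => F η ^ 2) (by fun_prop) hG]
  ring

/-- Young's convolution inequality. -/
theorem lintegral_lconv_rpow_le (hF : Measurable F) (hG : Measurable G) {p q r : ℝ}
    (hp : 0 < p) (hq : 0 < q) (hr : 0 < r) (hpr : p ≤ r) (hqr : q ≤ r)
    (hpqr : 1 / p + 1 / q = 1 + 1 / r) :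
    ∫⁻ ξ, lconv F G ξ ^ r ≤
      ((∫⁻ ξ, F ξ ^ p) * ∫⁻ ξ, G ξ ^ q) *
        ((∫⁻ ξ, F ξ ^ p) ^ (r / p - 1) * (∫⁻ ξ, G ξ ^ q) ^ (r / q - 1)) := by
  have ha : 0 ≤ 1 / p - 1 / r := sub_nonneg.2 (one_div_le_one_div_of_le hp hpr)
  have hb : 0 ≤ 1 / q - 1 / r := sub_nonneg.2 (one_div_le_one_div_of_le hq hqr)
  have h1 : ∀ ξ, lconv F G ξ ^ r ≤ (∫⁻ η, F η ^ p * G (ξ - η) ^ q) *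
      ((∫⁻ ξ, F ξ ^ p) ^ (r / p - 1) * (∫⁻ ξ, G ξ ^ q) ^ (r / q - 1)) := fun ξ => by
    -- Hölder for three factors: `F G` is the product of `(F^p G^q)^{1/r}`, `(F^p)^{1/p - 1/r}` and
    -- `(G^q)^{1/q - 1/r}`, whose exponents add up to `1` by the relation between `p`, `q` and `r`.
    let f : Fin 3 → Space d → ℝ≥0∞ := ![fun η => F η ^ p * G (ξ - η) ^ q, fun η => F η ^ p,
      fun η => G (ξ - η) ^ q]
    let e : Fin 3 → ℝ := ![1 / r, 1 / p - 1 / r, 1 / q - 1 / r]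
    have h2 := ENNReal.lintegral_prod_norm_pow_le (μ := (volume : Measure (Space d)))
      Finset.univ (f := f) (p := e)
      (by intro i _; fin_cases i <;> simp only [f] <;> dsimp <;> fun_prop)
      (by simp only [Fin.sum_univ_three, e]; dsimp; linarith)
      (by intro i _; fin_cases i <;> simp only [e] <;> dsimp <;> positivity)
    simp only [Fin.prod_univ_three, f, e, Matrix.cons_val_zero, Matrix.cons_val_one,
      Matrix.cons_val_two, Matrix.head_cons, Matrix.tail_cons] at h2
    have h3 : ∀ η, (F η ^ p * G (ξ - η) ^ q) ^ (1 / r) * (F η ^ p) ^ (1 / p - 1 / r) *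
        (G (ξ - η) ^ q) ^ (1 / q - 1 / r) = F η * G (ξ - η) := fun η => by
      have h4 : ∀ (z : ℝ≥0∞) {s : ℝ}, 0 < s → s ≤ r →
          (z ^ s) ^ (1 / r) * (z ^ s) ^ (1 / s - 1 / r) = z := fun z s hs hsr => by
        rw [← ENNReal.rpow_add_of_nonneg _ _ (by positivity)
          (sub_nonneg.2 (one_div_le_one_div_of_le hs hsr)), ← ENNReal.rpow_mul]
        rw [show s * (1 / r + (1 / s - 1 / r)) = 1 by field_simp; ring, ENNReal.rpow_one]
      rw [ENNReal.mul_rpow_of_nonneg _ _ (by positivity)]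
      calc _ = ((F η ^ p) ^ (1 / r) * (F η ^ p) ^ (1 / p - 1 / r)) *
            ((G (ξ - η) ^ q) ^ (1 / r) * (G (ξ - η) ^ q) ^ (1 / q - 1 / r)) := by ring
        _ = _ := by rw [h4 _ hp hpr, h4 _ hq hqr]
    simp only [h3] at h2
    rw [lintegral_sub_left_eq_self (fun η => G η ^ q)] at h2
    have h5 := ENNReal.rpow_le_rpow h2 hr.le
    refine h5.trans_eq ?_
    rw [ENNReal.mul_rpow_of_nonneg _ _ hr.le, ENNReal.mul_rpow_of_nonneg _ _ hr.le,
      ← ENNReal.rpow_mul, ← ENNReal.rpow_mul, ← ENNReal.rpow_mul, mul_assoc]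
    rw [show 1 / r * r = 1 by field_simp, ENNReal.rpow_one,
      show (1 / p - 1 / r) * r = r / p - 1 by field_simp,
      show (1 / q - 1 / r) * r = r / q - 1 by field_simp]
  refine (lintegral_mono h1).trans_eq ?_
  have hm : Measurable fun z : Space d × Space d => F z.2 ^ p * G (z.1 - z.2) ^ q := by fun_prop
  rw [lintegral_mul_const _ hm.lintegral_prod_right',
    lintegral_lconv_le_aux (F := fun η => F η ^ p) (G := fun η => G η ^ q) (by fun_prop)
      (by fun_prop)]

theorem measurable_iterate_lconv (hK : Measurable K) (hG : Measurable G) (n : ℕ) :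
    Measurable ((lconv K)^[n] G) := by
  induction n with
  | zero => exact hG
  | succ n ih => rw [Function.iterate_succ_apply']; exact measurable_lconv hK ih

/-- Iterated convolution with an `L^q` function improves integrability from `L¹` to `L²`. -/
theorem lintegral_iterate_lconv_sq_lt_top (hK : Measurable K) (hG : Measurable G) {n : ℕ}
    (hn : 0 < n) (hKi : ∫⁻ ξ, K ξ ^ (2 * n / (2 * n - 1) : ℝ) < ⊤) (hGi : ∫⁻ ξ, G ξ < ⊤) :
    ∫⁻ ξ, (lconv K)^[n] G ξ ^ 2 < ⊤ := by
  have hn1 : (1 : ℝ) ≤ n := by exact_mod_cast hn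
  -- Each convolution with `K` lowers the reciprocal exponent by `1/(2n)`, from `1` at `j = 0` to
  -- `1/2` at `j = n`.
  have h1 : ∀ j ≤ n, ∫⁻ ξ, (lconv K)^[j] G ξ ^ (2 * n / (2 * n - j) : ℝ) < ⊤ := by
    intro j
    induction j with
    | zero =>
      intro _
      have : (2 * n / (2 * n - (0 : ℕ)) : ℝ) = 1 := by
        rw [Nat.cast_zero, sub_zero]; exact div_self (by positivity)
      simpa only [this, ENNReal.rpow_one, Function.iterate_zero, id] using hGi
    | succ j ih =>
      intro hj
      have ih := ih (Nat.le_of_succ_le hj)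
      have hj' : (j : ℝ) + 1 ≤ n := by exact_mod_cast hj
      have e1 : (0 : ℝ) < 2 * n - 1 := by linarith
      have e2 : (0 : ℝ) < 2 * n - j := by linarith
      have e3 : (0 : ℝ) < 2 * n - (j + 1) := by linarith
      have hj0 : (0 : ℝ) ≤ j := Nat.cast_nonneg j
      rw [Function.iterate_succ_apply']
      refine (lintegral_lconv_rpow_le hK (measurable_iterate_lconv hK hG j)
        (p := 2 * n / (2 * n - 1)) (q := 2 * n / (2 * n - j)) (by positivity) (by positivity)
        (by push_cast; positivity) ?_ ?_ ?_).trans_lt ?_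
      · push_cast
        gcongr
        linarith
      · push_cast
        gcongr
        linarith
      · push_cast
        field_simp
        ring
      · refine ENNReal.mul_lt_top (ENNReal.mul_lt_top hKi ih) (ENNReal.mul_lt_top ?_ ?_)
        · refine ENNReal.rpow_lt_top_of_nonneg ?_ hKi.ne
          push_cast
          rw [sub_nonneg, one_le_div (by positivity)]
          gcongr
          linarith
        · refine ENNReal.rpow_lt_top_of_nonneg ?_ ih.ne
          push_cast
          rw [sub_nonneg, one_le_div (by positivity)]
          gcongr
          linarith
  have h2 := h1 n le_rfl
  have h3 : (2 * n / (2 * n - n) : ℝ) = 2 := by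
    rw [show (2 * n - n : ℝ) = n by ring]; field_simp
  simpa [h3] using h2

/-- A subsolution `A ≤ K * A + G` in `L¹` with `G ∈ L²` and `K ∈ L¹ ∩ L^q` is in `L²`. -/
theorem lintegral_sq_lt_top_of_le_lconv {A : Space d → ℝ≥0∞} (hA : Measurable A)
    (hK : Measurable K) (hG : Measurable G) {n : ℕ} (hn : 0 < n)
    (hKq : ∫⁻ ξ, K ξ ^ (2 * n / (2 * n - 1) : ℝ) < ⊤) (hK1 : ∫⁻ ξ, K ξ < ⊤)
    (hA1 : ∫⁻ ξ, A ξ < ⊤) (hG2 : ∫⁻ ξ, G ξ ^ 2 < ⊤)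
    (h : ∀ᵐ ξ, A ξ ≤ lconv K A ξ + G ξ) : ∫⁻ ξ, A ξ ^ 2 < ⊤ := by
  have hadd : ∀ {H H' : Space d → ℝ≥0∞}, Measurable H → Measurable H' → ∫⁻ ξ, H ξ ^ 2 < ⊤ →
      ∫⁻ ξ, H' ξ ^ 2 < ⊤ → ∫⁻ ξ, (H ξ + H' ξ) ^ 2 < ⊤ := fun {H H'} hm hm' h1 h2 => by
    have h3 : ∀ ξ, (H ξ + H' ξ) ^ 2 ≤ 2 * (H ξ ^ 2 + H' ξ ^ 2) := fun ξ => by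
      have := ENNReal.rpow_add_le_mul_rpow_add_rpow (H ξ) (H' ξ) one_le_two
      norm_num at this
      exact this
    refine (lintegral_mono h3).trans_lt ?_
    rw [lintegral_const_mul _ (by fun_prop), lintegral_add_left (by fun_prop)]
    finiteness
  -- The inequality is substituted into itself `m` times. The accumulated source stays in `L²`,
  -- because convolution with `K ∈ L¹` preserves `L²`.
  have h1 : ∀ m : ℕ, ∃ G' : Space d → ℝ≥0∞, Measurable G' ∧ ∫⁻ ξ, G' ξ ^ 2 < ⊤ ∧
      ∀ᵐ ξ, A ξ ≤ (lconv K)^[m] A ξ + G' ξ := by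
    intro m
    induction m with
    | zero => exact ⟨0, measurable_zero, by simp, by simp⟩
    | succ m ih =>
      obtain ⟨G', h1, h2, h3⟩ := ih
      refine ⟨fun ξ => lconv K G' ξ + G ξ, (measurable_lconv hK h1).add hG,
        hadd (measurable_lconv hK h1) hG ?_ hG2, ?_⟩
      · rw [lconv_comm]
        refine (lintegral_lconv_sq_le h1 hK).trans_lt ?_
        finiteness
      · filter_upwards [h] with ξ h
        refine h.trans ?_
        rw [Function.iterate_succ_apply', ← add_assoc, ← lconv_add hK
          (measurable_iterate_lconv hK hA m)]
        gcongr
        exact lconv_mono (Eventually.of_forall fun _ => le_rfl) h3 ξ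
  obtain ⟨G', h2, h3, h4⟩ := h1 n
  refine (lintegral_mono_ae (g := fun ξ => ((lconv K)^[n] A ξ + G' ξ) ^ 2) ?_).trans_lt
    (hadd (measurable_iterate_lconv hK hA n) h2
      (lintegral_iterate_lconv_sq_lt_top hK hA hn hKq hA1) h3)
  filter_upwards [h4] with ξ h
  gcongr

/-- Duality: a function paired boundedly with `L²` is in `L²`. -/
theorem lintegral_sq_le_of_forall_pairing {T : Space d → ℝ≥0∞} (hT : Measurable T) {A : ℝ≥0∞}
    (h : ∀ H : Space d → ℝ≥0∞, Measurable H → (∫⁻ ξ, H ξ * T ξ) ^ 2 ≤ A * ∫⁻ ξ, H ξ ^ 2) :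
    ∫⁻ ξ, T ξ ^ 2 ≤ A := by
  classical
  -- Testing with `T` itself would require `∫ T² < ∞` beforehand. Truncation in height and support
  -- makes the integral finite, so that it can be cancelled; monotone convergence removes the
  -- truncation.
  let H : ℕ → Space d → ℝ≥0∞ := fun n =>
    (Metric.ball (0 : Space d) n).indicator fun ξ => min (T ξ) n
  have hH : ∀ n, Measurable (H n) := fun n =>
    (hT.min measurable_const).indicator Metric.isOpen_ball.measurableSet
  have hmono : Monotone H := by
    intro m n hmn ξ
    have h1 : (m : ℝ≥0∞) ≤ n := by exact_mod_cast hmn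
    simp only [H, Set.indicator_apply, mem_ball_zero_iff]
    split_ifs with h2 h3
    · gcongr
    · exact absurd (h2.trans_le (by exact_mod_cast hmn)) h3
    · exact zero_le
    · exact le_rfl
  have hle : ∀ n ξ, H n ξ ≤ T ξ := fun n ξ => by
    simp only [H, Set.indicator_apply]
    split_ifs
    · exact min_le_left _ _
    · exact zero_le
  have hb : ∀ n, ∫⁻ ξ, H n ξ ^ 2 ≤ A := fun n => by
    set I := ∫⁻ ξ, H n ξ ^ 2 with hI
    have hfin : I < ⊤ := by
      have : ∀ ξ, H n ξ ^ 2 ≤ (Metric.ball (0 : Space d) n).indicator (fun _ => (n : ℝ≥0∞) ^ 2) ξ :=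
        fun ξ => by
          simp only [H, Set.indicator_apply]
          split_ifs
          · gcongr; exact min_le_right _ _
          · simp
      refine (lintegral_mono this).trans_lt ?_
      rw [lintegral_indicator Metric.isOpen_ball.measurableSet, lintegral_const]
      simp only [Measure.restrict_apply_univ]
      exact ENNReal.mul_lt_top (by finiteness) measure_ball_lt_top
    have h1 : I ≤ ∫⁻ ξ, H n ξ * T ξ := by
      refine lintegral_mono fun ξ => ?_
      simp only [pow_two]
      gcongr
      exact hle n ξ
    have h2 : I * I ≤ A * I := by
      rw [← pow_two]
      exact (pow_le_pow_left' h1 2).trans (h _ (hH n))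
    rcases eq_or_ne I 0 with h0 | h0
    · rw [h0]; exact zero_le
    · exact (ENNReal.mul_le_mul_iff_left h0 hfin.ne).1 h2
  have hsup : ∀ ξ, ⨆ n, H n ξ ^ 2 = T ξ ^ 2 := fun ξ => by
    refine le_antisymm (iSup_le fun n => by gcongr; exact hle n ξ) ?_
    have hlim : Tendsto (fun n : ℕ => min (T ξ) (n : ℝ≥0∞) ^ 2) atTop (𝓝 (T ξ ^ 2)) := by
      refine ENNReal.Tendsto.pow ?_
      have := (tendsto_const_nhds (x := T ξ)).min ENNReal.tendsto_nat_nhds_top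
      rwa [min_top_right] at this
    refine le_of_tendsto hlim ?_
    obtain ⟨N, hN⟩ := exists_nat_gt ‖ξ‖
    filter_upwards [eventually_ge_atTop N] with n hn
    refine le_trans (le_of_eq ?_) (le_iSup (fun n => H n ξ ^ 2) n)
    have : ξ ∈ Metric.ball (0 : Space d) n := by
      rw [mem_ball_zero_iff]; exact hN.trans_le (by exact_mod_cast hn)
    simp only [H, Set.indicator_of_mem this]
  calc ∫⁻ ξ, T ξ ^ 2 = ∫⁻ ξ, ⨆ n, H n ξ ^ 2 := by simp only [hsup]
    _ = ⨆ n, ∫⁻ ξ, H n ξ ^ 2 := lintegral_iSup (fun n => (hH n).pow_const 2)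
        fun m n hmn ξ => by dsimp; gcongr; exact hmono hmn ξ
    _ ≤ A := iSup_le hb

/-- A bilinear convolution estimate for a kernel with a uniform bound in `L²`. -/
theorem lintegral_kernel_sq_le (hF : Measurable F) (hG : Measurable G)
    {κ : Space d → Space d → ℝ≥0∞} (hκ : Measurable fun p : Space d × Space d => κ p.1 p.2)
    {M : ℝ≥0∞} (hM : ∀ η, ∫⁻ ξ, κ ξ η ^ 2 ≤ M) :
    ∫⁻ ξ, (∫⁻ η, κ ξ η * (F η * G (ξ - η))) ^ 2 ≤ M * (∫⁻ ξ, F ξ ^ 2) * ∫⁻ ξ, G ξ ^ 2 := by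
  have hκ' : ∀ η, Measurable fun ξ => κ ξ η := fun η => hκ.comp measurable_prodMk_right
  have hm : Measurable fun p : Space d × Space d => κ p.1 p.2 * (F p.2 * G (p.1 - p.2)) :=
    hκ.mul (by fun_prop)
  refine lintegral_sq_le_of_forall_pairing hm.lintegral_prod_right' fun H hH => ?_
  have hm2 : Measurable fun p : Space d × Space d => κ p.1 p.2 * (H p.1 * G (p.1 - p.2)) :=
    hκ.mul (by fun_prop)
  have h1 : ∫⁻ ξ, H ξ * ∫⁻ η, κ ξ η * (F η * G (ξ - η)) =
      ∫⁻ η, F η * ∫⁻ ξ, κ ξ η * (H ξ * G (ξ - η)) := by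
    calc _ = ∫⁻ ξ, ∫⁻ η, H ξ * (κ ξ η * (F η * G (ξ - η))) :=
          lintegral_congr fun ξ => (lintegral_const_mul _ (hm.comp measurable_prodMk_left)).symm
      _ = ∫⁻ η, ∫⁻ ξ, H ξ * (κ ξ η * (F η * G (ξ - η))) :=
          lintegral_lintegral_swap
            (show Measurable fun p : Space d × Space d => H p.1 * (κ p.1 p.2 * (F p.2 * G (p.1 - p.2)))
              from (hH.comp measurable_fst).mul hm).aemeasurable
      _ = ∫⁻ η, ∫⁻ ξ, F η * (κ ξ η * (H ξ * G (ξ - η))) := by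
          refine lintegral_congr fun η => lintegral_congr fun ξ => by ring
      _ = _ := lintegral_congr fun η =>
          lintegral_const_mul _ (hm2.comp measurable_prodMk_right)
  rw [h1]
  -- After testing with `H` and exchanging the integrals, the inner integration is over `ξ` with `η`
  -- fixed; here Cauchy–Schwarz uses exactly the uniform `L²` bound of `κ`.
  have h2 : ∀ η, (∫⁻ ξ, κ ξ η * (H ξ * G (ξ - η))) ^ 2 ≤ M * ∫⁻ ξ, H ξ ^ 2 * G (ξ - η) ^ 2 :=
    fun η => by
      refine (lintegral_mul_sq_le (hκ' η).aemeasurable (by fun_prop)).trans ?_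
      simp only [mul_pow]
      gcongr
      exact hM η
  have hm3 : Measurable fun p : Space d × Space d => H p.2 ^ 2 * G (p.2 - p.1) ^ 2 := by fun_prop
  calc (∫⁻ η, F η * ∫⁻ ξ, κ ξ η * (H ξ * G (ξ - η))) ^ 2
      ≤ (∫⁻ η, F η ^ 2) * ∫⁻ η, (∫⁻ ξ, κ ξ η * (H ξ * G (ξ - η))) ^ 2 :=
        lintegral_mul_sq_le hF.aemeasurable hm2.lintegral_prod_left'.aemeasurable
    _ ≤ (∫⁻ η, F η ^ 2) * ∫⁻ η, M * ∫⁻ ξ, H ξ ^ 2 * G (ξ - η) ^ 2 := by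
        gcongr with η
        exact h2 η
    _ = (∫⁻ η, F η ^ 2) * (M * ((∫⁻ ξ, H ξ ^ 2) * ∫⁻ ξ, G ξ ^ 2)) := by
        rw [lintegral_const_mul _ hm3.lintegral_prod_right']
        congr 2
        rw [lintegral_lintegral_swap hm3.aemeasurable, ← lintegral_mul_const _ (hH.pow_const 2)]
        refine lintegral_congr fun ξ => ?_
        have hG2 : Measurable fun η => G (ξ - η) ^ 2 := by fun_prop
        dsimp only
        rw [lintegral_const_mul _ hG2, lintegral_sub_left_eq_self (fun η => G η ^ 2)]
    _ = _ := by ring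

end Convolution

/-! ### A kernel criterion for algebra weights -/

theorem FourierWeight.lintegral_inv_lt_top {d : ℕ} {w : FourierWeight d}
    (hw : Integrable fun ξ => (w.toFun ξ)⁻¹) : ∫⁻ ξ, (ENNReal.ofReal (w.toFun ξ))⁻¹ < ⊤ := by
  rw [← WeightedFourierSpace.ofReal_integral_inv hw]
  exact ENNReal.ofReal_lt_top

/-- A weight is an algebra weight if `w (a + b) ≤ C (w a + w b + (k + k') w a w b)`, where the
kernels `k`, `k'` have uniformly bounded integrals. -/
theorem FourierWeight.isAlgebra_of_kernel {d : ℕ} {w : FourierWeight d}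
    (hw : Integrable fun ξ => (w.toFun ξ)⁻¹) (hw₀ : ∀ ξ, 0 ≤ w.toFun ξ)
    {k : Space d → Space d → ℝ} (hk : Measurable fun p : Space d × Space d => k p.1 p.2)
    (hk₀ : ∀ ξ η, 0 ≤ k ξ η) {M : ℝ≥0} (hM : ∀ η, ∫⁻ ξ, ENNReal.ofReal (k ξ η) ≤ M) {C : ℝ}
    (hC : 0 ≤ C) (h : ∀ ξ η, w.toFun ξ ≤ C * (w.toFun η + w.toFun (ξ - η) +
      (k ξ η + k ξ (ξ - η)) * (w.toFun η * w.toFun (ξ - η)))) : w.IsAlgebra := by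
  refine ⟨hw, ?_⟩
  -- The square root is subadditive and multiplicative, so the hypothesis on `w` passes to `Ω = √w`
  -- with `κ = √k`.
  let s : ℝ≥0∞ → ℝ≥0∞ := fun z => z ^ (1 / 2 : ℝ)
  have hsm : Measurable s := by fun_prop
  have hs_add : ∀ x y, s (x + y) ≤ s x + s y := fun x y =>
    ENNReal.rpow_add_le_add_rpow x y (by norm_num) (by norm_num)
  have hs_mul : ∀ x y, s (x * y) = s x * s y := fun x y =>
    ENNReal.mul_rpow_of_nonneg x y (by norm_num)
  have hs_mono : Monotone s := ENNReal.monotone_rpow_of_nonneg (by norm_num)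
  have hs_sq : ∀ x, s x ^ 2 = x := fun x => by
    simp only [s]; rw [← ENNReal.rpow_natCast, ← ENNReal.rpow_mul]; norm_num
  let Ω : Space d → ℝ≥0∞ := fun ξ => s (ENNReal.ofReal (w.toFun ξ))
  let κ : Space d → Space d → ℝ≥0∞ := fun ξ η => s (ENNReal.ofReal (k ξ η))
  have hΩm : Measurable Ω := hsm.comp w.measurable.ennreal_ofReal
  have hκm : Measurable fun p : Space d × Space d => κ p.1 p.2 := hsm.comp hk.ennreal_ofReal
  have hκM : ∀ η, ∫⁻ ξ, κ ξ η ^ 2 ≤ M := fun η => by simpa only [κ, hs_sq] using hM η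
  have hΩ : ∀ ξ η, Ω ξ ≤ s (ENNReal.ofReal C) * (Ω η + Ω (ξ - η) +
      (κ ξ η + κ ξ (ξ - η)) * (Ω η * Ω (ξ - η))) := fun ξ η => by
    have h1 := hs_mono (ENNReal.ofReal_le_ofReal (h ξ η))
    refine h1.trans ?_
    have e1 := hw₀ η
    have e2 := hw₀ (ξ - η)
    have e3 := hk₀ ξ η
    have e4 := hk₀ ξ (ξ - η)
    rw [ENNReal.ofReal_mul hC, ENNReal.ofReal_add (by positivity) (by positivity),
      ENNReal.ofReal_add e1 e2, ENNReal.ofReal_mul (by positivity), ENNReal.ofReal_mul e1,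
      ENNReal.ofReal_add e3 e4, hs_mul]
    gcongr
    refine (hs_add _ _).trans (add_le_add (hs_add _ _) ?_)
    rw [hs_mul, hs_mul]
    gcongr
    exact hs_add _ _
  set I := ∫⁻ ξ, (ENNReal.ofReal (w.toFun ξ))⁻¹ with hI
  have hIfin : I < ⊤ := FourierWeight.lintegral_inv_lt_top hw
  have hC' : (ENNReal.ofReal C * 16 * (2 * I + 2 * M)) ≠ ⊤ := by finiteness
  refine ⟨(ENNReal.ofReal C * 16 * (2 * I + 2 * M)).toNNReal, fun F G hF hG => ?_⟩
  rw [ENNReal.coe_toNNReal hC']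
  set f : Space d → ℝ≥0∞ := fun η => Ω η * F η with hf
  set g : Space d → ℝ≥0∞ := fun η => Ω η * G η with hg
  have hfm : Measurable f := hΩm.mul hF
  have hgm : Measurable g := hΩm.mul hG
  have hff : ∫⁻ ξ, f ξ ^ 2 = ∫⁻ ξ, ENNReal.ofReal (w.toFun ξ) * F ξ ^ 2 := by
    simp only [hf, mul_pow, Ω, hs_sq]
  have hgg : ∫⁻ ξ, g ξ ^ 2 = ∫⁻ ξ, ENNReal.ofReal (w.toFun ξ) * G ξ ^ 2 := by
    simp only [hg, mul_pow, Ω, hs_sq]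
  let T₁ : Space d → ℝ≥0∞ := lconv f G
  let T₂ : Space d → ℝ≥0∞ := lconv g F
  let T₃ : Space d → ℝ≥0∞ := fun ξ => ∫⁻ η, κ ξ η * (f η * g (ξ - η))
  let T₄ : Space d → ℝ≥0∞ := fun ξ => ∫⁻ η, κ ξ η * (g η * f (ξ - η))
  have hm₃ : Measurable fun p : Space d × Space d => κ p.1 p.2 * (f p.2 * g (p.1 - p.2)) :=
    hκm.mul (by fun_prop)
  have hm₄ : Measurable fun p : Space d × Space d => κ p.1 p.2 * (g p.2 * f (p.1 - p.2)) :=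
    hκm.mul (by fun_prop)
  -- The terms `T₁`, `T₂` put the weight on one input and are handled by Young's inequality with the
  -- other input in `L¹`; `T₃`, `T₄` carry the kernel and the weight on both inputs.
  have hpt : ∀ ξ, Ω ξ * lconv F G ξ ≤ s (ENNReal.ofReal C) * (T₁ ξ + T₂ ξ + T₃ ξ + T₄ ξ) := by
    intro ξ
    have e₂ : T₂ ξ = ∫⁻ η, F η * g (ξ - η) := by simp only [T₂]; rw [lconv_comm]; rfl
    -- The reflection `η ↦ ξ - η` exchanges the inputs, so both kernel terms reduce to the bound for
    -- `κ ξ η`.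
    have e₄ : T₄ ξ = ∫⁻ η, κ ξ (ξ - η) * (g (ξ - η) * f η) := by
      simp only [T₄]
      rw [← lintegral_sub_left_eq_self _ ξ]
      simp only [sub_sub_cancel]
    have n₁ : Measurable fun η => f η * G (ξ - η) := by fun_prop
    have n₂ : Measurable fun η => F η * g (ξ - η) := by fun_prop
    have n₃ : Measurable fun η => κ ξ η * (f η * g (ξ - η)) := hm₃.comp measurable_prodMk_left
    have n₁₂ : Measurable fun η => f η * G (ξ - η) + F η * g (ξ - η) := n₁.add n₂
    have n₁₃ : Measurable fun η => f η * G (ξ - η) + F η * g (ξ - η) +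
        κ ξ η * (f η * g (ξ - η)) := n₁₂.add n₃
    calc Ω ξ * lconv F G ξ = ∫⁻ η, Ω ξ * (F η * G (ξ - η)) := by
          unfold lconv; rw [lintegral_const_mul _ (by fun_prop)]
      _ ≤ ∫⁻ η, s (ENNReal.ofReal C) * (f η * G (ξ - η) + F η * g (ξ - η) +
            κ ξ η * (f η * g (ξ - η)) + κ ξ (ξ - η) * (g (ξ - η) * f η)) := by
          refine lintegral_mono fun η => ?_
          refine (mul_le_mul_left (hΩ ξ η) (F η * G (ξ - η))).trans_eq ?_
          simp only [hf, hg]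
          ring
      _ = _ := by
          rw [lintegral_const_mul' _ _ (by
              rw [← lt_top_iff_ne_top]
              exact ENNReal.rpow_lt_top_of_nonneg (by norm_num) ENNReal.ofReal_ne_top),
            lintegral_add_left n₁₃, lintegral_add_left n₁₂,
            lintegral_add_left n₁, e₂, e₄]
          rfl
  have b₁ : ∫⁻ ξ, T₁ ξ ^ 2 ≤ I * (∫⁻ ξ, f ξ ^ 2) * ∫⁻ ξ, g ξ ^ 2 := by
    refine (lintegral_lconv_sq_le hfm hG).trans ?_
    rw [mul_comm I, mul_assoc, hgg]
    gcongr
    exact w.lintegral_sq_le hG.aemeasurable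
  have b₂ : ∫⁻ ξ, T₂ ξ ^ 2 ≤ I * (∫⁻ ξ, f ξ ^ 2) * ∫⁻ ξ, g ξ ^ 2 := by
    refine (lintegral_lconv_sq_le hgm hF).trans ?_
    rw [mul_comm, hff]
    gcongr
    exact w.lintegral_sq_le hF.aemeasurable
  have b₃ : ∫⁻ ξ, T₃ ξ ^ 2 ≤ M * (∫⁻ ξ, f ξ ^ 2) * ∫⁻ ξ, g ξ ^ 2 :=
    lintegral_kernel_sq_le hfm hgm hκm hκM
  have b₄ : ∫⁻ ξ, T₄ ξ ^ 2 ≤ M * (∫⁻ ξ, f ξ ^ 2) * ∫⁻ ξ, g ξ ^ 2 := by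
    refine (lintegral_kernel_sq_le hgm hfm hκm hκM).trans_eq ?_
    ring
  have m₁ : Measurable T₁ := measurable_lconv hfm hG
  have m₂ : Measurable T₂ := measurable_lconv hgm hF
  have m₃ : Measurable T₃ := hm₃.lintegral_prod_right'
  have m₄ : Measurable T₄ := hm₄.lintegral_prod_right'
  have hsq : ∀ a b : ℝ≥0∞, (a + b) ^ 2 ≤ 2 * (a ^ 2 + b ^ 2) := fun a b => by
    have := ENNReal.rpow_add_le_mul_rpow_add_rpow a b one_le_two
    norm_num at this
    exact this
  have hsq4 : ∀ a b c e : ℝ≥0∞, (a + b + c + e) ^ 2 ≤ 16 * (a ^ 2 + b ^ 2 + c ^ 2 + e ^ 2) :=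
    fun a b c e => by
      calc (a + b + c + e) ^ 2 ≤ 2 * (2 * (2 * (a ^ 2 + b ^ 2) + c ^ 2) + e ^ 2) := by
            refine (hsq _ _).trans ?_
            gcongr
            refine (hsq _ _).trans ?_
            gcongr
            exact hsq _ _
        _ = 8 * a ^ 2 + 8 * b ^ 2 + 4 * c ^ 2 + 2 * e ^ 2 := by ring
        _ ≤ 16 * a ^ 2 + 16 * b ^ 2 + 16 * c ^ 2 + 16 * e ^ 2 := by
            gcongr <;> norm_num
        _ = _ := by ring
  calc ∫⁻ ξ, ENNReal.ofReal (w.toFun ξ) * lconv F G ξ ^ 2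
      = ∫⁻ ξ, (Ω ξ * lconv F G ξ) ^ 2 := by simp only [mul_pow, Ω, hs_sq]
    _ ≤ ∫⁻ ξ, (ENNReal.ofReal C * 16) * (T₁ ξ ^ 2 + T₂ ξ ^ 2 + T₃ ξ ^ 2 + T₄ ξ ^ 2) := by
        refine lintegral_mono fun ξ => ?_
        refine (pow_le_pow_left' (hpt ξ) 2).trans ?_
        rw [mul_pow, hs_sq, mul_assoc]
        gcongr
        exact hsq4 _ _ _ _
    _ = (ENNReal.ofReal C * 16) * ((∫⁻ ξ, T₁ ξ ^ 2) + (∫⁻ ξ, T₂ ξ ^ 2) + (∫⁻ ξ, T₃ ξ ^ 2) +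
          ∫⁻ ξ, T₄ ξ ^ 2) := by
        rw [lintegral_const_mul _ (by fun_prop), lintegral_add_left (by fun_prop),
          lintegral_add_left (by fun_prop), lintegral_add_left (by fun_prop)]
    _ ≤ (ENNReal.ofReal C * 16) * (I * (∫⁻ ξ, f ξ ^ 2) * (∫⁻ ξ, g ξ ^ 2) +
          I * (∫⁻ ξ, f ξ ^ 2) * (∫⁻ ξ, g ξ ^ 2) + M * (∫⁻ ξ, f ξ ^ 2) * (∫⁻ ξ, g ξ ^ 2) +
          M * (∫⁻ ξ, f ξ ^ 2) * ∫⁻ ξ, g ξ ^ 2) := by gcongr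
    _ = _ := by rw [hff, hgg]; ring

/-! ### Model singular integrals -/

section ModelIntegrals

/-- Replacing both factors by the larger one gives its square. This trades part of an `ξ₁²` for
powers of `|ξ|^δ`, with a free exponent `t`. -/
theorem rpow_mul_rpow_le_sq_add_sq {X Y t : ℝ} (hX : 0 ≤ X) (hY : 0 ≤ Y) (ht₀ : 0 ≤ t)
    (ht₂ : t ≤ 2) : X ^ (2 - t) * Y ^ t ≤ X ^ 2 + Y ^ 2 := by
  have h2 : (0 : ℝ) ≤ 2 - t := by linarith
  have key : ∀ Z : ℝ, 0 ≤ Z → Z ^ (2 - t) * Z ^ t = Z ^ 2 := fun Z hZ => by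
    rw [← Real.rpow_add_of_nonneg hZ h2 ht₀, sub_add_cancel, Real.rpow_two]
  rcases le_total X Y with h | h
  · calc X ^ (2 - t) * Y ^ t ≤ Y ^ (2 - t) * Y ^ t := by gcongr
      _ = Y ^ 2 := key Y hY
      _ ≤ _ := le_add_of_nonneg_left (sq_nonneg X)
  · calc X ^ (2 - t) * Y ^ t ≤ X ^ (2 - t) * X ^ t := by gcongr
      _ = X ^ 2 := key X hX
      _ ≤ _ := le_add_of_nonneg_right (sq_nonneg Y)

/-- The truncated power `|y|^(η - 1)`. -/
noncomputable def truncPow (η y : ℝ) : ℝ := if |y| ≤ 2 then |y| ^ (η - 1) else 0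

theorem truncPow_nonneg (η y : ℝ) : 0 ≤ truncPow η y := by
  unfold truncPow
  split_ifs <;> positivity

theorem measurable_truncPow (η : ℝ) : Measurable (truncPow η) := by
  unfold truncPow
  exact Measurable.ite (measurableSet_le (by fun_prop) measurable_const) (by fun_prop)
    measurable_const

theorem integrable_truncPow {η : ℝ} (hη : 0 < η) : Integrable (truncPow η) := by
  have h : Integrable (fun y : ℝ => (fun s : ℝ => if s ≤ 2 then s ^ (η - 1) else 0) ‖y‖) := by
    rw [integrable_fun_norm_addHaar (volume : Measure ℝ)
      (f := fun s : ℝ => if s ≤ 2 then s ^ (η - 1) else 0)]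
    simp only [Module.finrank_self, tsub_self, pow_zero, one_smul]
    have h1 : IntegrableOn (fun s : ℝ => s ^ (η - 1)) (Set.Ioc 0 2) := by
      have := intervalIntegral.intervalIntegrable_rpow' (a := 0) (b := 2)
        (show -1 < η - 1 by linarith)
      rwa [intervalIntegrable_iff_integrableOn_Ioc_of_le (by norm_num)] at this
    have h2 := h1.integrable_indicator measurableSet_Ioc
    refine h2.integrableOn.congr_fun (fun s hs => ?_) measurableSet_Ioi
    simp only [Set.indicator_apply, Set.mem_Ioc]
    have hs' : 0 < s := hs
    simp [hs']
  exact h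

theorem lintegral_prod_truncPow {d : ℕ} {η : ℝ} (hη : 0 < η) (c : Fin d → ℝ) :
    ∫⁻ ξ : Space d, ENNReal.ofReal (∏ i, truncPow η (ξ i - c i)) =
      ENNReal.ofReal ((∫ y, truncPow η y) ^ d) := by
  have h1 : Integrable (fun x : Fin d → ℝ => ∏ i, truncPow η (x i - c i)) :=
    Integrable.fintype_prod (f := fun i y => truncPow η (y - c i))
      fun i => (integrable_truncPow hη).comp_sub_right (c i)
  have h2 := integral_fintype_prod_volume_eq_prod (𝕜 := ℝ) (ι := Fin d)
    (fun i (y : ℝ) => truncPow η (y - c i))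
  have hm : Measurable fun x : Fin d → ℝ => ENNReal.ofReal (∏ i, truncPow η (x i - c i)) := by
    have := measurable_truncPow η
    fun_prop
  have h3 := (PiLp.volume_preserving_ofLp (Fin d)).lintegral_comp hm
  refine h3.trans ?_
  rw [← ofReal_integral_eq_lintegral_ofReal h1
    (Eventually.of_forall fun x => Finset.prod_nonneg fun i _ => truncPow_nonneg _ _), h2]
  simp [integral_sub_right_eq_self]

theorem ae_coord_ne {d : ℕ} (i : Fin d) (c : ℝ) : ∀ᵐ ξ : Space d, ξ i ≠ c := by
  have h := (PiLp.volume_preserving_ofLp (Fin d)).quasiMeasurePreserving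
  exact h.ae (Measure.ae_eval_ne (fun _ : Fin d => (volume : Measure ℝ)) i c)

/-- As `η - 1 ≤ 0` and `|ξᵢ| ≤ ‖ξ‖`, the power of the norm is shared out equally among the `d - 1`
remaining coordinates. The cut-off at `2` in `truncPow` leaves room for the shift, as `|ξ₁ - c| ≤
2`. -/
theorem rpow_norm_mul_le_prod_truncPow {d : ℕ} [NeZero d] {η : ℝ} (hη : η ≤ 1) {ξ : Space d}
    (hξ : ‖ξ‖ ≤ 1) (hξ₀ : ∀ i, ξ i ≠ 0) {c : ℝ} (hc : |c| ≤ 1) :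
    |ξ 0 - c| ^ (η - 1) * ‖ξ‖ ^ (((d : ℝ) - 1) * (η - 1)) ≤
      ∏ i, truncPow η (ξ i - (Pi.single (0 : Fin d) c : Fin d → ℝ) i) := by
  have hn : ∀ i, |ξ i| ≤ ‖ξ‖ := fun i => by simpa using PiLp.norm_apply_le ξ i
  rw [← Finset.mul_prod_erase Finset.univ _ (Finset.mem_univ (0 : Fin d))]
  have h1 : |ξ 0 - (Pi.single (0 : Fin d) c : Fin d → ℝ) 0| ≤ 2 := by
    rw [Pi.single_eq_same]
    have := abs_sub (ξ 0) c
    linarith [hn 0]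
  have h2 : ∀ i ∈ Finset.univ.erase (0 : Fin d),
      ‖ξ‖ ^ (η - 1) ≤ truncPow η (ξ i - (Pi.single (0 : Fin d) c : Fin d → ℝ) i) := fun i hi => by
    rw [Pi.single_eq_of_ne (Finset.ne_of_mem_erase hi), sub_zero, truncPow,
      if_pos (by linarith [hn i])]
    exact Real.rpow_le_rpow_of_nonpos (abs_pos.2 (hξ₀ i)) (hn i) (by linarith)
  rw [truncPow, if_pos h1, Pi.single_eq_same]
  gcongr
  refine le_trans (le_of_eq ?_) (Finset.prod_le_prod (fun i _ => by positivity) h2)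
  rw [Finset.prod_const, Finset.card_erase_of_mem (Finset.mem_univ _), Finset.card_univ,
    Fintype.card_fin, mul_comm, Real.rpow_mul (norm_nonneg _), ← Real.rpow_natCast,
    Nat.cast_sub (Nat.one_le_iff_ne_zero.2 (NeZero.ne d)), Nat.cast_one]

/-- A product singularity, integrable uniformly in the position of one factor. -/
theorem exists_lintegral_product_singularity_le {d : ℕ} [NeZero d] {η : ℝ} (hη₀ : 0 < η)
    (hη₁ : η ≤ 1) : ∃ M : ℝ≥0, ∀ c : ℝ, |c| ≤ 1 → ∀ f : Space d → ℝ,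
      (∀ᵐ ξ : Space d, 0 < f ξ → ‖ξ‖ ≤ 1 ∧
        f ξ ≤ |ξ 0 - c| ^ (η - 1) * ‖ξ‖ ^ (((d : ℝ) - 1) * (η - 1))) →
      ∫⁻ ξ, ENNReal.ofReal (f ξ) ≤ M := by
  refine ⟨((∫ y, truncPow η y) ^ d).toNNReal, fun c hc f hf => ?_⟩
  refine le_of_le_of_eq (lintegral_mono_ae ?_)
    (lintegral_prod_truncPow hη₀ (Pi.single (0 : Fin d) c))
  filter_upwards [hf, ae_all_iff.2 fun i => ae_coord_ne (d := d) i 0] with ξ h1 h2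
  rcases le_or_gt (f ξ) 0 with h3 | h3
  · rw [ENNReal.ofReal_of_nonpos h3]
    exact zero_le
  · obtain ⟨h4, h5⟩ := h1 h3
    exact ENNReal.ofReal_le_ofReal (h5.trans (rpow_norm_mul_le_prod_truncPow hη₁ h4 h2 hc))

theorem lintegral_comp_div {f : ℝ → ℝ≥0∞} (hf : Measurable f) {c : ℝ} (hc : 0 < c) :
    ∫⁻ x, f (x / c) = ENNReal.ofReal c * ∫⁻ x, f x := by
  have h := Real.smul_map_volume_mul_right (inv_ne_zero hc.ne')
  conv_rhs => rw [← h]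
  rw [lintegral_smul_measure, lintegral_map hf (by fun_prop), smul_eq_mul, ← mul_assoc,
    ← ENNReal.ofReal_mul hc.le, abs_of_pos (inv_pos.2 hc), mul_inv_cancel₀ hc.ne',
    ENNReal.ofReal_one, one_mul]
  simp only [div_eq_mul_inv]

theorem lintegral_space_two {f : ℝ → ℝ → ℝ≥0∞} (hf : Measurable fun p : ℝ × ℝ => f p.1 p.2) :
    ∫⁻ ξ : Space 2, f (ξ 0) (ξ 1) = ∫⁻ x, ∫⁻ y, f x y := by
  have h1 := ((volume_preserving_finTwoArrow ℝ).comp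
    (PiLp.volume_preserving_ofLp (Fin 2))).lintegral_comp hf
  refine h1.trans ?_
  exact lintegral_prod _ hf.aemeasurable

/-- This is the Poisson kernel of the half plane up to normalization; its mass does not depend on
the height `a` or the centre `b`. -/
theorem lintegral_poisson_le (b : ℝ) {a : ℝ} (ha : 0 < a) :
    ∫⁻ x, ENNReal.ofReal (a / ((x - b) ^ 2 + a ^ 2)) ≤ ENNReal.ofReal Real.pi := by
  have hm : Measurable fun x : ℝ => ENNReal.ofReal (a⁻¹ * (1 + x ^ 2)⁻¹) := by fun_prop
  calc ∫⁻ x, ENNReal.ofReal (a / ((x - b) ^ 2 + a ^ 2))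
      = ∫⁻ x, ENNReal.ofReal (a / (x ^ 2 + a ^ 2)) :=
        lintegral_sub_right_eq_self (fun x => ENNReal.ofReal (a / (x ^ 2 + a ^ 2))) b
    _ = ∫⁻ x, ENNReal.ofReal (a⁻¹ * (1 + (x / a) ^ 2)⁻¹) := by
        congr 1; funext x; congr 1; field_simp; ring
    _ = ENNReal.ofReal a * ∫⁻ x, ENNReal.ofReal (a⁻¹ * (1 + x ^ 2)⁻¹) := lintegral_comp_div hm ha
    _ = ENNReal.ofReal a * ENNReal.ofReal (∫ x, a⁻¹ * (1 + x ^ 2)⁻¹) := by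
        rw [ofReal_integral_eq_lintegral_ofReal (integrable_inv_one_add_sq.const_mul _)
          (Eventually.of_forall fun x => by positivity)]
    _ ≤ _ := by
        rw [integral_const_mul, integral_univ_inv_one_add_sq, ← ENNReal.ofReal_mul ha.le,
          mul_inv_cancel_left₀ ha.ne']

/-- The borderline planar singularity, integrable uniformly in the parameters. -/
theorem exists_lintegral_planar_singularity_le {r : ℝ} (hr : 1 / 2 < r) :
    ∃ M : ℝ≥0, ∀ a b : ℝ, 0 < a → ∫⁻ ξ : Space 2, ENNReal.ofReal
      (|ξ 0| ^ (2 * r - 1) * ‖ξ‖ ^ (-(2 * r)) * (a / ((ξ 0 - b) ^ 2 + a ^ 2))) ≤ M := by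
  have hi : Integrable fun y : ℝ => (1 + ‖y‖ ^ 2) ^ (-(2 * r) / 2) :=
    integrable_rpow_neg_one_add_norm_sq (by simpa using by linarith)
  let J := ∫⁻ y : ℝ, ENNReal.ofReal ((1 + y ^ 2) ^ (-r))
  have hJ : J < ⊤ := by
    have := hi.lintegral_lt_top
    refine lt_of_eq_of_lt ?_ this
    refine lintegral_congr fun y => ?_
    rw [Real.norm_eq_abs, sq_abs]
    congr 2
    ring
  refine ⟨(ENNReal.ofReal Real.pi * J).toNNReal, fun a b ha => ?_⟩
  rw [ENNReal.coe_toNNReal (by finiteness)]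
  have hm : Measurable fun p : ℝ × ℝ => ENNReal.ofReal (|p.1| ^ (2 * r - 1) *
      (p.1 ^ 2 + p.2 ^ 2) ^ (-r) * (a / ((p.1 - b) ^ 2 + a ^ 2))) := by fun_prop
  have h1 := lintegral_space_two (f := fun x y => ENNReal.ofReal (|x| ^ (2 * r - 1) *
      (x ^ 2 + y ^ 2) ^ (-r) * (a / ((x - b) ^ 2 + a ^ 2)))) hm
  have h2 : ∀ ξ : Space 2, ‖ξ‖ ^ (-(2 * r)) = (ξ 0 ^ 2 + ξ 1 ^ 2) ^ (-r) := fun ξ => by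
    rw [EuclideanSpace.norm_eq, Real.sqrt_eq_rpow, ← Real.rpow_mul (by positivity)]
    simp only [Fin.sum_univ_two, Real.norm_eq_abs, sq_abs]
    congr 1
    ring
  simp only [h2]
  rw [h1]
  -- At fixed `x ≠ 0` the substitution `y ↦ |x| y` makes the integral of `|x|^{2r-1} (x² + y²)^{-r}`
  -- over `y` independent of `x`. It converges because `2r > 1`, and only the Poisson kernel in `x`
  -- remains.
  have h3 : ∀ᵐ x : ℝ, ∫⁻ y, ENNReal.ofReal (|x| ^ (2 * r - 1) *
      (x ^ 2 + y ^ 2) ^ (-r) * (a / ((x - b) ^ 2 + a ^ 2))) =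
      ENNReal.ofReal (a / ((x - b) ^ 2 + a ^ 2)) * J := by
    filter_upwards [Measure.ae_ne volume (0 : ℝ)] with x hx
    have hx' : 0 < |x| := abs_pos.2 hx
    have hm2 : Measurable fun y : ℝ => ENNReal.ofReal ((1 + y ^ 2) ^ (-r)) := by fun_prop
    have h4 : ∀ y, ENNReal.ofReal (|x| ^ (2 * r - 1) * (x ^ 2 + y ^ 2) ^ (-r) *
        (a / ((x - b) ^ 2 + a ^ 2))) = (ENNReal.ofReal (a / ((x - b) ^ 2 + a ^ 2)) *
          ENNReal.ofReal |x|⁻¹) * ENNReal.ofReal ((1 + (y / |x|) ^ 2) ^ (-r)) := fun y => by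
      rw [← ENNReal.ofReal_mul (by positivity), ← ENNReal.ofReal_mul (by positivity)]
      congr 1
      have h5 : x ^ 2 + y ^ 2 = |x| ^ 2 * (1 + (y / |x|) ^ 2) := by
        rw [← sq_abs x]; field_simp
      have h6 : |x| ^ (2 * r - 1) * (|x| ^ 2) ^ (-r) = |x|⁻¹ := by
        rw [← Real.rpow_two, ← Real.rpow_mul hx'.le, ← Real.rpow_add hx', ← Real.rpow_neg_one]
        congr 1
        ring
      rw [h5, Real.mul_rpow (by positivity) (by positivity), ← mul_assoc, h6]
      ring
    simp only [h4]
    rw [lintegral_const_mul _ (by fun_prop), lintegral_comp_div hm2 hx', mul_assoc, ← mul_assoc (ENNReal.ofReal |x|⁻¹),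
      ← ENNReal.ofReal_mul (by positivity), inv_mul_cancel₀ hx'.ne', ENNReal.ofReal_one, one_mul]
  rw [lintegral_congr_ae h3, lintegral_mul_const _ (by fun_prop)]
  gcongr
  exact lintegral_poisson_le b ha

end ModelIntegrals

/-! ### The anisotropic weight: integrability of negative powers and the algebra property -/

theorem abs_coord_le_norm {d : ℕ} (ξ : Space d) (i : Fin d) : |ξ i| ≤ ‖ξ‖ := by
  simpa using PiLp.norm_apply_le ξ i

section AnisotropicWeight

variable {d : ℕ} [NeZero d]

theorem anisotropicWeight_of_lt {s r δ : ℝ} {ξ : Space d} (h : ‖ξ‖ < 1) :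
    (anisotropicWeight d s r δ).toFun ξ = ((ξ 0) ^ 2 + ‖ξ‖ ^ (2 * δ)) / ‖ξ‖ ^ (2 * r) :=
  if_pos h

theorem anisotropicWeight_of_le {s r δ : ℝ} {ξ : Space d} (h : 1 ≤ ‖ξ‖) :
    (anisotropicWeight d s r δ).toFun ξ = (1 + ‖ξ‖ ^ 2) ^ s :=
  if_neg h.not_gt

theorem anisotropicWeight_nonneg (s r δ : ℝ) (ξ : Space d) :
    0 ≤ (anisotropicWeight d s r δ).toFun ξ := by
  rcases lt_or_ge ‖ξ‖ 1 with h | h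
  · rw [anisotropicWeight_of_lt h]; positivity
  · rw [anisotropicWeight_of_le h]; positivity

theorem rpow_two_mul {x : ℝ} (hx : 0 ≤ x) (t : ℝ) : x ^ (2 * t) = (x ^ t) ^ 2 := by
  rw [mul_comm, Real.rpow_mul hx, Real.rpow_two]

/-- Negative powers of the anisotropic weight, up to an exponent below `-1`, are integrable. -/
theorem lintegral_anisotropicWeight_rpow_lt_top {s r δ : ℝ} (hδ : 1 < δ)
    (hdim : 1 + δ - 2 * r < (d : ℝ)) (hr₀ : 0 ≤ r) (hs : (d : ℝ) / 2 < s)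
    {τ : ℝ} (hτ₀ : 0 ≤ τ) (hτ : 4 * δ * τ ≤ 2 * r + d - 1 - δ) :
    ∫⁻ ξ, ENNReal.ofReal ((anisotropicWeight d s r δ).toFun ξ ^ (-(1 + τ))) < ⊤ := by
  set κ := 2 * r + d - 1 - δ with hκ
  have hκ0 : 0 < κ := by linarith
  have hd1 : (1 : ℝ) ≤ d := by exact_mod_cast NeZero.one_le
  have hdδ : 0 < δ + d := by linarith
  -- The margin `κ > 0` in the dimension condition is split in half: one half pays for `η`, the
  -- other for `τ`.
  obtain ⟨η, hη0, hη1, hη⟩ : ∃ η : ℝ, 0 < η ∧ η ≤ 1 ∧ 2 * (δ + d) * η ≤ κ := by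
    refine ⟨min 1 (κ / (2 * (δ + d))), by positivity, min_le_left _ _, ?_⟩
    rw [← le_div_iff₀' (by positivity)]
    exact min_le_right _ _
  obtain ⟨M, hM⟩ := exists_lintegral_product_singularity_le (d := d) hη0 hη1
  -- This `t` is chosen so that the factor `|ξ₁|^{2-t}`, raised to `-(1 + τ)`, becomes exactly
  -- `|ξ₁|^{η-1}`, which is barely integrable.
  set t := 2 - (1 - η) / (1 + τ) with ht
  have hq0 : 0 ≤ (1 - η) / (1 + τ) := div_nonneg (by linarith) (by linarith)
  have hq1 : (1 - η) / (1 + τ) ≤ 1 := by rw [div_le_one (by linarith)]; linarith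
  have hqm : (2 - t) * (1 + τ) = 1 - η := by
    rw [ht, sub_sub_cancel, div_mul_cancel₀ _ (by linarith : (1 + τ) ≠ 0)]
  let f : Space d → ℝ := fun ξ =>
    if ‖ξ‖ < 1 then (anisotropicWeight d s r δ).toFun ξ ^ (-(1 + τ)) else 0
  have h1 := hM 0 (by simp) f (by
    filter_upwards [ae_coord_ne (d := d) 0 0] with ξ hξ hf
    by_cases hξ1 : ‖ξ‖ < 1
    swap
    · simp [f, hξ1] at hf
    refine ⟨hξ1.le, ?_⟩
    have hx : 0 < |ξ 0| := abs_pos.2 hξ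
    have hρ : 0 < ‖ξ‖ := hx.trans_le (abs_coord_le_norm ξ 0)
    simp only [f, if_pos hξ1, anisotropicWeight_of_lt hξ1, sub_zero]
    have h2 := rpow_mul_rpow_le_sq_add_sq hx.le (Real.rpow_nonneg hρ.le δ)
      (t := t) (by linarith) (by linarith)
    rw [sq_abs, ← rpow_two_mul hρ.le] at h2
    have h3 : |ξ 0| ^ (2 - t) * (‖ξ‖ ^ δ) ^ t / ‖ξ‖ ^ (2 * r) =
        |ξ 0| ^ (2 - t) * ‖ξ‖ ^ (δ * t - 2 * r) := by
      rw [← Real.rpow_mul hρ.le, Real.rpow_sub hρ, mul_div_assoc]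
    calc _ ≤ (|ξ 0| ^ (2 - t) * ‖ξ‖ ^ (δ * t - 2 * r)) ^ (-(1 + τ)) := by
          refine Real.rpow_le_rpow_of_nonpos (by positivity) ?_ (by linarith)
          rw [← h3]
          gcongr
      _ = |ξ 0| ^ (η - 1) * ‖ξ‖ ^ ((δ * t - 2 * r) * (-(1 + τ))) := by
          rw [Real.mul_rpow (by positivity) (by positivity), ← Real.rpow_mul hx.le,
            ← Real.rpow_mul hρ.le]
          congr 2
          linarith
      _ ≤ _ := by
          gcongr ?_ * ?_
          refine Real.rpow_le_rpow_of_exponent_ge hρ hξ1.le ?_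
          have h4 : (δ * t - 2 * r) * (-(1 + τ)) =
              2 * r * (1 + τ) - δ * (2 * (1 + τ) - (2 - t) * (1 + τ)) := by ring
          rw [h4, hqm]
          nlinarith [mul_nonneg hr₀ hτ₀])
  have h2 : ∫⁻ ξ : Space d, ENNReal.ofReal ((1 + ‖ξ‖ ^ 2) ^ (-(2 * s) / 2)) < ⊤ :=
    (integrable_rpow_neg_one_add_norm_sq (by simpa using by linarith)).lintegral_lt_top
  have h3 : ∀ ξ : Space d, ENNReal.ofReal ((anisotropicWeight d s r δ).toFun ξ ^ (-(1 + τ))) ≤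
      ENNReal.ofReal (f ξ) + ENNReal.ofReal ((1 + ‖ξ‖ ^ 2) ^ (-(2 * s) / 2)) := fun ξ => by
    rcases lt_or_ge ‖ξ‖ 1 with h | h
    · simp only [f, if_pos h]
      exact le_self_add
    · refine le_add_left (ENNReal.ofReal_le_ofReal ?_)
      have hb : 1 ≤ 1 + ‖ξ‖ ^ 2 := by nlinarith
      rw [anisotropicWeight_of_le h, ← Real.rpow_mul (by positivity)]
      refine Real.rpow_le_rpow_of_exponent_le hb ?_
      have : 0 ≤ s := by linarith
      nlinarith [mul_nonneg this hτ₀]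
  refine (lintegral_mono h3).trans_lt ?_
  rw [lintegral_add_right _ (by fun_prop)]
  exact ENNReal.add_lt_top.2 ⟨h1.trans_lt ENNReal.coe_lt_top, h2⟩

/-- The kernel that controls interactions of two high frequencies into a low one. -/
noncomputable def interactionKernel (r δ θ : ℝ) (ξ b : Space d) : ℝ :=
  if ‖b‖ < 1 ∧ ‖ξ‖ ≤ ‖b‖ then
    ‖ξ‖ ^ (-(2 * r)) * |ξ 0| ^ θ * ‖b‖ ^ (4 * r - θ * δ) / ((ξ 0 - b 0) ^ 2 + ‖b‖ ^ (2 * δ))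
  else 0

theorem interactionKernel_nonneg (r δ θ : ℝ) (ξ b : Space d) :
    0 ≤ interactionKernel r δ θ ξ b := by
  unfold interactionKernel
  split_ifs <;> positivity

theorem measurable_interactionKernel (r δ θ : ℝ) :
    Measurable fun p : Space d × Space d => interactionKernel r δ θ p.1 p.2 := by
  unfold interactionKernel
  refine Measurable.ite ?_ (by fun_prop) measurable_const
  exact (measurableSet_lt measurable_snd.norm measurable_const).inter
    (measurableSet_le measurable_fst.norm measurable_snd.norm)

/-- For small `θ` the factor `|ξ|^{-2r}` is weak enough to be traded against powers of `|b| ≥ |ξ|`,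
because `2r ≤ d - 1`. The denominator is interpolated down to `|ξ₁ - b₁|^{1-η}`, which leaves the
product singularity and a nonnegative power of `|b| < 1`. -/
theorem exists_lintegral_interactionKernel_le_of_le {r δ : ℝ} (hδ : 1 < δ)
    (hdim : 1 + δ - 2 * r < (d : ℝ)) (hr : 2 * r ≤ d - 1) :
    ∃ θ : ℝ, 0 ≤ θ ∧ θ ≤ 2 ∧ ∃ M : ℝ≥0, ∀ b : Space d,
      ∫⁻ ξ, ENNReal.ofReal (interactionKernel r δ θ ξ b) ≤ M := by
  set κ := 2 * r + d - 1 - δ with hκ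
  have hκ0 : 0 < κ := by linarith
  have hd1 : (1 : ℝ) ≤ d := by exact_mod_cast NeZero.one_le
  obtain ⟨ε, hε0, hε1, hε⟩ : ∃ ε : ℝ, 0 < ε ∧ ε ≤ 1 ∧ δ * ε ≤ κ := by
    refine ⟨min 1 (κ / δ), by positivity, min_le_left _ _, ?_⟩
    rw [← le_div_iff₀' (by positivity)]
    exact min_le_right _ _
  obtain ⟨η, hη0, hη⟩ : ∃ η : ℝ, 0 < η ∧ (d + δ) * η = ε :=
    ⟨ε / (d + δ), by positivity, mul_div_cancel₀ _ (by positivity)⟩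
  have hη1 : η ≤ 1 := by nlinarith
  obtain ⟨M, hM⟩ := exists_lintegral_product_singularity_le (d := d) hη0 hη1
  refine ⟨ε, hε0.le, by linarith, M, fun b => ?_⟩
  by_cases hb1 : ‖b‖ < 1
  swap
  · simp [interactionKernel, hb1]
  refine hM (b 0) ((abs_coord_le_norm b 0).trans hb1.le) _ ?_
  filter_upwards [ae_coord_ne (d := d) 0 0, ae_coord_ne (d := d) 0 (b 0)] with ξ hξ0 hξb hf
  by_cases hξ : ‖ξ‖ ≤ ‖b‖
  swap
  · simp [interactionKernel, hξ] at hf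
  refine ⟨hξ.trans hb1.le, ?_⟩
  have hρ : 0 < ‖ξ‖ := (abs_pos.2 hξ0).trans_le (abs_coord_le_norm ξ 0)
  have hl : 0 < ‖b‖ := hρ.trans_le hξ
  have hD : 0 < |ξ 0 - b 0| := abs_pos.2 (sub_ne_zero.2 hξb)
  rw [interactionKernel, if_pos ⟨hb1, hξ⟩]
  have h2 := rpow_mul_rpow_le_sq_add_sq hD.le (Real.rpow_nonneg hl.le δ)
    (t := 1 + η) (by linarith) (by linarith)
  rw [sq_abs, ← rpow_two_mul hl.le, ← Real.rpow_mul hl.le] at h2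
  have h3 : |ξ 0| ^ ε ≤ ‖ξ‖ ^ ε :=
    Real.rpow_le_rpow (abs_nonneg _) (abs_coord_le_norm ξ 0) hε0.le
  have h4 : ‖ξ‖ ^ (-(2 * r)) * ‖ξ‖ ^ ε ≤
      ‖ξ‖ ^ (((d : ℝ) - 1) * (η - 1)) * ‖b‖ ^ (ε - 2 * r - ((d : ℝ) - 1) * (η - 1)) := by
    rw [← Real.rpow_add hρ]
    calc ‖ξ‖ ^ (-(2 * r) + ε) = ‖ξ‖ ^ (((d : ℝ) - 1) * (η - 1)) *
          ‖ξ‖ ^ (ε - 2 * r - ((d : ℝ) - 1) * (η - 1)) := by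
          rw [← Real.rpow_add hρ]; congr 1; ring
      _ ≤ _ := by
          gcongr
          nlinarith
  calc _ ≤ ‖ξ‖ ^ (-(2 * r)) * ‖ξ‖ ^ ε * ‖b‖ ^ (4 * r - ε * δ) /
        (|ξ 0 - b 0| ^ (2 - (1 + η)) * ‖b‖ ^ (δ * (1 + η))) := by gcongr
    _ ≤ ‖ξ‖ ^ (((d : ℝ) - 1) * (η - 1)) * ‖b‖ ^ (ε - 2 * r - ((d : ℝ) - 1) * (η - 1)) *
        ‖b‖ ^ (4 * r - ε * δ) / (|ξ 0 - b 0| ^ (2 - (1 + η)) * ‖b‖ ^ (δ * (1 + η))) := by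
        gcongr
    _ = |ξ 0 - b 0| ^ (η - 1) * ‖ξ‖ ^ (((d : ℝ) - 1) * (η - 1)) *
        ‖b‖ ^ (ε - 2 * r - ((d : ℝ) - 1) * (η - 1) + (4 * r - ε * δ) - δ * (1 + η)) := by
        generalize ε - 2 * r - ((d : ℝ) - 1) * (η - 1) = e
        generalize 4 * r - ε * δ = e'
        rw [Real.rpow_sub hl, Real.rpow_add hl, show |ξ 0 - b 0| ^ (η - 1) =
          (|ξ 0 - b 0| ^ (2 - (1 + η)))⁻¹ by rw [← Real.rpow_neg hD.le]; congr 1; ring]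
        field_simp
    _ ≤ _ := by
        refine mul_le_of_le_one_right (by positivity)
          (Real.rpow_le_one hl.le hb1.le ?_)
        nlinarith

/-- The choice `θ = 2r - 1` makes the numerator scale invariant in the second coordinate. What
remains is a Poisson kernel of height `|b|^δ`, provided `4r - (2r - 1)δ ≥ δ`, that is, `δ ≤ 2`. -/
theorem exists_lintegral_interactionKernel_le_of_two {r δ : ℝ} (hδ₂ : δ ≤ 2)
    (hr : 1 < 2 * r) (hr₁ : r ≤ 1) (hd : d = 2) :
    ∃ θ : ℝ, 0 ≤ θ ∧ θ ≤ 2 ∧ ∃ M : ℝ≥0, ∀ b : Space d,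
      ∫⁻ ξ, ENNReal.ofReal (interactionKernel r δ θ ξ b) ≤ M := by
  subst hd
  obtain ⟨M, hM⟩ := exists_lintegral_planar_singularity_le (r := r) (by linarith)
  refine ⟨2 * r - 1, by linarith, by linarith, M, fun b => ?_⟩
  rcases (norm_nonneg b).eq_or_lt with hb | hb
  · refine le_of_eq_of_le (lintegral_eq_zero_of_ae_eq_zero ?_) zero_le
    filter_upwards [Measure.ae_ne volume (0 : Space 2)] with ξ hξ
    rw [interactionKernel, if_neg]
    · simp
    · rw [← hb]
      intro h
      exact hξ (norm_le_zero_iff.1 h.2)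
  refine (lintegral_mono fun ξ => ENNReal.ofReal_le_ofReal ?_).trans
    (hM (‖b‖ ^ δ) (b 0) (by positivity))
  unfold interactionKernel
  split_ifs with h
  swap
  · positivity
  have h1 : ‖b‖ ^ (4 * r - (2 * r - 1) * δ) ≤ ‖b‖ ^ δ :=
    Real.rpow_le_rpow_of_exponent_ge hb h.1.le (by nlinarith)
  rw [rpow_two_mul hb.le, mul_div_assoc, mul_comm (‖ξ‖ ^ (-(2 * r)))]
  gcongr

theorem exists_lintegral_interactionKernel_le {r δ : ℝ} (hd : 2 ≤ d) (hδ : 1 < δ)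
    (hdim : 1 + δ - 2 * r < (d : ℝ)) (hr₁ : r ≤ 1) (hδ₂ : d = 2 → δ ≤ 2) :
    ∃ θ : ℝ, 0 ≤ θ ∧ θ ≤ 2 ∧ ∃ M : ℝ≥0, ∀ b : Space d,
      ∫⁻ ξ, ENNReal.ofReal (interactionKernel r δ θ ξ b) ≤ M := by
  rcases le_or_gt (2 * r) (d - 1) with h | h
  · exact exists_lintegral_interactionKernel_le_of_le hδ hdim h
  -- Since `r ≤ 1`, the inequality `2r > d - 1` is possible only in the plane.
  · have hd2 : d = 2 := by
      refine le_antisymm ?_ hd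
      have : (d : ℝ) < 3 := by linarith
      exact Nat.lt_succ_iff.1 (by exact_mod_cast this)
    refine exists_lintegral_interactionKernel_le_of_two (hδ₂ hd2) ?_ hr₁ hd2
    rw [hd2] at h
    push_cast at h
    linarith

/-- Here `a₁ = ξ₁ - b₁` and `|a|`, `|b|` are comparable, so the denominator of the kernel cancels
the numerator of `w a`. There remains `ξ₁² |b|^{θδ} ≲ |ξ₁|^θ (b₁² + |b|^{2δ})`, which is
interpolation together with `|ξ₁| ≤ 2|b₁|`. -/
theorem sq_mul_rpow_le_interactionKernel {s r δ θ : ℝ} (hδ : 0 ≤ δ) (hr₀ : 0 ≤ r) (hr₁ : r ≤ 1)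
    (hθ₀ : 0 ≤ θ) (hθ₂ : θ ≤ 2) {ξ a b : Space d} (hab : ξ = a + b) (ha : ‖a‖ < 1) (hb : ‖b‖ < 1)
    (hξb : ‖ξ‖ ≤ ‖b‖) (hξ : |ξ 0| ≤ 2 * |b 0|) (h₁ : ‖b‖ ≤ 2 * ‖a‖) (h₂ : ‖a‖ ≤ 2 * ‖b‖)
    (hb₀ : 0 < ‖b‖) :
    (ξ 0) ^ 2 * ‖ξ‖ ^ (-(2 * r)) ≤ 16 * 4 ^ δ * (interactionKernel r δ θ ξ b *
      ((anisotropicWeight d s r δ).toFun b * (anisotropicWeight d s r δ).toFun a)) := by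
  rw [anisotropicWeight_of_lt ha, anisotropicWeight_of_lt hb, interactionKernel,
    if_pos ⟨hb, hξb⟩]
  have hD : ξ 0 - b 0 = a 0 := by rw [hab]; simp
  have ha₀ : 0 < ‖a‖ := by linarith
  rw [hD]
  have e0 : ‖b‖ ^ (4 * r - θ * δ) = (‖b‖ ^ (2 * r)) ^ 2 / ‖b‖ ^ (θ * δ) := by
    rw [Real.rpow_sub hb₀, ← rpow_two_mul hb₀.le]; ring_nf
  have e1 : (ξ 0) ^ 2 * ‖b‖ ^ (θ * δ) ≤ |ξ 0| ^ θ * (4 * (b 0 ^ 2 + ‖b‖ ^ (2 * δ))) := by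
    have h := rpow_mul_rpow_le_sq_add_sq (abs_nonneg (ξ 0)) (Real.rpow_nonneg hb₀.le δ) hθ₀ hθ₂
    rw [sq_abs, ← rpow_two_mul hb₀.le, ← Real.rpow_mul hb₀.le, mul_comm δ θ] at h
    have h3 : |ξ 0| ^ θ * |ξ 0| ^ (2 - θ) = ξ 0 ^ 2 := by
      rw [← Real.rpow_add_of_nonneg (abs_nonneg _) hθ₀ (by linarith), add_sub_cancel,
        Real.rpow_two, sq_abs]
    have h4 : ξ 0 ^ 2 ≤ 4 * b 0 ^ 2 := by
      rw [← sq_abs (ξ 0), ← sq_abs (b 0)]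
      nlinarith [abs_nonneg (ξ 0), abs_nonneg (b 0)]
    have h5 : 0 ≤ ‖b‖ ^ (2 * δ) := by positivity
    calc (ξ 0) ^ 2 * ‖b‖ ^ (θ * δ) = |ξ 0| ^ θ * (|ξ 0| ^ (2 - θ) * ‖b‖ ^ (θ * δ)) := by
          rw [← h3]; ring
      _ ≤ |ξ 0| ^ θ * (ξ 0 ^ 2 + ‖b‖ ^ (2 * δ)) := by gcongr
      _ ≤ _ := by gcongr; linarith
  have h41 : (1 : ℝ) ≤ 4 ^ δ := Real.one_le_rpow (by norm_num) hδ
  have e2 : (a 0 ^ 2 + ‖b‖ ^ (2 * δ)) / ‖b‖ ^ (2 * r) ≤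
      4 * 4 ^ δ * ((a 0 ^ 2 + ‖a‖ ^ (2 * δ)) / ‖a‖ ^ (2 * r)) := by
    have h3 : ‖b‖ ^ (2 * δ) ≤ 4 ^ δ * ‖a‖ ^ (2 * δ) := by
      calc ‖b‖ ^ (2 * δ) ≤ (2 * ‖a‖) ^ (2 * δ) := by gcongr
        _ = _ := by
          rw [Real.mul_rpow (by norm_num) ha₀.le, Real.rpow_mul (by norm_num)]; norm_num
    have h4 : ‖a‖ ^ (2 * r) ≤ 4 * ‖b‖ ^ (2 * r) := by
      calc ‖a‖ ^ (2 * r) ≤ (2 * ‖b‖) ^ (2 * r) := by gcongr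
        _ = 4 ^ r * ‖b‖ ^ (2 * r) := by
          rw [Real.mul_rpow (by norm_num) hb₀.le, Real.rpow_mul (by norm_num)]; norm_num
        _ ≤ _ := by
          gcongr
          calc (4 : ℝ) ^ r ≤ 4 ^ (1 : ℝ) := Real.rpow_le_rpow_of_exponent_le (by norm_num) hr₁
            _ = 4 := Real.rpow_one 4
    have hA : 0 < ‖a‖ ^ (2 * r) := by positivity
    have hB : 0 < ‖b‖ ^ (2 * r) := by positivity
    rw [mul_div_assoc', div_le_div_iff₀ hB hA]
    calc (a 0 ^ 2 + ‖b‖ ^ (2 * δ)) * ‖a‖ ^ (2 * r)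
        ≤ (4 ^ δ * (a 0 ^ 2 + ‖a‖ ^ (2 * δ))) * (4 * ‖b‖ ^ (2 * r)) := by
          gcongr
          rw [mul_add]
          gcongr
          exact le_mul_of_one_le_left (sq_nonneg _) h41
      _ = _ := by ring
  set Λ := ‖b‖ ^ (2 * r) with hΛ
  set V := ‖b‖ ^ (θ * δ) with hV
  set L := ‖b‖ ^ (2 * δ) with hL
  have hΛ0 : 0 < Λ := by positivity
  have hV0 : 0 < V := by positivity
  have hL0 : 0 < L := by positivity
  set P := ‖ξ‖ ^ (-(2 * r)) with hP
  set W := (a 0 ^ 2 + ‖a‖ ^ (2 * δ)) / ‖a‖ ^ (2 * r) with hW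
  have hP0 : 0 ≤ P := by positivity
  have hU0 : 0 ≤ |ξ 0| ^ θ := by positivity
  rw [e0]
  calc ξ 0 ^ 2 * P ≤ |ξ 0| ^ θ * (4 * (b 0 ^ 2 + L)) / V * P := by
        gcongr
        rwa [le_div_iff₀ hV0]
    _ = 4 * (P * |ξ 0| ^ θ * (Λ ^ 2 / V) / (a 0 ^ 2 + L) *
          ((b 0 ^ 2 + L) / Λ * ((a 0 ^ 2 + L) / Λ))) := by
        field_simp
    _ ≤ 4 * (P * |ξ 0| ^ θ * (Λ ^ 2 / V) / (a 0 ^ 2 + L) *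
          ((b 0 ^ 2 + L) / Λ * (4 * 4 ^ δ * W))) := by gcongr
    _ = _ := by ring

theorem rpow_two_mul_le_mul {x y t : ℝ} (hx : 0 ≤ x) (hy : 0 ≤ y) (ht : 0 ≤ t) (h : x ≤ 2 * y) :
    x ^ (2 * t) ≤ 4 ^ t * y ^ (2 * t) := by
  calc x ^ (2 * t) ≤ (2 * y) ^ (2 * t) := by gcongr
    _ = _ := by
      rw [Real.mul_rpow (by norm_num) hy, Real.rpow_mul (by norm_num)]; norm_num

/-- The larger input carries at least half of the output frequency. If it is below `1` it is still
at least `1/2`, where the low-frequency weight is bounded below. -/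
theorem anisotropicWeight_add_le_of_one_le {s r δ : ℝ} (hs : 0 ≤ s) (hδ : 1 ≤ δ) (hr₀ : 0 ≤ r)
    {ξ a b : Space d} (hab : ξ = a + b)
    (hle : ‖a‖ ≤ ‖b‖) (hξ : 1 ≤ ‖ξ‖) :
    (anisotropicWeight d s r δ).toFun ξ ≤ 5 ^ s * 4 ^ δ * (anisotropicWeight d s r δ).toFun b := by
  set w := (anisotropicWeight d s r δ).toFun with hw
  have hwb : 0 ≤ w b := anisotropicWeight_nonneg s r δ b
  have h5 : (1 : ℝ) ≤ 5 ^ s := Real.one_le_rpow (by norm_num) hs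
  have h4 : (1 : ℝ) ≤ 4 ^ δ := Real.one_le_rpow (by norm_num) (by linarith)
  set p : ℝ := 5 ^ s
  set q : ℝ := 4 ^ δ
  have hξb : ‖ξ‖ ≤ 2 * ‖b‖ := by
    rw [hab]; linarith [norm_add_le a b]
  have e1 : w ξ = (1 + ‖ξ‖ ^ 2) ^ s := anisotropicWeight_of_le hξ
  rcases le_or_gt 1 ‖b‖ with hb | hb
  · have e2 : w b = (1 + ‖b‖ ^ 2) ^ s := anisotropicWeight_of_le hb
    calc w ξ ≤ (5 * (1 + ‖b‖ ^ 2)) ^ s := by rw [e1]; gcongr; nlinarith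
      _ = p * w b := by rw [Real.mul_rpow (by norm_num) (by positivity), e2]
      _ ≤ p * q * w b := by gcongr; exact le_mul_of_one_le_right (by linarith) h4
  · have e2 : w b = (b 0 ^ 2 + ‖b‖ ^ (2 * δ)) / ‖b‖ ^ (2 * r) := anisotropicWeight_of_lt hb
    have hb0 : 0 < ‖b‖ := by linarith
    have e3 : 1 ≤ q * ‖b‖ ^ (2 * δ) := by
      have := rpow_two_mul_le_mul zero_le_one hb0.le (t := δ) (by linarith) (by linarith)
      rwa [Real.one_rpow] at this
    have e4 : ‖b‖ ^ (2 * δ) ≤ w b := by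
      rw [e2, le_div_iff₀ (by positivity)]
      calc ‖b‖ ^ (2 * δ) * ‖b‖ ^ (2 * r) ≤ ‖b‖ ^ (2 * δ) * 1 := by
            gcongr; exact Real.rpow_le_one hb0.le hb.le (by linarith)
        _ ≤ _ := by nlinarith [sq_nonneg (b 0)]
    calc w ξ ≤ p := by rw [e1]; exact Real.rpow_le_rpow (by positivity) (by nlinarith) hs
      _ ≤ p * (q * ‖b‖ ^ (2 * δ)) := le_mul_of_one_le_right (by linarith) e3
      _ ≤ p * (q * w b) := by gcongr
      _ = _ := by ring

/-- Inside the unit ball the weight is at most `2`, since `r ≤ 1 ≤ δ`; outside it is at least `1`.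
-/
theorem anisotropicWeight_le_of_lt_one_le {s r δ : ℝ} (hs : 0 ≤ s) (hδ : 1 ≤ δ) (hr₁ : r ≤ 1)
    {ξ b : Space d} (hξ0 : 0 < ‖ξ‖) (hξ : ‖ξ‖ < 1) (hb : 1 ≤ ‖b‖) :
    (anisotropicWeight d s r δ).toFun ξ ≤ 2 * (anisotropicWeight d s r δ).toFun b := by
  set w := (anisotropicWeight d s r δ).toFun with hw
  have e1 : w ξ = (ξ 0 ^ 2 + ‖ξ‖ ^ (2 * δ)) / ‖ξ‖ ^ (2 * r) := anisotropicWeight_of_lt hξ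
  have hξc := abs_coord_le_norm ξ 0
  have e2 : w b = (1 + ‖b‖ ^ 2) ^ s := anisotropicWeight_of_le hb
  have e3 : 1 ≤ w b := by rw [e2]; exact Real.one_le_rpow (by nlinarith) hs
  have e4 : w ξ ≤ 2 := by
    rw [e1, div_le_iff₀ (by positivity)]
    have h1 : ‖ξ‖ ^ (2 * δ) ≤ ‖ξ‖ ^ (2 * r) :=
      Real.rpow_le_rpow_of_exponent_ge hξ0 hξ.le (by linarith)
    have h2 : ‖ξ‖ ^ (2 : ℝ) ≤ ‖ξ‖ ^ (2 * r) :=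
      Real.rpow_le_rpow_of_exponent_ge hξ0 hξ.le (by linarith)
    have h3 : ξ 0 ^ 2 ≤ ‖ξ‖ ^ (2 : ℝ) := by
      rw [Real.rpow_two, ← sq_abs]; gcongr
    linarith
  linarith

/-- The part `|ξ|^{2(δ-r)}` of the weight is increasing in `|ξ|` and harmless. For `ξ₁² |ξ|^{-2r}`,
either `|b| < 2|ξ|` and the singular factor is comparable at `b`, or the inputs nearly cancel and
the kernel is needed. -/
theorem anisotropicWeight_add_le_of_lt {s r δ θ : ℝ} (hδ : 1 ≤ δ) (hr₀ : 0 ≤ r)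
    (hr₁ : r ≤ 1) (hθ₀ : 0 ≤ θ) (hθ₂ : θ ≤ 2) {ξ a b : Space d} (hab : ξ = a + b)
    (hle : ‖a‖ ≤ ‖b‖) (hξ0 : 0 < ‖ξ‖) (hξ : ‖ξ‖ < 1) (hb : ‖b‖ < 1) :
    (anisotropicWeight d s r δ).toFun ξ ≤ 17 * 4 ^ δ *
      ((anisotropicWeight d s r δ).toFun b + (anisotropicWeight d s r δ).toFun a +
      (interactionKernel r δ θ ξ b + interactionKernel r δ θ ξ a) *
      ((anisotropicWeight d s r δ).toFun b * (anisotropicWeight d s r δ).toFun a)) := by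
  set w := (anisotropicWeight d s r δ).toFun with hw
  have hwa : 0 ≤ w a := anisotropicWeight_nonneg s r δ a
  have hwb : 0 ≤ w b := anisotropicWeight_nonneg s r δ b
  have hka := interactionKernel_nonneg r δ θ ξ a
  have hkb := interactionKernel_nonneg r δ θ ξ b
  have hka' : 0 ≤ interactionKernel r δ θ ξ a * (w b * w a) := by positivity
  have hkb' : 0 ≤ interactionKernel r δ θ ξ b * (w b * w a) := by positivity
  have h4 : (1 : ℝ) ≤ 4 ^ δ := Real.one_le_rpow (by norm_num) (by linarith)
  set q : ℝ := 4 ^ δ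
  have hξb : ‖ξ‖ ≤ 2 * ‖b‖ := by
    rw [hab]; linarith [norm_add_le a b]
  have hξc := abs_coord_le_norm ξ 0
  have e1 : w ξ = (ξ 0 ^ 2 + ‖ξ‖ ^ (2 * δ)) / ‖ξ‖ ^ (2 * r) := anisotropicWeight_of_lt hξ
  have hb0 : 0 < ‖b‖ := by linarith
  have ha : ‖a‖ < 1 := hle.trans_lt hb
  have e2 : w b = (b 0 ^ 2 + ‖b‖ ^ (2 * δ)) / ‖b‖ ^ (2 * r) := anisotropicWeight_of_lt hb
  have e3 : w a = (a 0 ^ 2 + ‖a‖ ^ (2 * δ)) / ‖a‖ ^ (2 * r) := anisotropicWeight_of_lt ha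
  have e4 : ‖ξ‖ ^ (2 * δ) / ‖ξ‖ ^ (2 * r) ≤ q * w b := by
    have h0 : 2 * δ - 2 * r = 2 * (δ - r) := by ring
    calc ‖ξ‖ ^ (2 * δ) / ‖ξ‖ ^ (2 * r) = ‖ξ‖ ^ (2 * (δ - r)) := by rw [← Real.rpow_sub hξ0, h0]
      _ ≤ 4 ^ (δ - r) * ‖b‖ ^ (2 * (δ - r)) :=
          rpow_two_mul_le_mul hξ0.le hb0.le (by linarith) hξb
      _ ≤ q * (‖b‖ ^ (2 * δ) / ‖b‖ ^ (2 * r)) := by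
          rw [← Real.rpow_sub hb0, h0]
          gcongr
          exact Real.rpow_le_rpow_of_exponent_le (by norm_num) (by linarith)
      _ ≤ q * w b := by
          rw [e2]; gcongr; exact le_add_of_nonneg_left (sq_nonneg _)
  have e5 : w ξ = ξ 0 ^ 2 * ‖ξ‖ ^ (-(2 * r)) + ‖ξ‖ ^ (2 * δ) / ‖ξ‖ ^ (2 * r) := by
    rw [e1, add_div, Real.rpow_neg hξ0.le, div_eq_mul_inv]
  have hq0 : 0 ≤ q := by linarith
  have hξab : ξ 0 = a 0 + b 0 := by rw [hab]; simp
  rcases lt_or_ge ‖b‖ (2 * ‖ξ‖) with hbξ | hbξ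
  · have h1 : ‖ξ‖ ^ (-(2 * r)) ≤ 4 * ‖b‖ ^ (-(2 * r)) := by
      rw [Real.rpow_neg hξ0.le, Real.rpow_neg hb0.le, ← div_eq_mul_inv,
        inv_le_iff_one_le_mul₀ (by positivity), div_mul_eq_mul_div, le_div_iff₀ (by positivity),
        one_mul]
      refine (rpow_two_mul_le_mul hb0.le hξ0.le hr₀ hbξ.le).trans ?_
      gcongr
      exact (Real.rpow_le_rpow_of_exponent_le (by norm_num) hr₁).trans_eq (Real.rpow_one 4)
    have h2 : b 0 ^ 2 * ‖b‖ ^ (-(2 * r)) ≤ w b := by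
      rw [e2, Real.rpow_neg hb0.le, ← div_eq_mul_inv]
      gcongr
      exact le_add_of_nonneg_right (by positivity)
    have h3 : a 0 ^ 2 * ‖b‖ ^ (-(2 * r)) ≤ w a := by
      rcases (norm_nonneg a).eq_or_lt with ha0 | ha0
      · have : a = 0 := norm_eq_zero.1 ha0.symm
        rw [this] at hwa ⊢
        simpa using hwa
      rw [e3, Real.rpow_neg hb0.le, ← div_eq_mul_inv]
      gcongr
      exact le_add_of_nonneg_right (by positivity)
    have h6 : ξ 0 ^ 2 * ‖ξ‖ ^ (-(2 * r)) ≤ 8 * (w b + w a) := by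
      calc ξ 0 ^ 2 * ‖ξ‖ ^ (-(2 * r)) ≤ (2 * (a 0 ^ 2 + b 0 ^ 2)) * (4 * ‖b‖ ^ (-(2 * r))) := by
            gcongr
            rw [hξab]
            nlinarith [sq_nonneg (a 0 - b 0)]
        _ = 8 * (b 0 ^ 2 * ‖b‖ ^ (-(2 * r)) + a 0 ^ 2 * ‖b‖ ^ (-(2 * r))) := by ring
        _ ≤ _ := by gcongr
    have h7 := le_mul_of_one_le_left hwb h4
    have h8 := le_mul_of_one_le_left hwa h4
    have h9 := mul_nonneg hq0 hka'
    have h10 := mul_nonneg hq0 hkb'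
    rw [e5, mul_add, mul_add, add_mul, mul_add]
    linarith
  · have hba : ‖b‖ ≤ 2 * ‖a‖ := by
      have : ‖b‖ ≤ ‖ξ‖ + ‖a‖ := by
        rw [show b = ξ - a by rw [hab]; abel]
        exact norm_sub_le _ _
      linarith
    -- At least one input controls the first coordinate of the output. It need not be the longer
    -- one, which is why the kernel is required at both inputs.
    have hc : |ξ 0| ≤ 2 * |b 0| ∨ |ξ 0| ≤ 2 * |a 0| := by
      have : |ξ 0| ≤ |a 0| + |b 0| := by rw [hξab]; exact abs_add_le _ _
      rcases le_total |a 0| |b 0| with h | h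
      · left; linarith
      · right; linarith
    rcases hc with hc | hc
    · have h := sq_mul_rpow_le_interactionKernel (s := s) (θ := θ) (zero_le_one.trans hδ) hr₀ hr₁
        hθ₀ hθ₂ hab ha hb (by linarith) hc hba (by linarith) hb0
      have h8 := mul_nonneg hq0 hwa
      have h9 := mul_nonneg hq0 hka'
      have h10 := mul_nonneg hq0 hkb'
      have h11 := mul_nonneg hq0 hwb
      rw [e5]
      change _ ≤ 16 * q * (interactionKernel r δ θ ξ b * (w b * w a)) at h
      rw [mul_add, mul_add, add_mul, mul_add]
      linarith
    · have h := sq_mul_rpow_le_interactionKernel (s := s) (θ := θ) (zero_le_one.trans hδ) hr₀ hr₁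
        hθ₀ hθ₂ (hab.trans (add_comm a b)) hb ha (by linarith) hc (by linarith) hba (by linarith)
      have h8 := mul_nonneg hq0 hwa
      have h9 := mul_nonneg hq0 hka'
      have h10 := mul_nonneg hq0 hkb'
      have h11 := mul_nonneg hq0 hwb
      rw [e5]
      change _ ≤ 16 * q * (interactionKernel r δ θ ξ a * (w a * w b)) at h
      rw [mul_comm (w a)] at h
      rw [mul_add, mul_add, add_mul, mul_add]
      linarith

theorem anisotropicWeight_add_le {s r δ θ : ℝ} (hs : 0 ≤ s) (hδ : 1 ≤ δ) (hr₀ : 0 ≤ r)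
    (hr₁ : r ≤ 1) (hθ₀ : 0 ≤ θ) (hθ₂ : θ ≤ 2) {ξ a b : Space d} (hab : ξ = a + b)
    (hle : ‖a‖ ≤ ‖b‖) :
    (anisotropicWeight d s r δ).toFun ξ ≤ 17 * 5 ^ s * 4 ^ δ *
      ((anisotropicWeight d s r δ).toFun b + (anisotropicWeight d s r δ).toFun a +
      (interactionKernel r δ θ ξ b + interactionKernel r δ θ ξ a) *
      ((anisotropicWeight d s r δ).toFun b * (anisotropicWeight d s r δ).toFun a)) := by
  set w := (anisotropicWeight d s r δ).toFun with hw
  have hwa : 0 ≤ w a := anisotropicWeight_nonneg s r δ a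
  have hwb : 0 ≤ w b := anisotropicWeight_nonneg s r δ b
  have hka := interactionKernel_nonneg r δ θ ξ a
  have hkb := interactionKernel_nonneg r δ θ ξ b
  have hka' : 0 ≤ interactionKernel r δ θ ξ a * (w b * w a) := by positivity
  have hkb' : 0 ≤ interactionKernel r δ θ ξ b * (w b * w a) := by positivity
  have h5 : (1 : ℝ) ≤ 5 ^ s := Real.one_le_rpow (by norm_num) hs
  have h4 : (1 : ℝ) ≤ 4 ^ δ := Real.one_le_rpow (by norm_num) (by linarith)
  set S := w b + w a + (interactionKernel r δ θ ξ b + interactionKernel r δ θ ξ a) *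
    (w b * w a) with hS
  have hbS : w b ≤ S := by rw [hS, add_mul]; linarith
  rcases le_or_gt 1 ‖ξ‖ with hξ | hξ
  · refine (anisotropicWeight_add_le_of_one_le hs hδ hr₀ hab hle hξ).trans ?_
    gcongr
    linarith
  rcases (norm_nonneg ξ).eq_or_lt with hξ0 | hξ0
  · have : w ξ = 0 := by
      refine (anisotropicWeight_of_lt hξ).trans ?_
      rw [norm_eq_zero.1 hξ0.symm, norm_zero, Real.zero_rpow (by linarith : (2 * δ) ≠ 0)]
      simp
    rw [this]
    positivity
  rcases le_or_gt 1 ‖b‖ with hb | hb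
  · refine (anisotropicWeight_le_of_lt_one_le hs hδ hr₁ hξ0 hξ hb).trans ?_
    refine mul_le_mul ?_ hbS hwb (by positivity)
    nlinarith
  · refine (anisotropicWeight_add_le_of_lt hδ hr₀ hr₁ hθ₀ hθ₂ hab hle hξ0 hξ hb).trans ?_
    gcongr
    linarith

theorem integrable_anisotropicWeight_inv {s r δ : ℝ} (hδ : 1 < δ)
    (hdim : 1 + δ - 2 * r < (d : ℝ)) (hr₀ : 0 ≤ r) (hs : (d : ℝ) / 2 < s) :
    Integrable fun ξ => ((anisotropicWeight d s r δ).toFun ξ)⁻¹ := by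
  have h := lintegral_anisotropicWeight_rpow_lt_top hδ hdim hr₀ hs le_rfl (by linarith)
  refine ⟨(anisotropicWeight d s r δ).measurable.inv.aestronglyMeasurable, ?_⟩
  rw [hasFiniteIntegral_iff_ofReal
    (Eventually.of_forall fun ξ => inv_nonneg.2 (anisotropicWeight_nonneg s r δ ξ))]
  simpa [Real.rpow_neg_one] using h

theorem isAlgebra_anisotropicWeight {s r δ : ℝ} (hd : 2 ≤ d) (hδ : 1 < δ)
    (hdim : 1 + δ - 2 * r < (d : ℝ)) (hr₀ : 0 ≤ r) (hr₁ : r ≤ 1) (hδ₂ : d = 2 → δ ≤ 2)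
    (hs : (d : ℝ) / 2 < s) : (anisotropicWeight d s r δ).IsAlgebra := by
  obtain ⟨θ, hθ₀, hθ₂, M, hM⟩ := exists_lintegral_interactionKernel_le hd hδ hdim hr₁ hδ₂
  have hs0 : 0 ≤ s := le_trans (by positivity) hs.le
  refine FourierWeight.isAlgebra_of_kernel (integrable_anisotropicWeight_inv hδ hdim hr₀ hs)
    (anisotropicWeight_nonneg s r δ) (measurable_interactionKernel r δ θ)
    (interactionKernel_nonneg r δ θ) hM (C := 17 * 5 ^ s * 4 ^ δ) (by positivity) fun ξ η => ?_
  rcases le_total ‖ξ - η‖ ‖η‖ with h | h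
  · exact anisotropicWeight_add_le hs0 hδ.le hr₀ hr₁ hθ₀ hθ₂ (sub_add_cancel ξ η).symm h
  · refine (anisotropicWeight_add_le hs0 hδ.le hr₀ hr₁ hθ₀ hθ₂ (add_sub_cancel η ξ).symm h).trans_eq
      ?_
    ring

end AnisotropicWeight

/-! ### Gain of integrability for powers and Taylor remainders -/

/-- Interpolation between `∫ w |g|² < ∞` and integrability of a negative power of the weight. -/
theorem FourierWeight.lintegral_rpow_lt_top {d : ℕ} (w : FourierWeight d) {j : ℕ} (hj : 0 < j)
    (hw : ∫⁻ ξ, ENNReal.ofReal (w.toFun ξ ^ (-(1 + 1 / (j : ℝ)))) < ⊤) {g : Space d → ℂ}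
    (hg : Integrable fun ξ => w.toFun ξ * ‖g ξ‖ ^ 2) :
    ∫⁻ ξ, ‖g ξ‖ₑ ^ (2 * ((j + 1 : ℕ) : ℝ) / (2 * ((j + 1 : ℕ) : ℝ) - 1)) < ⊤ := by
  have hm := w.measurable
  have hj' : (0 : ℝ) < j := by exact_mod_cast hj
  have h1 : ∫⁻ ξ, ‖g ξ‖ₑ ^ (2 * ((j + 1 : ℕ) : ℝ) / (2 * ((j + 1 : ℕ) : ℝ) - 1)) ≤
      ∫⁻ ξ, (ENNReal.ofReal (w.toFun ξ * ‖g ξ‖ ^ 2) +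
        ENNReal.ofReal (w.toFun ξ ^ (-(1 + 1 / (j : ℝ))))) := by
    refine lintegral_mono_ae ?_
    filter_upwards [w.pos] with ξ hξ
    rw [← ofReal_norm, ENNReal.ofReal_rpow_of_nonneg (norm_nonneg _) (by
      push_cast
      exact div_nonneg (by positivity) (by linarith)), ← ENNReal.ofReal_add (by positivity)
      (by positivity)]
    refine ENNReal.ofReal_le_ofReal ?_
    have ha : 0 ≤ w.toFun ξ * ‖g ξ‖ ^ 2 := by positivity
    have hb : 0 ≤ w.toFun ξ ^ (-(1 + 1 / (j : ℝ))) := by positivity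
    -- With `θ = q/2` the powers of the weight cancel: `θ = (1 + 1/j)(1 - θ)`. Thus `|g|^q` is a
    -- weighted geometric mean of the two integrable functions.
    set θ : ℝ := (j + 1) / (2 * j + 1) with hθ
    have hθ0 : 0 ≤ θ := by positivity
    have hθ1 : 0 ≤ 1 - θ := by
      rw [hθ, sub_nonneg, div_le_one (by positivity)]; linarith
    have h2 := Real.geom_mean_le_arith_mean2_weighted hθ0 hθ1 ha hb (by ring)
    refine le_trans (le_of_eq ?_) (h2.trans ?_)
    · rw [Real.mul_rpow hξ.le (by positivity), ← Real.rpow_mul hξ.le, ← Real.rpow_natCast,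
        ← Real.rpow_mul (norm_nonneg _), mul_right_comm, ← Real.rpow_add hξ]
      have e1 : θ + -(1 + 1 / (j : ℝ)) * (1 - θ) = 0 := by
        rw [hθ]; field_simp; ring
      rw [e1, Real.rpow_zero, one_mul]
      congr 1
      have e2 : 2 * ((j : ℝ) + 1) - 1 = 2 * j + 1 := by ring
      rw [hθ]; push_cast; rw [e2, mul_div_assoc]
    · have : θ ≤ 1 := by linarith
      nlinarith
  refine h1.trans_lt ?_
  rw [lintegral_add_right _ (by fun_prop)]
  exact ENNReal.add_lt_top.2 ⟨hg.lintegral_lt_top, hw⟩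

namespace WeightedFourierSpace

variable {𝕜 : Type*} [RCLike 𝕜] [NormedAlgebra 𝕜 ℂ] {d : ℕ} {w : FourierWeight d}

theorem val_sub (hw : Integrable fun ξ => (w.toFun ξ)⁻¹) (f g : WeightedFourierSpace 𝕜 w)
    (x : Space d) : val (f - g) x = val f x - val g x :=
  map_sub (evalCLM hw x) f g

/-- Large powers of an element of the algebra are square integrable. -/
theorem memLp_val_pow (h : w.IsAlgebra) {n : ℕ} (hn : 0 < n) (u : WeightedFourierSpace 𝕜 w)
    (hu : ∫⁻ ξ, ‖fourierFun u ξ‖ₑ ^ (2 * n / (2 * n - 1) : ℝ) < ⊤) :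
    MemLp (fun x => algebraMap 𝕜 ℂ (val u x ^ (n + 1))) 2 := by
  have hm := (isFunction_fourierFun u).1.aestronglyMeasurable.enorm
  set K := hm.mk with hK
  have hKe : (fun ξ => ‖fourierFun u ξ‖ₑ) =ᵐ[volume] K := hm.ae_eq_mk
  have hKm : Measurable K := hm.measurable_mk
  have h1 : ∀ j, ∀ᵐ ξ, ‖fourierFun ((mulCLM h u ^ j) u) ξ‖ₑ ≤ (lconv K)^[j] K ξ := by
    intro j
    induction j with
    | zero =>
      filter_upwards [hKe] with ξ h1
      simp [h1]
    | succ j ih =>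
      rw [pow_succ', mul_apply_eq_comp, mulCLM_apply]
      filter_upwards [fourierFun_mul h u ((mulCLM h u ^ j) u)] with ξ h1
      rw [h1, Function.iterate_succ_apply']
      exact (enorm_convolution_le _ _ _).trans (lconv_mono hKe.le ih ξ)
  have h2 : ∫⁻ ξ, (lconv K)^[n] K ξ ^ 2 < ⊤ := by
    refine lintegral_iterate_lconv_sq_lt_top hKm hKm hn ?_ ?_
    · refine lt_of_eq_of_lt (lintegral_congr_ae ?_) hu
      filter_upwards [hKe] with ξ h1
      rw [h1]
    · rw [← lintegral_congr_ae hKe]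
      exact (integrable_fourierFun' h.integrable_inv u).2
  set y := (mulCLM h u ^ n) u with hy
  have h3 : MemLp (fourierFun y) 2 := by
    refine ⟨(isFunction_fourierFun y).1.aestronglyMeasurable, ?_⟩
    rw [eLpNorm_lt_top_iff_lintegral_rpow_enorm_lt_top (by norm_num) (by norm_num)]
    simp only [ENNReal.toReal_ofNat, ENNReal.rpow_ofNat]
    refine (lintegral_mono_ae ?_).trans_lt h2
    filter_upwards [h1 n] with ξ h
    gcongr
  have h4 := (IsFunction.memLp_two_of_fourier (isFunction_val h.integrable_inv y)
    (isFunction_fourierFun y) h3).1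
  refine h4.congr_norm ?_ (Eventually.of_forall fun x => ?_)
  · have h5 : (fun x => algebraMap 𝕜 ℂ (val u x ^ (n + 1))) =
        fun x => algebraMap 𝕜 ℂ (val y x) := by
      funext x
      rw [hy, val_mulCLM_pow, pow_succ]
    rw [h5]
    exact h4.1
  · rw [hy, val_mulCLM_pow, pow_succ]

theorem exists_val_pow (h : w.IsAlgebra) (u : WeightedFourierSpace 𝕜 w) (n : ℕ) :
    ∃ y : WeightedFourierSpace 𝕜 w, ∀ x, val y x = val u x ^ (n + 1) :=
  ⟨(mulCLM h u ^ n) u, fun x => by rw [val_mulCLM_pow, pow_succ]⟩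

/-- Differences of powers are divisible by the difference, in the algebra. -/
theorem exists_val_pow_sub_pow (h : w.IsAlgebra) (u v : WeightedFourierSpace 𝕜 w) (n : ℕ) :
    ∃ k : WeightedFourierSpace 𝕜 w, ∀ x,
      val u x ^ (n + 2) - val v x ^ (n + 2) = (val u x - val v x) * val k x := by
  induction n with
  | zero => exact ⟨u + v, fun x => by rw [val_add h.integrable_inv]; ring⟩
  | succ n ih =>
    obtain ⟨k, hk⟩ := ih
    obtain ⟨y, hy⟩ := exists_val_pow h v (n + 1)
    refine ⟨mul h u k + y, fun x => ?_⟩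
    rw [val_add h.integrable_inv, val_mul, hy]
    linear_combination val u x * hk x

/-- The linear term is removed so that the cofactor of `u - v` has no constant part and lies in the
algebra, which contains no unit. -/
theorem exists_val_sum_pow_sub (h : w.IsAlgebra) (u v : WeightedFourierSpace 𝕜 w) (c : ℕ → 𝕜)
    (n : ℕ) : ∃ k : WeightedFourierSpace 𝕜 w, ∀ x,
      ∑ i ∈ Finset.range (n + 2), c i * (val u x ^ i - val v x ^ i) -
        c 1 * (val u x - val v x) = (val u x - val v x) * val k x := by
  induction n with
  | zero =>
    refine ⟨0, fun x => ?_⟩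
    have : val (0 : WeightedFourierSpace 𝕜 w) x = 0 := map_zero (evalCLM h.integrable_inv x)
    simp [Finset.sum_range_succ, this]
  | succ n ih =>
    obtain ⟨k, hk⟩ := ih
    obtain ⟨y, hy⟩ := exists_val_pow_sub_pow h u v n
    refine ⟨k + c (n + 2) • y, fun x => ?_⟩
    rw [Finset.sum_range_succ, val_add h.integrable_inv, val_smul]
    linear_combination hk x + c (n + 2) * hy x

/-- The difference of two values of the nonlinearity is a product with the difference of the
arguments, up to a square integrable function. -/
theorem exists_enorm_fourier_sub_le (h : w.IsAlgebra) {n : ℕ} (hn : 0 < n)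
    (hq : ∀ u : WeightedFourierSpace 𝕜 w,
      ∫⁻ ξ, ‖fourierFun u ξ‖ₑ ^ (2 * n / (2 * n - 1) : ℝ) < ⊤)
    {R ρ : ℝ} (hρ : 0 < ρ) (hρR : ρ < R) {ζ : 𝕜 → 𝕜} {p : FormalMultilinearSeries 𝕜 𝕜 𝕜}
    (hζ : HasFPowerSeriesOnBall ζ p 0 (ENNReal.ofReal R)) {a : 𝕜} (hζ' : HasDerivAt ζ a 0)
    {u v : WeightedFourierSpace 𝕜 w} (hu : ∀ x, ‖val u x‖ < ρ) (hv : ∀ x, ‖val v x‖ < ρ)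
    {T : 𝓢'(Space d, ℂ)} (hT : IsFunction T fun x =>
      algebraMap 𝕜 ℂ (ζ (val u x) - ζ (val v x) - a * (val u x - val v x))) :
    ∃ (t : Space d → ℂ) (k : WeightedFourierSpace 𝕜 w) (G : Space d → ℂ),
      IsFunction (𝓕 T) t ∧ MemLp G 2 ∧ ∀ᵐ ξ, ‖t ξ‖ₑ ≤
      lconv (fun η => ‖fourierFun k η‖ₑ) (fun η => ‖fourierFun (u - v) η‖ₑ) ξ + ‖G ξ‖ₑ := by
  -- The Taylor polynomial is kept up to degree `n = m + 1`, so the remainder is of order `n + 1 = m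
  -- + 2`, the power known to be square integrable.
  obtain ⟨m, rfl⟩ : ∃ m, n = m + 1 := ⟨n - 1, by omega⟩
  obtain ⟨k, hk⟩ := exists_val_sum_pow_sub h u v p.coeff m
  have hc1 : p.coeff 1 = a := hζ.hasFPowerSeriesAt.hasDerivAt.unique hζ'
  obtain ⟨b, hb, C, hC, hE⟩ := hζ.uniform_geometric_approx' (r' := ρ.toNNReal)
    ((ENNReal.ofReal_lt_ofReal_iff (hρ.trans hρR)).2 hρR)
  rw [Real.coe_toNNReal ρ hρ.le] at hE
  have hE' : ∀ z : 𝕜, ‖z‖ < ρ → ‖ζ z - ∑ i ∈ Finset.range (m + 2), p.coeff i * z ^ i‖ ≤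
      C * (b / ρ) ^ (m + 2) * ‖z ^ (m + 2)‖ := fun z hz => by
    have h1 := hE z (by simpa using hz) (m + 2)
    have h2 : p.partialSum (m + 2) z = ∑ i ∈ Finset.range (m + 2), p.coeff i * z ^ i := by
      refine Finset.sum_congr rfl fun i _ => ?_
      rw [FormalMultilinearSeries.apply_eq_pow_smul_coeff, smul_eq_mul, mul_comm]
    rw [zero_add, h2] at h1
    refine h1.trans_eq ?_
    rw [norm_pow, mul_assoc, ← mul_pow]
    congr 2
    ring
  -- Removing the multiple of `u - v` leaves the difference of the two Taylor remainders, bounded by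
  -- a multiple of `|u|^{n+1} + |v|^{n+1}` and hence in `L²`.
  set S := T - distribution (mul h (u - v) k) with hS
  have hSf := hT.sub (isFunction_val h.integrable_inv (mul h (u - v) k))
  rw [← hS] at hSf
  have hS2 := ((memLp_val_pow h hn u (hq u)).norm.add (memLp_val_pow h hn v (hq v)).norm).const_mul
    (C * (b / ρ) ^ (m + 2))
  have hSm := hS2.of_le hSf.1.aestronglyMeasurable (Eventually.of_forall fun x => by
    have h1 := hE' _ (hu x)
    have h2 := hE' _ (hv x)
    have h3 := hk x
    rw [hc1] at h3
    simp only [mul_sub, Finset.sum_sub_distrib] at h3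
    rw [Pi.sub_apply, ← map_sub, norm_algebraMap_eq, val_mul, val_sub h.integrable_inv]
    have h4 : ζ (val u x) - ζ (val v x) - a * (val u x - val v x) -
        (val u x - val v x) * val k x =
        (ζ (val u x) - ∑ i ∈ Finset.range (m + 2), p.coeff i * val u x ^ i) -
        (ζ (val v x) - ∑ i ∈ Finset.range (m + 2), p.coeff i * val v x ^ i) := by
      linear_combination h3
    rw [h4]
    refine le_trans ?_ (Real.le_norm_self _)
    simp only [Pi.add_apply, norm_algebraMap_eq, mul_add]
    exact (norm_sub_le _ _).trans (add_le_add h1 h2))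
  obtain ⟨G, hG, hGf, -⟩ := hSf.exists_fourier_of_memLp_two hSm
  have hT' : T = distribution (mul h (u - v) k) + S := by rw [hS]; abel
  refine ⟨fourierFun (mul h (u - v) k) + G, k, G, ?_, hG, ?_⟩
  · rw [hT', FourierTransform.fourier_add]
    exact (isFunction_fourierFun _).add hGf
  filter_upwards [fourierFun_mul h (u - v) k] with ξ h2
  rw [Pi.add_apply, h2]
  refine (enorm_add_le _ _).trans (add_le_add_left ?_ _)
  rw [lconv_comm]
  exact enorm_convolution_le _ _ _

end WeightedFourierSpace

theorem lconv_linear_combination {d : ℕ} {a b : ℝ≥0∞} (ha : a ≠ ⊤) (hb : b ≠ ⊤)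
    {F F' G : Space d → ℝ≥0∞} (hF : Measurable F) (hG : Measurable G) (ξ : Space d) :
    lconv (fun η => a * F η + b * F' η) G ξ = a * lconv F G ξ + b * lconv F' G ξ := by
  unfold lconv
  simp only [add_mul, mul_assoc]
  rw [lintegral_add_left (by fun_prop), lintegral_const_mul' _ _ ha, lintegral_const_mul' _ _ hb]

theorem lintegral_rpow_linear_combination_lt_top {α : Type*} [MeasurableSpace α] {μ : Measure α}
    {f g : α → ℝ≥0∞} (hf : Measurable f) {a b : ℝ≥0∞} (ha : a ≠ ⊤) (hb : b ≠ ⊤) {q : ℝ}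
    (hq : 1 ≤ q) (hfq : ∫⁻ x, f x ^ q ∂μ < ⊤) (hgq : ∫⁻ x, g x ^ q ∂μ < ⊤) :
    ∫⁻ x, (a * f x + b * g x) ^ q ∂μ < ⊤ := by
  have hq0 : 0 ≤ q := zero_le_one.trans hq
  have h1 : ∀ {c : ℝ≥0∞} {F : α → ℝ≥0∞}, c ≠ ⊤ → ∫⁻ x, F x ^ q ∂μ < ⊤ →
      ∫⁻ x, (c * F x) ^ q ∂μ < ⊤ := fun {c F} hc hF => by
    simp only [ENNReal.mul_rpow_of_nonneg _ _ hq0]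
    have hc' : c ^ q ≠ ⊤ := (ENNReal.rpow_lt_top_of_nonneg hq0 hc).ne
    rw [lintegral_const_mul' _ _ hc']
    exact ENNReal.mul_lt_top hc'.lt_top hF
  exact ENNReal.lintegral_rpow_add_lt_top_of_lintegral_rpow_lt_top (by fun_prop) (h1 ha hfq)
    (h1 hb hgq) hq

/-! ### The symbol of the linearized operator -/

/-- The symbol of the linearized equation. -/
noncomputable def linearSymbol {d : ℕ} [NeZero d] (φ : Space d → ℝ) (γ α β : ℝ) (ξ : Space d) :
    ℂ :=
  β * φ ξ - 2 * Real.pi * Complex.I * γ * α * ξ 0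

section Symbol

variable {d : ℕ} [NeZero d] {φ : Space d → ℝ} {γ α β : ℝ}

theorem norm_sq_linearSymbol (ξ : Space d) :
    ‖linearSymbol φ γ α β ξ‖ ^ 2 = (β * φ ξ) ^ 2 + (2 * Real.pi * γ * α * ξ 0) ^ 2 := by
  have h : linearSymbol φ γ α β ξ =
      ((β * φ ξ : ℝ) : ℂ) + ((-(2 * Real.pi * γ * α * ξ 0) : ℝ) : ℂ) * Complex.I := by
    rw [linearSymbol]; push_cast; ring
  rw [h, Complex.sq_norm, Complex.normSq_add_mul_I, neg_sq]

theorem linearSymbol_ne_zero (hγ : γ ≠ 0) (hα : α ≠ 0) (hβ : β ≠ 0) {ξ : Space d}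
    (h : ξ 0 = 0 → φ ξ ≠ 0) : linearSymbol φ γ α β ξ ≠ 0 := by
  intro h0
  have h1 := norm_sq_linearSymbol (φ := φ) (γ := γ) (α := α) (β := β) ξ
  rw [h0, norm_zero, zero_pow two_ne_zero] at h1
  have h2 : β * φ ξ = 0 := by
    nlinarith [sq_nonneg (β * φ ξ), sq_nonneg (2 * Real.pi * γ * α * ξ 0)]
  have h3 : 2 * Real.pi * γ * α * ξ 0 = 0 := by
    nlinarith [sq_nonneg (β * φ ξ), sq_nonneg (2 * Real.pi * γ * α * ξ 0)]
  simp only [mul_eq_zero, OfNat.ofNat_ne_zero, Real.pi_ne_zero, hγ, hα, false_or] at h3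
  exact h h3 ((mul_eq_zero.1 h2).resolve_left hβ)

theorem abs_mul_le_norm_linearSymbol (ξ : Space d) :
    |β| * |φ ξ| ≤ ‖linearSymbol φ γ α β ξ‖ := by
  rw [← abs_mul]
  refine abs_le_of_sq_le_sq ?_ (norm_nonneg _)
  rw [norm_sq_linearSymbol]
  exact le_add_of_nonneg_right (sq_nonneg _)

theorem abs_mul_coord_le_norm_linearSymbol (ξ : Space d) :
    |α| * (2 * Real.pi * |γ| * |ξ 0|) ≤ ‖linearSymbol φ γ α β ξ‖ := by
  have h : |α| * (2 * Real.pi * |γ| * |ξ 0|) = |2 * Real.pi * γ * α * ξ 0| := by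
    simp only [abs_mul, abs_of_pos Real.pi_pos, abs_two]; ring
  rw [h]
  refine abs_le_of_sq_le_sq ?_ (norm_nonneg _)
  rw [norm_sq_linearSymbol]
  exact le_add_of_nonneg_left (sq_nonneg _)

theorem continuous_linearSymbol (hφ : Continuous φ) : Continuous (linearSymbol φ γ α β) := by
  unfold linearSymbol
  fun_prop

theorem linearSymbol_neg (hφ : ∀ ξ, φ (-ξ) = φ ξ) (ξ : Space d) :
    linearSymbol φ γ α β (-ξ) = (starRingEnd ℂ) (linearSymbol φ γ α β ξ) := by
  have h2 : (starRingEnd ℂ) 2 = 2 := map_ofNat _ 2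
  simp [linearSymbol, hφ, h2]

/-- The linearized operator gains exactly the regularity that separates the two spaces. -/
theorem exists_anisotropicWeight_le {s r δ σ : ℝ} (hγ : γ ≠ 0) (hα : α ≠ 0) (hβ : β ≠ 0)
    (hφ_cont : Continuous φ)
    (hφ_low : φ =Θ[𝓝 0] fun ξ => ‖ξ‖ ^ δ)
    (hφ_high : φ =Θ[cocompact (Space d)] fun ξ => ‖ξ‖ ^ σ)
    (hφ_ne : ∀ ξ : Space d, ξ ≠ 0 → ξ 0 = 0 → φ ξ ≠ 0) :
    ∃ C : ℝ, ∀ ξ : Space d, ξ ≠ 0 →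
      (anisotropicWeight d (s + σ) r δ).toFun ξ * ‖(linearSymbol φ γ α β ξ)⁻¹‖ ^ 2 ≤
        C * (sobolevWeight d s r).toFun ξ := by
  set m := linearSymbol φ γ α β with hm
  have hm0 : ∀ ξ : Space d, ξ ≠ 0 → 0 < ‖m ξ‖ := fun ξ hξ =>
    norm_pos_iff.2 (linearSymbol_ne_zero hγ hα hβ (hφ_ne ξ hξ))
  have hφm : ∀ ξ, |φ ξ| ≤ |β|⁻¹ * ‖m ξ‖ := fun ξ => by
    rw [← div_eq_inv_mul, le_div_iff₀' (abs_pos.2 hβ)]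
    exact abs_mul_le_norm_linearSymbol ξ
  have hcm : ∀ ξ : Space d, |ξ 0| ≤ (|α| * (2 * Real.pi * |γ|))⁻¹ * ‖m ξ‖ := fun ξ => by
    rw [← div_eq_inv_mul, le_div_iff₀' (by positivity), mul_assoc]
    exact abs_mul_coord_le_norm_linearSymbol ξ
  have hY₁ : ∀ ξ : Space d, (1 + ‖ξ‖ ^ 2) ^ s ≤ (sobolevWeight d s r).toFun ξ := fun ξ =>
    le_add_of_nonneg_right (by positivity)
  have hY₂ : ∀ ξ : Space d, ‖ξ‖ ^ (-2 * r) ≤ (sobolevWeight d s r).toFun ξ := fun ξ =>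
    le_add_of_nonneg_left (by positivity)
  have hY₀ : ∀ ξ : Space d, 0 < (sobolevWeight d s r).toFun ξ := fun ξ =>
    lt_of_lt_of_le (by positivity) (hY₁ ξ)
  obtain ⟨c₁, hc₁⟩ := hφ_low.2.bound
  obtain ⟨ε, hε, hlow⟩ := Metric.eventually_nhds_iff_ball.1 hc₁
  obtain ⟨c₂, hc₂⟩ := hφ_high.2.bound
  obtain ⟨t, ht, hhigh⟩ := mem_cocompact.1 hc₂
  obtain ⟨L, hL⟩ := ht.isBounded.subset_closedBall (0 : Space d)
  have hlow' : ∃ C₁ : ℝ, 0 ≤ C₁ ∧ ∀ ξ : Space d, ξ ≠ 0 → ‖ξ‖ < min ε 1 →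
      (anisotropicWeight d (s + σ) r δ).toFun ξ ≤
        C₁ * (sobolevWeight d s r).toFun ξ * ‖m ξ‖ ^ 2 := by
    refine ⟨((|α| * (2 * Real.pi * |γ|))⁻¹) ^ 2 + (|c₁| * |β|⁻¹) ^ 2, by positivity,
      fun ξ hξ hξε => ?_⟩
    have hξ0 := norm_pos_iff.2 hξ
    have h1 := hlow ξ (by simpa using hξε.trans_le (min_le_left _ _))
    rw [Real.norm_of_nonneg (by positivity), Real.norm_eq_abs] at h1
    have h2 : ‖ξ‖ ^ δ ≤ |c₁| * |β|⁻¹ * ‖m ξ‖ := by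
      rw [mul_assoc]
      exact h1.trans (mul_le_mul (le_abs_self _) (hφm ξ) (abs_nonneg _) (abs_nonneg _))
    rw [anisotropicWeight_of_lt (hξε.trans_le (min_le_right _ _)), rpow_two_mul hξ0.le δ,
      ← sq_abs (ξ 0)]
    calc (|ξ 0| ^ 2 + (‖ξ‖ ^ δ) ^ 2) / ‖ξ‖ ^ (2 * r)
        ≤ (((|α| * (2 * Real.pi * |γ|))⁻¹ * ‖m ξ‖) ^ 2 + (|c₁| * |β|⁻¹ * ‖m ξ‖) ^ 2) /
            ‖ξ‖ ^ (2 * r) := by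
          gcongr
          exact hcm ξ
      _ = (((|α| * (2 * Real.pi * |γ|))⁻¹) ^ 2 + (|c₁| * |β|⁻¹) ^ 2) * ‖ξ‖ ^ (-2 * r) *
            ‖m ξ‖ ^ 2 := by
          rw [neg_mul, Real.rpow_neg hξ0.le, div_eq_mul_inv]; ring
      _ ≤ _ := by
          gcongr
          exact hY₂ ξ
  have hhigh' : ∃ C₂ : ℝ, 0 ≤ C₂ ∧ ∀ ξ : Space d, max L 1 < ‖ξ‖ →
      (anisotropicWeight d (s + σ) r δ).toFun ξ ≤
        C₂ * (sobolevWeight d s r).toFun ξ * ‖m ξ‖ ^ 2 := by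
    refine ⟨2 ^ |σ| * (|c₂| * |β|⁻¹) ^ 2, by positivity, fun ξ hξ => ?_⟩
    have hξ1 : 1 < ‖ξ‖ := (le_max_right _ _).trans_lt hξ
    have hξ0 : 0 < ‖ξ‖ := zero_lt_one.trans hξ1
    have h1 := hhigh (show ξ ∈ tᶜ from fun h => by
      have := hL h
      rw [mem_closedBall_zero_iff] at this
      exact absurd ((le_max_left L 1).trans_lt hξ) this.not_gt)
    change ‖‖ξ‖ ^ σ‖ ≤ _ at h1
    rw [Real.norm_of_nonneg (by positivity), Real.norm_eq_abs] at h1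
    have h2 : ‖ξ‖ ^ σ ≤ |c₂| * |β|⁻¹ * ‖m ξ‖ := by
      rw [mul_assoc]
      exact h1.trans (mul_le_mul (le_abs_self _) (hφm ξ) (abs_nonneg _) (abs_nonneg _))
    have h3 : (1 + ‖ξ‖ ^ 2) ^ σ ≤ 2 ^ |σ| * (‖ξ‖ ^ σ) ^ 2 := by
      have e : (‖ξ‖ ^ 2) ^ σ = (‖ξ‖ ^ σ) ^ 2 := by
        rw [← Real.rpow_natCast, ← Real.rpow_natCast, ← Real.rpow_mul hξ0.le,
          ← Real.rpow_mul hξ0.le, mul_comm]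
      -- For `σ ≥ 0` the bound `1 + |ξ|² ≤ 2|ξ|²` is used; for `σ < 0` the power is decreasing and
      -- no factor is needed.
      rcases le_total 0 σ with h | h
      · rw [abs_of_nonneg h, ← e, ← Real.mul_rpow (by norm_num) (by positivity)]
        exact Real.rpow_le_rpow (by positivity) (by nlinarith) h
      · rw [← e]
        calc (1 + ‖ξ‖ ^ 2) ^ σ ≤ (‖ξ‖ ^ 2) ^ σ :=
              Real.rpow_le_rpow_of_nonpos (by positivity) (by linarith) h
          _ ≤ _ := le_mul_of_one_le_left (by positivity)
              (Real.one_le_rpow one_le_two (abs_nonneg σ))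
    rw [anisotropicWeight_of_le hξ1.le, Real.rpow_add (by positivity)]
    calc (1 + ‖ξ‖ ^ 2) ^ s * (1 + ‖ξ‖ ^ 2) ^ σ
        ≤ (sobolevWeight d s r).toFun ξ * (2 ^ |σ| * (|c₂| * |β|⁻¹ * ‖m ξ‖) ^ 2) := by
          refine mul_le_mul (hY₁ ξ) (h3.trans ?_) (by positivity) (hY₀ ξ).le
          gcongr
      _ = _ := by ring
  have hmid : ∃ C₃ : ℝ, 0 ≤ C₃ ∧ ∀ ξ : Space d, min ε 1 ≤ ‖ξ‖ → ‖ξ‖ ≤ max L 1 →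
      (anisotropicWeight d (s + σ) r δ).toFun ξ ≤
        C₃ * (sobolevWeight d s r).toFun ξ * ‖m ξ‖ ^ 2 := by
    have hε1 : 0 < min ε 1 := by positivity
    have hK : IsCompact (Metric.closedBall (0 : Space d) (max L 1) \ Metric.ball 0 (min ε 1)) :=
      (isCompact_closedBall _ _).diff Metric.isOpen_ball
    have hne : ∀ ξ ∈ Metric.closedBall (0 : Space d) (max L 1) \ Metric.ball 0 (min ε 1),
        ξ ≠ 0 := by
      rintro ξ ⟨-, h⟩ rfl
      exact h (Metric.mem_ball_self hε1)
    have hmc : Continuous m := continuous_linearSymbol hφ_cont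
    -- On this compact annulus `m` has no zeros. The weight jumps at `|ξ| = 1`, so the continuous
    -- sum of its two formulas is bounded instead.
    obtain ⟨C, hC⟩ := hK.exists_bound_of_continuousOn
      (f := fun ξ : Space d => (((ξ 0) ^ 2 + ‖ξ‖ ^ (2 * δ)) / ‖ξ‖ ^ (2 * r) +
        (1 + ‖ξ‖ ^ 2) ^ (s + σ)) / ((1 + ‖ξ‖ ^ 2) ^ s * ‖m ξ‖ ^ 2)) (by
        have hn : ∀ a : ℝ, ContinuousOn (fun ξ : Space d => ‖ξ‖ ^ a)
            (Metric.closedBall (0 : Space d) (max L 1) \ Metric.ball 0 (min ε 1)) := fun a =>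
          continuous_norm.continuousOn.rpow_const fun ξ hξ => Or.inl (norm_ne_zero_iff.2 (hne ξ hξ))
        have hj : ∀ a : ℝ, Continuous (fun ξ : Space d => (1 + ‖ξ‖ ^ 2) ^ a) := fun a =>
          Continuous.rpow_const (by fun_prop) fun ξ => Or.inl (by positivity)
        refine ContinuousOn.div (((Continuous.continuousOn (by fun_prop)).add (hn _)).div (hn _)
          (fun ξ hξ => ?_) |>.add (hj _).continuousOn)
          ((hj _).mul (hmc.norm.pow 2)).continuousOn fun ξ hξ => ?_
        · have := norm_pos_iff.2 (hne ξ hξ)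
          positivity
        · have := hm0 ξ (hne ξ hξ)
          positivity)
    refine ⟨|C|, abs_nonneg C, fun ξ h1 h2 => ?_⟩
    have hξ : ξ ∈ Metric.closedBall (0 : Space d) (max L 1) \ Metric.ball 0 (min ε 1) :=
      ⟨by simpa using h2, by rw [mem_ball_zero_iff]; exact h1.not_gt⟩
    have h3 := hm0 ξ (hne ξ hξ)
    have h4 := (le_abs_self _).trans ((hC ξ hξ).trans (le_abs_self C))
    rw [div_le_iff₀ (by positivity)] at h4
    have h5 : (anisotropicWeight d (s + σ) r δ).toFun ξ ≤
        ((ξ 0) ^ 2 + ‖ξ‖ ^ (2 * δ)) / ‖ξ‖ ^ (2 * r) + (1 + ‖ξ‖ ^ 2) ^ (s + σ) := by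
      rcases lt_or_ge ‖ξ‖ 1 with h | h
      · rw [anisotropicWeight_of_lt h]
        exact le_add_of_nonneg_right (by positivity)
      · rw [anisotropicWeight_of_le h]
        exact le_add_of_nonneg_left (by positivity)
    refine h5.trans (h4.trans ?_)
    rw [← mul_assoc]
    gcongr
    exact hY₁ ξ
  obtain ⟨C₁, hC₁, H₁⟩ := hlow'
  obtain ⟨C₂, hC₂, H₂⟩ := hhigh'
  obtain ⟨C₃, hC₃, H₃⟩ := hmid
  refine ⟨C₁ + C₂ + C₃, fun ξ hξ => ?_⟩
  have hmξ := hm0 ξ hξ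
  have hYξ := (hY₀ ξ).le
  rw [norm_inv, inv_pow, ← div_eq_mul_inv, div_le_iff₀ (by positivity)]
  have key : ∀ c, c ≤ C₁ + C₂ + C₃ → c * (sobolevWeight d s r).toFun ξ * ‖m ξ‖ ^ 2 ≤
      (C₁ + C₂ + C₃) * (sobolevWeight d s r).toFun ξ * ‖m ξ‖ ^ 2 := fun c hc => by gcongr
  rcases lt_or_ge ‖ξ‖ (min ε 1) with h1 | h1
  · exact (H₁ ξ hξ h1).trans (key _ (by linarith))
  · rcases lt_or_ge (max L 1) ‖ξ‖ with h2 | h2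
    · exact (H₂ ξ h2).trans (key _ (by linarith))
    · exact (H₃ ξ h1 h2).trans (key _ (by linarith))

end Symbol

/-- Both coefficients on the right are controlled by the symbol itself, so dividing by it costs only
the constants `|α|⁻¹` and `|β|⁻¹`, uniformly in `ξ`. -/
theorem norm_le_of_linearSymbol_mul_eq {d : ℕ} [NeZero d] {φ : Space d → ℝ} {γ α β : ℝ}
    (hα : α ≠ 0) (hβ : β ≠ 0) {ξ : Space d} (hm : linearSymbol φ γ α β ξ ≠ 0) {W a b : ℂ}
    (h : linearSymbol φ γ α β ξ * W =
      2 * Real.pi * Complex.I * γ * ξ 0 * a - φ ξ * b) :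
    ‖W‖ ≤ |α|⁻¹ * ‖a‖ + |β|⁻¹ * ‖b‖ := by
  have hm0 := norm_pos_iff.2 hm
  have hα0 := abs_pos.2 hα
  have hβ0 := abs_pos.2 hβ
  refine le_of_mul_le_mul_left ?_ hm0
  rw [← norm_mul, h]
  have h1 : ‖2 * Real.pi * Complex.I * γ * ξ 0 * a‖ = 2 * Real.pi * |γ| * |ξ 0| * ‖a‖ := by
    simp [abs_of_pos Real.pi_pos]
  have h2 : ‖(φ ξ : ℂ) * b‖ = |φ ξ| * ‖b‖ := by simp
  refine (norm_sub_le _ _).trans ?_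
  rw [h1, h2, mul_add]
  refine add_le_add ?_ ?_
  · rw [← mul_assoc]
    refine mul_le_mul_of_nonneg_right ?_ (norm_nonneg _)
    rw [← div_eq_mul_inv, le_div_iff₀' hα0]
    exact abs_mul_coord_le_norm_linearSymbol ξ
  · rw [← mul_assoc]
    refine mul_le_mul_of_nonneg_right ?_ (norm_nonneg _)
    rw [← div_eq_mul_inv, le_div_iff₀' hβ0]
    exact abs_mul_le_norm_linearSymbol ξ

theorem IsFunction.fourier_lineDeriv_coord {d : ℕ} [NeZero d] {T : 𝓢'(Space d, ℂ)}
    {g : Space d → ℂ} (hT : IsFunction (𝓕 T) g) :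
    IsFunction (𝓕 (∂_{EuclideanSpace.single (0 : Fin d) (1 : ℝ)} T))
      (fun ξ => 2 * Real.pi * Complex.I * ξ 0 * g ξ) := by
  simpa [EuclideanSpace.inner_single_right] using
    hT.fourier_lineDeriv (EuclideanSpace.single (0 : Fin d) (1 : ℝ))

theorem IsFunction.fourier_sub {d : ℕ} {S T : 𝓢'(Space d, ℂ)} {g h : Space d → ℂ}
    (hS : IsFunction (𝓕 S) g) (hT : IsFunction (𝓕 T) h) : IsFunction (𝓕 (S - T)) (g - h) := by
  rw [sub_eq_add_neg, FourierTransform.fourier_add, FourierTransform.fourier_neg,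
    ← sub_eq_add_neg]
  exact hS.sub hT

/-! ### Uniqueness -/

namespace WeightedFourierSpace

variable {𝕜 : Type*} [RCLike 𝕜] [NormedAlgebra 𝕜 ℂ] {d : ℕ} {w : FourierWeight d}

/-- If the Fourier transform of `W` is bounded by its convolution with transforms of elements of
the space, up to square integrable terms, then it is square integrable. -/
theorem memLp_fourierFun_of_le_lconv (hw : Integrable fun ξ => (w.toFun ξ)⁻¹) {n : ℕ} (hn : 0 < n)
    (hq : ∀ u : WeightedFourierSpace 𝕜 w,
      ∫⁻ ξ, ‖fourierFun u ξ‖ₑ ^ (2 * n / (2 * n - 1) : ℝ) < ⊤)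
    {W k₁ k₂ : WeightedFourierSpace 𝕜 w} {G₁ G₂ : Space d → ℂ} (hG₁ : MemLp G₁ 2)
    (hG₂ : MemLp G₂ 2) {a b : ℝ≥0∞} (ha : a ≠ ⊤) (hb : b ≠ ⊤)
    (h : ∀ᵐ ξ, ‖fourierFun W ξ‖ₑ ≤
      a * (lconv (fun η => ‖fourierFun k₁ η‖ₑ) (fun η => ‖fourierFun W η‖ₑ) ξ + ‖G₁ ξ‖ₑ) +
      b * (lconv (fun η => ‖fourierFun k₂ η‖ₑ) (fun η => ‖fourierFun W η‖ₑ) ξ + ‖G₂ ξ‖ₑ)) :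
    MemLp (fourierFun W) 2 := by
  have hm : ∀ u : WeightedFourierSpace 𝕜 w, AEMeasurable fun ξ => ‖fourierFun u ξ‖ₑ := fun u =>
    (isFunction_fourierFun u).1.aestronglyMeasurable.enorm
  have hint : ∀ u : WeightedFourierSpace 𝕜 w, ∫⁻ ξ, (hm u).mk _ ξ < ⊤ := fun u => by
    rw [← lintegral_congr_ae (hm u).ae_eq_mk]
    exact (integrable_fourierFun' hw u).2
  have hq' : ∀ u : WeightedFourierSpace 𝕜 w,
      ∫⁻ ξ, (hm u).mk _ ξ ^ (2 * n / (2 * n - 1) : ℝ) < ⊤ := fun u => by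
    refine lt_of_eq_of_lt (lintegral_congr_ae ?_) (hq u)
    filter_upwards [(hm u).ae_eq_mk] with ξ h
    rw [← h]
  have hgm₁ := hG₁.1.enorm
  have hgm₂ := hG₂.1.enorm
  have hG2 : ∀ {G : Space d → ℂ} (hG : MemLp G 2), ∫⁻ ξ, hG.1.enorm.mk _ ξ ^ (2 : ℝ) < ⊤ :=
    fun {G} hG => by
      have h1 := (eLpNorm_lt_top_iff_lintegral_rpow_enorm_lt_top (by norm_num) (by norm_num)).1 hG.2
      rw [ENNReal.toReal_ofNat] at h1
      refine lt_of_eq_of_lt (lintegral_congr_ae ?_) h1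
      filter_upwards [hG.1.enorm.ae_eq_mk] with ξ h
      rw [← h]
  have hn1 : (1 : ℝ) ≤ n := by exact_mod_cast hn
  have hq1 : (1 : ℝ) ≤ 2 * n / (2 * n - 1) := by
    rw [le_div_iff₀ (by linarith)]; linarith
  have hW : (fun ξ => ‖fourierFun W ξ‖ₑ) =ᵐ[volume] (hm W).mk _ := (hm W).ae_eq_mk
  have key := lintegral_sq_lt_top_of_le_lconv (A := (hm W).mk _)
    (K := fun ξ => a * (hm k₁).mk _ ξ + b * (hm k₂).mk _ ξ)
    (G := fun ξ => a * hgm₁.mk _ ξ + b * hgm₂.mk _ ξ)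
    (hm W).measurable_mk
    (((hm k₁).measurable_mk.const_mul a).add ((hm k₂).measurable_mk.const_mul b))
    ((hgm₁.measurable_mk.const_mul a).add (hgm₂.measurable_mk.const_mul b)) hn
    (lintegral_rpow_linear_combination_lt_top (hm k₁).measurable_mk ha hb hq1 (hq' k₁) (hq' k₂))
    (by
      have := lintegral_rpow_linear_combination_lt_top (hm k₁).measurable_mk ha hb le_rfl
        (by simpa using hint k₁) (by simpa using hint k₂)
      simpa using this)
    (hint W)
    (by
      have := lintegral_rpow_linear_combination_lt_top hgm₁.measurable_mk ha hb one_le_two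
        (hG2 hG₁) (hG2 hG₂)
      simpa using this)
    (by
      filter_upwards [h, hW, hgm₁.ae_eq_mk, hgm₂.ae_eq_mk] with ξ h1 h2 h3 h4
      rw [← h2, ← h3, ← h4]
      refine h1.trans_eq ?_
      rw [lconv_congr (hm k₁).ae_eq_mk hW, lconv_congr (hm k₂).ae_eq_mk hW,
        lconv_linear_combination ha hb (hm k₁).measurable_mk (hm W).measurable_mk]
      ring)
  refine ⟨(isFunction_fourierFun W).1.aestronglyMeasurable, ?_⟩
  rw [eLpNorm_lt_top_iff_lintegral_rpow_enorm_lt_top (by norm_num) (by norm_num)]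
  simp only [ENNReal.toReal_ofNat, ENNReal.rpow_ofNat]
  refine lt_of_eq_of_lt (lintegral_congr_ae ?_) key
  filter_upwards [hW] with ξ h
  rw [h]

/-- Plancherel for a function that is pointwise bounded by an element of the space. -/
theorem eLpNorm_fourier_le_of_norm_le (hw : Integrable fun ξ => (w.toFun ξ)⁻¹)
    {W : WeightedFourierSpace 𝕜 w} (hW : MemLp (fourierFun W) 2) {T : 𝓢'(Space d, ℂ)}
    {D : Space d → ℂ} (hT : IsFunction T D) {c : ℝ} (hD : ∀ x, ‖D x‖ ≤ c * ‖val W x‖)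
    {t : Space d → ℂ} (ht : IsFunction (𝓕 T) t) :
    MemLp t 2 ∧ eLpNorm t 2 ≤ ENNReal.ofReal c * eLpNorm (fourierFun W) 2 := by
  obtain ⟨h1, h2⟩ := IsFunction.memLp_two_of_fourier (isFunction_val hw W)
    (isFunction_fourierFun W) hW
  have hb : ∀ᵐ x, ‖D x‖ ≤ c * ‖algebraMap 𝕜 ℂ (val W x)‖ := Eventually.of_forall fun x => by
    rw [norm_algebraMap_eq]; exact hD x
  have h3 : MemLp D 2 := h1.of_le_mul hT.1.aestronglyMeasurable hb
  obtain ⟨h, hh, hTh, he⟩ := hT.exists_fourier_of_memLp_two h3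
  have hth := ht.ae_eq hTh
  refine ⟨hh.ae_eq hth.symm, ?_⟩
  rw [eLpNorm_congr_ae hth, he, ← h2]
  exact eLpNorm_le_mul_eLpNorm_of_ae_le_mul hb 2

end WeightedFourierSpace

open WeightedFourierSpace in
/-- The continuous function that represents a solution is the canonical one. -/
theorem IsSolution.exists_val {𝕜 : Type*} [RCLike 𝕜] [NormedAlgebra 𝕜 ℂ] {d : ℕ} [NeZero d]
    {w : FourierWeight d} (hw : Integrable fun ξ => (w.toFun ξ)⁻¹) {φ : Space d → ℝ} {γ : ℝ}
    {ζ ψ : 𝕜 → 𝕜} {ρ : ℝ} {f : 𝓢'(Space d, ℂ)} {u : WeightedFourierSpace 𝕜 w}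
    (h : IsSolution φ γ ζ ψ ρ f (distribution u)) :
    (∀ x, ‖val u x‖ < ρ) ∧ ∃ Z P Q : 𝓢'(Space d, ℂ),
      IsFunction Z (fun x => algebraMap 𝕜 ℂ (ζ (val u x))) ∧
      IsFunction P (fun x => algebraMap 𝕜 ℂ (ψ (val u x))) ∧
      IsMultiplierImage φ P Q ∧
      -(γ : ℂ) • ∂_{EuclideanSpace.single (0 : Fin d) (1 : ℝ)} Z + Q = f := by
  obtain ⟨v, hv, hvρ, hvu, h⟩ := h
  have hc : Continuous (algebraMap 𝕜 ℂ) :=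
    (AddMonoidHomClass.isometry_of_norm (algebraMap 𝕜 ℂ) (by simp)).continuous
  have h1 := (Continuous.ae_eq_iff_eq volume (hc.comp hv) (hc.comp (continuous_val hw u))).1
    (hvu.ae_eq (isFunction_val hw u))
  have h2 : v = val u := funext fun x => (algebraMap 𝕜 ℂ).injective (congrFun h1 x)
  subst h2
  exact ⟨hvρ, h⟩

namespace WeightedFourierSpace

/-- Small solutions are unique. -/
theorem eq_of_isSolution {𝕜 : Type*} [RCLike 𝕜] [NormedAlgebra 𝕜 ℂ] {d : ℕ} [NeZero d]
    {w : FourierWeight d} (h : w.IsAlgebra) {n : ℕ} (hn : 0 < n)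
    (hq : ∀ u : WeightedFourierSpace 𝕜 w,
      ∫⁻ ξ, ‖fourierFun u ξ‖ₑ ^ (2 * n / (2 * n - 1) : ℝ) < ⊤)
    {φ : Space d → ℝ} {γ α β : ℝ} (hγ : γ ≠ 0) (hα : α ≠ 0) (hβ : β ≠ 0) {R ρ : ℝ} (hρ : 0 < ρ)
    (hρR : ρ < R) {ζ ψ : 𝕜 → 𝕜} {p q : FormalMultilinearSeries 𝕜 𝕜 𝕜}
    (hζ : HasFPowerSeriesOnBall ζ p 0 (ENNReal.ofReal R))
    (hψ : HasFPowerSeriesOnBall ψ q 0 (ENNReal.ofReal R))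
    (hζ' : HasDerivAt ζ (α : 𝕜) 0) (hψ' : HasDerivAt ψ (β : 𝕜) 0)
    (hζL : ∀ z z' : 𝕜, ‖z‖ < ρ → ‖z'‖ < ρ →
      ‖ζ z - ζ z' - α * (z - z')‖ ≤ |α| / 4 * ‖z - z'‖)
    (hψL : ∀ z z' : 𝕜, ‖z‖ < ρ → ‖z'‖ < ρ →
      ‖ψ z - ψ z' - β * (z - z')‖ ≤ |β| / 4 * ‖z - z'‖)
    {f : 𝓢'(Space d, ℂ)} {u v : WeightedFourierSpace 𝕜 w}
    (hu : IsSolution φ γ ζ ψ ρ f (distribution u))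
    (hv : IsSolution φ γ ζ ψ ρ f (distribution v)) : u = v := by
  have hw := h.integrable_inv
  obtain ⟨hu1, Z₁, P₁, Q₁, hZ₁, hP₁, ⟨p₁, hp₁, hQ₁⟩, he₁⟩ := hu.exists_val hw
  obtain ⟨hv1, Z₂, P₂, Q₂, hZ₂, hP₂, ⟨p₂, hp₂, hQ₂⟩, he₂⟩ := hv.exists_val hw
  set W := u - v with hWdef
  have hWv := isFunction_val hw W
  have hTζ : IsFunction (Z₁ - Z₂ - (α : ℂ) • distribution W) fun x =>
      algebraMap 𝕜 ℂ (ζ (val u x) - ζ (val v x) - α * (val u x - val v x)) := by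
    convert! (hZ₁.sub hZ₂).sub (hWv.smul α) using 1
    funext x
    simp [val_sub hw, hWdef, algebraMap_ofReal]
  have hTψ : IsFunction (P₁ - P₂ - (β : ℂ) • distribution W) fun x =>
      algebraMap 𝕜 ℂ (ψ (val u x) - ψ (val v x) - β * (val u x - val v x)) := by
    convert! (hP₁.sub hP₂).sub (hWv.smul β) using 1
    funext x
    simp [val_sub hw, hWdef, algebraMap_ofReal]
  obtain ⟨t, k₁, G₁, ht, hG₁, htb⟩ :=
    exists_enorm_fourier_sub_le h hn hq hρ hρR hζ hζ' hu1 hv1 hTζ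
  obtain ⟨y, k₂, G₂, hy, hG₂, hyb⟩ :=
    exists_enorm_fourier_sub_le h hn hq hρ hρR hψ hψ' hu1 hv1 hTψ
  have hWF := isFunction_fourierFun W
  have hZF : IsFunction (𝓕 (Z₁ - Z₂)) (t + (α : ℂ) • fourierFun W) := by
    have h1 := ht.add (hWF.smul α)
    rwa [← FourierTransform.fourier_smul, ← FourierTransform.fourier_add, sub_add_cancel] at h1
  have hPF : IsFunction (𝓕 (P₁ - P₂)) (y + (β : ℂ) • fourierFun W) := by
    have h1 := hy.add (hWF.smul β)
    rwa [← FourierTransform.fourier_smul, ← FourierTransform.fourier_add, sub_add_cancel] at h1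
  have hPF' : IsFunction (𝓕 (P₁ - P₂)) (p₁ - p₂) := hp₁.fourier_sub hp₂
  have hEq : (γ : ℂ) • ∂_{EuclideanSpace.single (0 : Fin d) (1 : ℝ)} (Z₁ - Z₂) = Q₁ - Q₂ := by
    rw [sub_eq_add_neg Z₁, lineDerivOp_add, lineDerivOp_neg, ← sub_eq_add_neg, smul_sub]
    rw [← he₂] at he₁
    have hns : ∀ T : 𝓢'(Space d, ℂ), -(γ : ℂ) • T = -((γ : ℂ) • T) := fun T => neg_smul _ T
    rw [hns, hns, neg_add_eq_sub, neg_add_eq_sub, sub_eq_sub_iff_add_eq_add] at he₁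
    rw [sub_eq_sub_iff_add_eq_add, add_comm, ← he₁, add_comm]
  -- The difference of the two equations: the linear parts `αŴ` and `βŴ` combine into the symbol,
  -- and `t`, `y` are the transforms of the nonlinear differences.
  have hsym : ∀ᵐ ξ, linearSymbol φ γ α β ξ * fourierFun W ξ =
      2 * Real.pi * Complex.I * γ * ξ 0 * t ξ - φ ξ * y ξ := by
    have h1 := (hZF.fourier_lineDeriv_coord).smul γ
    rw [← FourierTransform.fourier_smul, hEq] at h1
    filter_upwards [h1.ae_eq (hQ₁.fourier_sub hQ₂), hPF.ae_eq hPF'] with ξ h2 h3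
    simp only [Pi.smul_apply, Pi.add_apply, Pi.sub_apply, smul_eq_mul] at h2 h3
    rw [linearSymbol]
    linear_combination -h2 + φ ξ * h3
  have hbound : ∀ᵐ ξ, ‖fourierFun W ξ‖ ≤ |α|⁻¹ * ‖t ξ‖ + |β|⁻¹ * ‖y ξ‖ := by
    -- Almost every `ξ` has `ξ₁ ≠ 0`, where the symbol is nonzero whatever `φ` does.
    filter_upwards [hsym, ae_coord_ne (d := d) 0 0] with ξ h1 h2
    exact norm_le_of_linearSymbol_mul_eq hα hβ
      (linearSymbol_ne_zero hγ hα hβ fun h0 => absurd h0 h2) h1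
  have hW2 : MemLp (fourierFun W) 2 := by
    refine memLp_fourierFun_of_le_lconv hw hn hq hG₁ hG₂ (k₁ := k₁) (k₂ := k₂)
      (a := ENNReal.ofReal |α|⁻¹) (b := ENNReal.ofReal |β|⁻¹) ENNReal.ofReal_ne_top
      ENNReal.ofReal_ne_top ?_
    filter_upwards [hbound, htb, hyb] with ξ h1 h2 h3
    calc ‖fourierFun W ξ‖ₑ ≤ ENNReal.ofReal |α|⁻¹ * ‖t ξ‖ₑ + ENNReal.ofReal |β|⁻¹ * ‖y ξ‖ₑ := by
          rw [← ofReal_norm, ← ofReal_norm, ← ofReal_norm, ← ENNReal.ofReal_mul (by positivity),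
            ← ENNReal.ofReal_mul (by positivity), ← ENNReal.ofReal_add (by positivity)
            (by positivity)]
          exact ENNReal.ofReal_le_ofReal h1
      _ ≤ _ := by gcongr
  obtain ⟨ht2, htn⟩ := eLpNorm_fourier_le_of_norm_le hw hW2 hTζ (c := |α| / 4) (fun x => by
    rw [norm_algebraMap_eq, hWdef, val_sub hw]
    exact hζL _ _ (hu1 x) (hv1 x)) ht
  obtain ⟨hy2, hyn⟩ := eLpNorm_fourier_le_of_norm_le hw hW2 hTψ (c := |β| / 4) (fun x => by
    rw [norm_algebraMap_eq, hWdef, val_sub hw]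
    exact hψL _ _ (hu1 x) (hv1 x)) hy
  set N := eLpNorm (fourierFun W) 2 volume with hN
  -- The Lipschitz constants `|α|/4` and `|β|/4` cancel the factors `|α|⁻¹` and `|β|⁻¹`: each
  -- nonlinear term contributes a quarter of the norm.
  have hscale : ∀ {c : ℝ} {g : Space d → ℂ}, c ≠ 0 →
      eLpNorm g 2 volume ≤ ENNReal.ofReal (|c| / 4) * N →
      eLpNorm (fun ξ => |c|⁻¹ * ‖g ξ‖) 2 volume ≤ ENNReal.ofReal (1 / 4) * N := by
    intro c g hc hg
    have hc' := abs_pos.2 hc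
    have h1 : eLpNorm (fun ξ => |c|⁻¹ * ‖g ξ‖) 2 volume ≤
        ENNReal.ofReal |c|⁻¹ * eLpNorm g 2 volume :=
      eLpNorm_le_mul_eLpNorm_of_ae_le_mul (Eventually.of_forall fun ξ => by
        rw [Real.norm_of_nonneg (by positivity)]) 2
    refine h1.trans ((mul_le_mul_right hg _).trans_eq ?_)
    rw [← mul_assoc, ← ENNReal.ofReal_mul (by positivity)]
    congr 2
    field_simp
  have hN2 : N ≤ ENNReal.ofReal (1 / 4) * N + ENNReal.ofReal (1 / 4) * N := by
    calc N ≤ eLpNorm ((fun ξ => |α|⁻¹ * ‖t ξ‖) + fun ξ => |β|⁻¹ * ‖y ξ‖) 2 volume :=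
          eLpNorm_mono_ae_real hbound
      _ ≤ _ := eLpNorm_add_le (ht2.norm.const_mul _).1 (hy2.norm.const_mul _).1 one_le_two
      _ ≤ _ := add_le_add (hscale hα htn) (hscale hβ hyn)
  have hN0 : N = 0 := by
    -- Without this finiteness, which is the purpose of the bootstrap, `N ≤ N/2` would not force `N
    -- = 0`.
    have hfin : N ≠ ⊤ := hW2.2.ne
    rw [← ENNReal.ofReal_toReal hfin, ← ENNReal.ofReal_mul (by norm_num),
      ← ENNReal.ofReal_add (by positivity) (by positivity),
      ENNReal.ofReal_le_ofReal_iff (by positivity)] at hN2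
    have h0 : N.toReal = 0 := le_antisymm (by linarith) ENNReal.toReal_nonneg
    exact ((ENNReal.toReal_eq_zero_iff N).1 h0).resolve_right hfin
  have hW0 : fourierFun W =ᵐ[volume] 0 :=
    (eLpNorm_eq_zero_iff hW2.1 two_ne_zero).1 hN0
  refine ext_fourierFun ?_
  filter_upwards [hW0, fourierFun_sub u v] with ξ h1 h2
  rw [h1] at h2
  exact (sub_eq_zero.1 h2.symm)

end WeightedFourierSpace

/-! ### Existence, and the main theorem -/

/-- An analytic perturbation of the identity has an analytic right inverse near the origin, with
values in a prescribed neighbourhood. -/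
theorem exists_analytic_rightInverse {𝕜 X : Type*} [RCLike 𝕜] [NormedAddCommGroup X]
    [NormedSpace 𝕜 X] [CompleteSpace X] {F : X → X} (hF : AnalyticAt 𝕜 F 0) (hF₀ : F 0 = 0)
    (hF' : HasStrictFDerivAt F (ContinuousLinearMap.id 𝕜 X) 0) {V : Set X} (hV : V ∈ 𝓝 0) :
    ∃ (W : Set X) (G : X → X), IsOpen W ∧ 0 ∈ W ∧ AnalyticOnNhd 𝕜 G W ∧
      ∀ y ∈ W, F (G y) = y ∧ G y ∈ V := by
  have hF'' : HasStrictFDerivAt F ((ContinuousLinearEquiv.refl 𝕜 X : X ≃L[𝕜] X) : X →L[𝕜] X) 0 :=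
    hF'
  let e := hF''.toOpenPartialHomeomorph F
  have he : (e : X → X) = F := rfl
  have h0 : (0 : X) ∈ e.source := hF''.mem_toOpenPartialHomeomorph_source
  have h0t : (0 : X) ∈ e.target := by
    have := e.map_source h0
    rwa [he, hF₀] at this
  have h0s : e.symm 0 = 0 := by
    have := e.left_inv h0
    rwa [he, hF₀] at this
  have ha : AnalyticAt 𝕜 e.symm 0 := by
    have hd : fderiv 𝕜 e 0 =
        ((ContinuousLinearEquiv.refl 𝕜 X : X ≃L[𝕜] X) : X →L[𝕜] X) := hF''.hasFDerivAt.fderiv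
    have := e.analyticAt_symm' h0 (h := hF) (i := ContinuousLinearEquiv.refl 𝕜 X) hd
    rwa [he, hF₀] at this
  have hVs : ∀ᶠ y in 𝓝 (0 : X), e.symm y ∈ V :=
    ha.continuousAt.eventually_mem (by rwa [h0s])
  obtain ⟨W, hW, hWo, hW0⟩ := eventually_nhds_iff.1
    (ha.eventually_analyticAt.and (hVs.and (e.open_target.mem_nhds h0t)))
  exact ⟨W, e.symm, hWo, hW0, fun y hy => (hW y hy).1,
    fun y hy => ⟨e.right_inv (hW y hy).2.2, (hW y hy).2.1⟩⟩

namespace WeightedFourierSpace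

/-- A solution of the equation on the Fourier side is a solution of the equation. -/
theorem isSolution_of_fourierFun {𝕜 : Type*} [RCLike 𝕜] [NormedAlgebra 𝕜 ℂ] {d : ℕ} [NeZero d]
    {w w' : FourierWeight d} (hw : Integrable fun ξ => (w.toFun ξ)⁻¹)
    {φ : Space d → ℝ} {γ α β ρ : ℝ} {ζ ψ : 𝕜 → 𝕜} {u a b : WeightedFourierSpace 𝕜 w}
    (hu : ∀ x, ‖val u x‖ < ρ) (ha : ∀ x, val a x = ζ (val u x) - α * val u x)
    (hb : ∀ x, val b x = ψ (val u x) - β * val u x) {f : WeightedFourierSpace 𝕜 w'}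
    (h : ∀ᵐ ξ, linearSymbol φ γ α β ξ * fourierFun u ξ =
      fourierFun f ξ + 2 * Real.pi * Complex.I * γ * ξ 0 * fourierFun a ξ -
        φ ξ * fourierFun b ξ) :
    IsSolution φ γ ζ ψ ρ (distribution f) (distribution u) := by
  set Z := (α : ℂ) • distribution u + distribution a with hZ
  set P := (β : ℂ) • distribution u + distribution b with hP
  have hZf : IsFunction Z fun x => algebraMap 𝕜 ℂ (ζ (val u x)) := by
    convert! ((isFunction_val hw u).smul α).add (isFunction_val hw a) using 1
    funext x
    simp [ha, algebraMap_ofReal]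
  have hPf : IsFunction P fun x => algebraMap 𝕜 ℂ (ψ (val u x)) := by
    convert! ((isFunction_val hw u).smul β).add (isFunction_val hw b) using 1
    funext x
    simp [hb, algebraMap_ofReal]
  have hZF : IsFunction (𝓕 Z) ((α : ℂ) • fourierFun u + fourierFun a) := by
    rw [hZ, FourierTransform.fourier_add, FourierTransform.fourier_smul]
    exact ((isFunction_fourierFun u).smul _).add (isFunction_fourierFun a)
  have hPF : IsFunction (𝓕 P) ((β : ℂ) • fourierFun u + fourierFun b) := by
    rw [hP, FourierTransform.fourier_add, FourierTransform.fourier_smul]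
    exact ((isFunction_fourierFun u).smul _).add (isFunction_fourierFun b)
  -- `Q` is defined by the equation itself; the content is that its transform equals `φ` times that
  -- of `P`.
  refine ⟨val u, continuous_val hw u, hu, isFunction_val hw u, Z, P,
    distribution f + (γ : ℂ) • ∂_{EuclideanSpace.single (0 : Fin d) (1 : ℝ)} Z, hZf, hPf,
    ⟨_, hPF, ?_⟩, ?_⟩
  · rw [FourierTransform.fourier_add, FourierTransform.fourier_smul]
    refine ((isFunction_fourierFun f).add (hZF.fourier_lineDeriv_coord.smul γ)).congr ?_
    filter_upwards [h] with ξ h1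
    simp only [Pi.add_apply, Pi.smul_apply, smul_eq_mul]
    rw [linearSymbol] at h1
    linear_combination -h1
  · have hns : ∀ T : 𝓢'(Space d, ℂ), -(γ : ℂ) • T = -((γ : ℂ) • T) := fun T => neg_smul _ T
    rw [hns]
    abel

end WeightedFourierSpace

/-- Near a point, a function is approximated by its derivative on a small ball. -/
theorem HasStrictDerivAt.exists_norm_sub_sub_le {𝕜 : Type*} [RCLike 𝕜] {ζ : 𝕜 → 𝕜} {a : 𝕜}
    (h : HasStrictDerivAt ζ a 0) {ε : ℝ} (hε : 0 < ε) :
    ∃ ρ : ℝ, 0 < ρ ∧ ∀ z z' : 𝕜, ‖z‖ < ρ → ‖z'‖ < ρ →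
      ‖ζ z - ζ z' - a * (z - z')‖ ≤ ε * ‖z - z'‖ := by
  obtain ⟨ρ, hρ, H⟩ := Metric.eventually_nhds_iff.1 (h.isLittleO.bound hε)
  refine ⟨ρ, hρ, fun z z' hz hz' => ?_⟩
  have h1 := H (y := (z, z')) (by
    rw [Prod.dist_eq]
    simpa using ⟨hz, hz'⟩)
  simpa [mul_comm] using h1

theorem mainTheorem10 {𝕜 : Type*} [RCLike 𝕜] [NormedAlgebra 𝕜 ℂ] {d : ℕ} [NeZero d] (hd : 2 ≤ d)
    {s r δ σ : ℝ} (hδ : 1 < δ) (hdim : 1 + δ - 2 * r < (d : ℝ)) (hr₀ : 0 ≤ r) (hr₁ : r ≤ 1)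
    (hσs : σ ≤ s) (hrs : 1 - r ≤ s) (hsσ : (d : ℝ) / 2 < s + σ) (hδ₂ : d = 2 → δ ≤ 2)
    {γ : ℝ} (hγ : γ ≠ 0)
    {φ : Space d → ℝ} (hφ_cont : Continuous φ) (hφ_nonneg : ∀ ξ, 0 ≤ φ ξ)
    (hφ_low : φ =Θ[𝓝 0] fun ξ => ‖ξ‖ ^ δ)
    (hφ_high : φ =Θ[cocompact (Space d)] fun ξ => ‖ξ‖ ^ σ)
    (hφ_ne : ∀ ξ : Space d, ξ ≠ 0 → ξ 0 = 0 → φ ξ ≠ 0)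
    (hφ_even : (RCLike.I : 𝕜) = 0 → ∀ ξ, φ (-ξ) = φ ξ)
    {R : ℝ} (hR : 0 < R) {ζ ψ : 𝕜 → 𝕜} {p q : FormalMultilinearSeries 𝕜 𝕜 𝕜}
    (hζ : HasFPowerSeriesOnBall ζ p 0 (ENNReal.ofReal R))
    (hψ : HasFPowerSeriesOnBall ψ q 0 (ENNReal.ofReal R))
    (hζ₀ : ζ 0 = 0) (hψ₀ : ψ 0 = 0)
    {α β : ℝ} (hα : α ≠ 0) (hβ : β ≠ 0)
    (hζ' : HasDerivAt ζ (α : 𝕜) 0) (hψ' : HasDerivAt ψ (β : 𝕜) 0) :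
    ∃ ρ : ℝ, 0 < ρ ∧ ρ ≤ R ∧
      ∃ U : Set (SobolevInter 𝕜 d s r), IsOpen U ∧ 0 ∈ U ∧
        (∀ f ∈ U, ∃! u : XSpace 𝕜 d (s + σ) r δ,
          IsSolution φ γ ζ ψ ρ f.distribution u.distribution) ∧
        ∃ Φ : SobolevInter 𝕜 d s r → XSpace 𝕜 d (s + σ) r δ,
          (∀ f ∈ U, IsSolution φ γ ζ ψ ρ f.distribution (Φ f).distribution) ∧
          AnalyticOnNhd 𝕜 Φ U := by
  have hα' := abs_pos.2 hα
  have hβ' := abs_pos.2 hβ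
  set w := anisotropicWeight d (s + σ) r δ with hwdef
  have hA : w.IsAlgebra := isAlgebra_anisotropicWeight hd hδ hdim hr₀ hr₁ hδ₂ hsσ
  have hw := hA.integrable_inv
  have := WeightedFourierSpace.completeSpace (𝕜 := 𝕜) hw
  obtain ⟨ρ₁, hρ₁, hζL⟩ := (hζ.hasFPowerSeriesAt.hasStrictDerivAt.congr_deriv
    (hζ.hasFPowerSeriesAt.hasDerivAt.unique hζ')).exists_norm_sub_sub_le
      (show 0 < |α| / 4 by positivity)
  obtain ⟨ρ₂, hρ₂, hψL⟩ := (hψ.hasFPowerSeriesAt.hasStrictDerivAt.congr_deriv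
    (hψ.hasFPowerSeriesAt.hasDerivAt.unique hψ')).exists_norm_sub_sub_le
      (show 0 < |β| / 4 by positivity)
  -- `R / 2` keeps `ρ` strictly inside the disc of convergence, as the Taylor remainder bound
  -- requires; `ρ₁` and `ρ₂` give the Lipschitz constants of the uniqueness argument.
  set ρ := min (R / 2) (min ρ₁ ρ₂) with hρdef
  have hρ : 0 < ρ := by positivity
  have hρR : ρ < R := (min_le_left _ _).trans_lt (by linarith)
  have hρ₁' : ρ ≤ ρ₁ := (min_le_right _ _).trans (min_le_left _ _)
  have hρ₂' : ρ ≤ ρ₂ := (min_le_right _ _).trans (min_le_right _ _)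
  -- With `τ = 1/j` this gives `4δτ ≤ 2r + d - 1 - δ`, so `w^{-(1+1/j)}` is integrable and
  -- transforms lie in `L^q` with `q = 2n/(2n-1)`, `n = j + 1`.
  obtain ⟨j, hj⟩ := exists_nat_gt (4 * δ / (2 * r + d - 1 - δ))
  have hκ : 0 < 2 * r + d - 1 - δ := by linarith
  have hj0 : (0 : ℝ) < j := lt_of_le_of_lt (by positivity) hj
  have hq : ∀ u : WeightedFourierSpace 𝕜 w, ∫⁻ ξ, ‖WeightedFourierSpace.fourierFun u ξ‖ₑ ^
      (2 * ((j + 1 : ℕ) : ℝ) / (2 * ((j + 1 : ℕ) : ℝ) - 1)) < ⊤ := fun u =>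
    w.lintegral_rpow_lt_top (by exact_mod_cast hj0)
      (lintegral_anisotropicWeight_rpow_lt_top hδ hdim hr₀ hsσ (by positivity) (by
        rw [mul_one_div, div_le_iff₀ hj0]
        rw [div_lt_iff₀ hκ] at hj
        linarith))
      (WeightedFourierSpace.integrable_fourierFun u)
  set m := linearSymbol φ γ α β with hm
  have hmc : Continuous m := continuous_linearSymbol hφ_cont
  have hm0 : ∀ ξ : Space d, ξ ≠ 0 → m ξ ≠ 0 := fun ξ hξ =>
    linearSymbol_ne_zero hγ hα hβ (hφ_ne ξ hξ)
  have hne : ∀ᵐ ξ : Space d, ξ ≠ 0 := Measure.ae_ne volume 0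
  have hmh : (RCLike.I : 𝕜) = 0 → ∀ ξ, m (-ξ) = (starRingEnd ℂ) (m ξ) := fun hI ξ =>
    linearSymbol_neg (hφ_even hI) ξ
  obtain ⟨C, hC⟩ := exists_anisotropicWeight_le (s := s) (r := r) hγ hα hβ hφ_cont hφ_low hφ_high
    hφ_ne
  obtain ⟨A, hAf⟩ := WeightedFourierSpace.exists_multiplier (𝕜 := 𝕜)
    (w := sobolevWeight d s r) (b := fun ξ => (m ξ)⁻¹) hw hmc.measurable.inv.aestronglyMeasurable
    (fun hI => Eventually.of_forall fun ξ => by beta_reduce; rw [hmh hI, map_inv₀])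
    (by filter_upwards [hne] with ξ hξ using hC ξ hξ)
  obtain ⟨B₁, hB₁⟩ := WeightedFourierSpace.exists_multiplier (𝕜 := 𝕜) (w := w)
    (b := fun ξ => 2 * Real.pi * Complex.I * γ * ξ 0 / m ξ) (C := (|α|⁻¹) ^ 2) hw
    (Measurable.div (by fun_prop) hmc.measurable).aestronglyMeasurable
    (fun hI => Eventually.of_forall fun ξ => by
      have h2 : (starRingEnd ℂ) 2 = 2 := map_ofNat _ 2
      beta_reduce
      rw [hmh hI, map_div₀]
      simp [h2])
    (by
      filter_upwards [hne, w.pos] with ξ hξ hwξ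
      rw [mul_comm]
      gcongr
      have h1 := norm_pos_iff.2 (hm0 ξ hξ)
      have h2 : ‖2 * Real.pi * Complex.I * γ * ξ 0‖ = 2 * Real.pi * |γ| * |ξ 0| := by
        simp [abs_of_pos Real.pi_pos]
      rw [norm_div, h2, div_le_iff₀ h1, ← div_eq_inv_mul, le_div_iff₀' hα']
      exact abs_mul_coord_le_norm_linearSymbol ξ)
  obtain ⟨B₂, hB₂⟩ := WeightedFourierSpace.exists_multiplier (𝕜 := 𝕜) (w := w)
    (b := fun ξ => φ ξ / m ξ) (C := (|β|⁻¹) ^ 2) hw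
    (Measurable.div (by fun_prop) hmc.measurable).aestronglyMeasurable
    (fun hI => Eventually.of_forall fun ξ => by
      beta_reduce
      rw [hmh hI, map_div₀, hφ_even hI, Complex.conj_ofReal])
    (by
      filter_upwards [hne, w.pos] with ξ hξ hwξ
      rw [mul_comm]
      gcongr
      have h1 := norm_pos_iff.2 (hm0 ξ hξ)
      rw [norm_div, Complex.norm_real, Real.norm_eq_abs, div_le_iff₀ h1, ← div_eq_inv_mul,
        le_div_iff₀' hβ']
      exact abs_mul_le_norm_linearSymbol ξ)
  obtain ⟨N₁, hN₁a, hN₁d, hN₁0, hN₁⟩ :=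
    WeightedFourierSpace.exists_nonlinearity hA hR hζ hζ₀ hζ'
  obtain ⟨N₂, hN₂a, hN₂d, hN₂0, hN₂⟩ :=
    WeightedFourierSpace.exists_nonlinearity hA hR hψ hψ₀ hψ'
  have hball : ∀ᶠ u in 𝓝 (0 : WeightedFourierSpace 𝕜 w),
      ∀ x, ‖WeightedFourierSpace.val u x‖ < ρ := by
    obtain ⟨C, hC0, hC⟩ := WeightedFourierSpace.exists_norm_val_le (𝕜 := 𝕜) hw
    filter_upwards [Metric.ball_mem_nhds (0 : WeightedFourierSpace 𝕜 w)
      (show 0 < ρ / (C + 1) by positivity)] with u hu x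
    rw [mem_ball_zero_iff, lt_div_iff₀ (by positivity)] at hu
    refine (hC u x).trans_lt (lt_of_le_of_lt ?_ hu)
    nlinarith [norm_nonneg u]
  -- After division by the symbol the equation reads `F u = A f`.
  let F : WeightedFourierSpace 𝕜 w → WeightedFourierSpace 𝕜 w :=
    fun u => u - B₁ (N₁ u) + B₂ (N₂ u)
  have hFa : AnalyticAt 𝕜 F 0 := by
    have h1 : AnalyticAt 𝕜 (fun u => B₁ (N₁ u)) 0 := (B₁.analyticAt _).comp hN₁a
    have h2 : AnalyticAt 𝕜 (fun u => B₂ (N₂ u)) 0 := (B₂.analyticAt _).comp hN₂a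
    exact (analyticAt_id.sub h1).add h2
  have hF0 : F 0 = 0 := by simp [F, hN₁0, hN₂0]
  have hFd : HasStrictFDerivAt F (ContinuousLinearMap.id 𝕜 (WeightedFourierSpace 𝕜 w)) 0 := by
    have h1 : HasStrictFDerivAt (fun u => B₁ (N₁ u))
        (B₁.comp (0 : WeightedFourierSpace 𝕜 w →L[𝕜] WeightedFourierSpace 𝕜 w)) 0 :=
      B₁.hasStrictFDerivAt.comp 0 hN₁d
    have h2 : HasStrictFDerivAt (fun u => B₂ (N₂ u))
        (B₂.comp (0 : WeightedFourierSpace 𝕜 w →L[𝕜] WeightedFourierSpace 𝕜 w)) 0 :=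
      B₂.hasStrictFDerivAt.comp 0 hN₂d
    refine (((hasStrictFDerivAt_id 0).sub h1).add h2).congr_fderiv ?_
    simp
  -- The inverse takes values where `|u| < ρ` and where the abstract maps `N₁`, `N₂` agree with the
  -- pointwise nonlinearities.
  obtain ⟨W, G, hWo, hW0, hGa, hG⟩ := exists_analytic_rightInverse hFa hF0 hFd
    (hball.and (hN₁.and hN₂))
  have hsol : ∀ f ∈ A ⁻¹' W, IsSolution φ γ ζ ψ ρ f.distribution (G (A f)).distribution := by
    intro f hf
    obtain ⟨hFG, hu, h₁, h₂⟩ := hG _ hf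
    refine WeightedFourierSpace.isSolution_of_fourierFun hw hu h₁ h₂ ?_
    set u := G (A f) with hudef
    have e1 := WeightedFourierSpace.fourierFun_add (u - B₁ (N₁ u)) (B₂ (N₂ u))
    have e2 := WeightedFourierSpace.fourierFun_sub u (B₁ (N₁ u))
    have hFG' : u - B₁ (N₁ u) + B₂ (N₂ u) = A f := hFG
    rw [hFG'] at e1
    filter_upwards [e1, e2, hAf f, hB₁ (N₁ u), hB₂ (N₂ u), hne] with ξ e1 e2 e3 e4 e5 hξ
    rw [Pi.add_apply, e2, Pi.sub_apply, e3, e4, e5] at e1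
    have hmξ := hm0 ξ hξ
    field_simp at e1
    linear_combination -e1
  refine ⟨ρ, hρ, hρR.le, A ⁻¹' W, hWo.preimage A.continuous, by simpa using hW0, fun f hf =>
    ⟨G (A f), hsol f hf, fun u hu => ?_⟩, fun f => G (A f), hsol, fun f hf =>
      AnalyticAt.comp (hGa _ hf) (A.analyticAt f)⟩
  exact WeightedFourierSpace.eq_of_isSolution hA (Nat.succ_pos j) hq hγ hα hβ hρ hρR hζ hψ hζ' hψ'
    (fun z z' hz hz' => hζL z z' (hz.trans_le hρ₁') (hz'.trans_le hρ₁'))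
    (fun z z' hz hz' => hψL z z' (hz.trans_le hρ₂') (hz'.trans_le hρ₂')) hu (hsol f hf)
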